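/- Let $\mathbb{T}=\mathbb{R}/2\pi\mathbb{Z}$. For $l\in\mathbb{Z}\setminus\{0\}$ and $\alpha\in\mathbb{R}$ define in the complex Hilbert space $L^2(\mathbb{T})$ the operators \[ A_l=\partial_y^2-l^2,\quad D(A_l)=W^{2,2}(\mathbb{T}),\qquad \hat\Lambda_l=M_{\sin y}(I+A_l^{-1}),\quad D(\hat\Lambda_l)=L^2(\mathbb{T}),\qquad L_{\alpha,l}=A_l-i\alpha l\,\hat\Lambda_l,\quad D(L_{\alpha,l})=W^{2,2}(\mathbb{T}), \] where $M_{\sin y}$ is multiplication by $\sin y$. Let $Y_l=\{f\in L^2(\mathbb{T}) : \int_0^{2\pi} f\,dy=0\}$ if $l=\pm1$ and $Y_l=L^2(\mathbb{T})$ if $|l|\ge 2$, let $\mathbb{Q}_l$ be the orthogonal projection of $L^2(\mathbb{T})$ onto $Y_l$, and regard $\mathbb{Q}_lL_{\alpha,l}$ as an operator in $Y_l$ with domain $W^{2,2}(\mathbb{T})\cap Y_l$. There exist constants $c,C,\alpha_0>0$ such that for all $\alpha\in\mathbb{R}$ with $|\alpha|\ge\alpha_0$ and all $l\in\mathbb{Z}\setminus\{0\}$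 the following holds. Every $\zeta$ in the spectrum $\sigma(\mathbb{Q}_lL_{\alpha,l})$ satisfies \[ \operatorname{Re}\zeta\le -c\,|\alpha l|^{1/2}. \] Moreover, for every $\lambda\in\mathbb{R}$, with $\mu=\lambda/(\alpha l)$, the operator $i\lambda+\mathbb{Q}_lL_{\alpha,l}$ has a bounded inverse on $Y_l$, and \[ \|(i\lambda+\mathbb{Q}_lL_{\alpha,l})^{-1}\|_{Y_l\to Y_l}\le \begin{cases} \dfrac{C}{|\alpha l|\,(|\mu|-1)} & \text{if } |\mu|>1+|\alpha l|^{-1/2},\\[2mm] \dfrac{C}{|\alpha l|^{1/2}} & \text{if } 1-|\alpha l|^{-1/2}<|\mu|\le 1+|\alpha l|^{-1/2},\\[2mm] \dfrac{C}{|\alpha l|^{2/3}(1-|\mu|)^{1/3}} & \text{if } |\mu|\le 1-|\alpha l|^{-1/2}. \end{cases} \] -/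

import Mathlib

open MeasureTheory

noncomputable section

namespace Kolmogorov

/-! ### Bounded inverses and spectrum of an unbounded operator -/

section Unbounded

variable {E : Type*} [NormedAddCommGroup E] [NormedSpace ℂ E]

/-- `R` is the bounded, everywhere defined, two-sided inverse of the unbounded operator `S`. -/
def IsBoundedInverse (S : E →ₗ.[ℂ] E) (R : E →L[ℂ] E) : Prop :=
  (∀ f : E, ∃ h : R f ∈ S.domain, S ⟨R f, h⟩ = f) ∧ ∀ u : S.domain, R (S u) = u

/-- The operator `z + S` with domain `D(S)`. -/
def shift (z : ℂ) (S : E →ₗ.[ℂ] E) : E →ₗ.[ℂ] E :=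
  (z • (LinearMap.id : E →ₗ[ℂ] E)) +ᵥ S

/-- The spectrum of `S`: all `ζ` for which `ζ - S` has no bounded everywhere defined inverse. -/
def opSpectrum (S : E →ₗ.[ℂ] E) : Set ℂ :=
  {ζ | ¬ ∃ R : E →L[ℂ] E, IsBoundedInverse (shift ζ (-S)) R}

end Unbounded

/-! ### The torus and its Lebesgue space -/

instance factTwoPiPos : Fact (0 < 2 * Real.pi) := ⟨Real.two_pi_pos⟩

/-- The torus `𝕋 = ℝ / 2πℤ`. -/
abbrev Torus : Type := AddCircle (2 * Real.pi)

/-- The normalized measure `dy / 2π` on `𝕋`; the normalization does not affect operator norms. -/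
abbrev torusMeasure : Measure Torus := AddCircle.haarAddCircle

/-- The complex Hilbert space `L²(𝕋)`. -/
abbrev L2T : Type := Lp ℂ 2 torusMeasure

lemma integrable_mul (f : L2T) (ψ : C(Torus, ℂ)) :
    Integrable (fun y => f y * ψ y) torusMeasure := by
  have hf : Integrable f torusMeasure := (Lp.memLp f).integrable (by norm_num)
  exact hf.mul_bdd (c := ‖ψ‖) ψ.continuous.aestronglyMeasurable
    (Filter.Eventually.of_forall fun y => ψ.norm_coe_le_norm y)

/-! ### Weak derivatives and the operator `A_l` -/

/-- `g` is the weak derivative of `f`: `∫ f φ' = - ∫ g φ` for every smooth `φ` on `𝕋`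
(here `ψ` is the derivative of `φ`). -/
def IsWeakDeriv (f g : L2T) : Prop :=
  ∀ φ ψ : C(Torus, ℂ),
    ContDiff ℝ (⊤ : ℕ∞) (fun x : ℝ => φ (x : Torus)) →
    (∀ x : ℝ, HasDerivAt (fun x : ℝ => φ (x : Torus)) (ψ (x : Torus)) x) →
    ∫ y, f y * ψ y ∂torusMeasure = - ∫ y, g y * φ y ∂torusMeasure

lemma integral_add_mul (f g : L2T) (ψ : C(Torus, ℂ)) :
    ∫ y, (f + g : L2T) y * ψ y ∂torusMeasure =
      ∫ y, f y * ψ y ∂torusMeasure + ∫ y, g y * ψ y ∂torusMeasure := by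
  rw [← integral_add (integrable_mul f ψ) (integrable_mul g ψ)]
  refine integral_congr_ae ?_
  filter_upwards [Lp.coeFn_add f g] with y hy
  rw [hy, Pi.add_apply, add_mul]

lemma integral_smul_mul (c : ℂ) (f : L2T) (ψ : C(Torus, ℂ)) :
    ∫ y, (c • f : L2T) y * ψ y ∂torusMeasure = c * ∫ y, f y * ψ y ∂torusMeasure := by
  rw [← integral_const_mul]
  refine integral_congr_ae ?_
  filter_upwards [Lp.coeFn_smul c f] with y hy
  rw [hy, Pi.smul_apply, smul_eq_mul, mul_assoc]

lemma IsWeakDeriv.add {f g f' g' : L2T} (h : IsWeakDeriv f g) (h' : IsWeakDeriv f' g') :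
    IsWeakDeriv (f + f') (g + g') := by
  intro φ ψ hφ hψ
  rw [integral_add_mul, integral_add_mul, h φ ψ hφ hψ, h' φ ψ hφ hψ]
  ring

lemma IsWeakDeriv.smul (c : ℂ) {f g : L2T} (h : IsWeakDeriv f g) :
    IsWeakDeriv (c • f) (c • g) := by
  intro φ ψ hφ hψ
  rw [integral_smul_mul, integral_smul_mul, h φ ψ hφ hψ]
  ring

lemma integral_zero_mul (ψ : C(Torus, ℂ)) : ∫ y, (0 : L2T) y * ψ y ∂torusMeasure = 0 := by
  have h := integral_smul_mul 0 0 ψ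
  rwa [smul_zero, zero_mul] at h

lemma IsWeakDeriv.zero : IsWeakDeriv 0 0 := by
  intro φ ψ _ _
  rw [integral_zero_mul, integral_zero_mul, neg_zero]

lemma eq_zero_of_integral_fourier {g : L2T}
    (h : ∀ n : ℤ, ∫ y, g y * fourier n y ∂torusMeasure = 0) : g = 0 := by
  apply (fourierBasis (T := 2 * Real.pi)).repr.injective
  ext n
  rw [fourierBasis_repr, map_zero, fourierCoeff]
  simpa [mul_comm] using h (-n)

lemma hasDerivAt_fourier_torus (n : ℤ) (x : ℝ) :
    HasDerivAt (fun x : ℝ => (fourier n : C(Torus, ℂ)) (x : Torus))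
      (((Complex.I * n) • (fourier n : C(Torus, ℂ))) (x : Torus)) x := by
  have h := hasDerivAt_fourier (2 * Real.pi) n x
  convert h using 1
  have : (Real.pi : ℂ) ≠ 0 := by exact_mod_cast Real.pi_ne_zero
  simp only [ContinuousMap.smul_apply, smul_eq_mul]
  push_cast
  field_simp

lemma contDiff_fourier_torus (n : ℤ) :
    ContDiff ℝ (⊤ : ℕ∞) (fun x : ℝ => (fourier n : C(Torus, ℂ)) (x : Torus)) := by
  have : (fun x : ℝ => (fourier n : C(Torus, ℂ)) (x : Torus)) =
      fun x : ℝ => Complex.exp (2 * Real.pi * Complex.I * n * x / (2 * Real.pi : ℝ)) := by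
    funext x
    rw [fourier_coe_apply]
  rw [this]
  exact Complex.contDiff_exp.comp
    ((contDiff_const.mul Complex.ofRealCLM.contDiff).div_const _)

/-- Weak derivatives are unique. -/
lemma IsWeakDeriv.eq_zero {g : L2T} (h : IsWeakDeriv 0 g) : g = 0 := by
  refine eq_zero_of_integral_fourier fun n => ?_
  have h1 := h _ _ (contDiff_fourier_torus n) (hasDerivAt_fourier_torus n)
  rw [integral_zero_mul] at h1
  exact neg_eq_zero.mp h1.symm

/-- The graph of `A_l = ∂_y² - l²` with domain `W^{2,2}(𝕋)`: the pairs `(u, u'' - l² u)` such that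
`u ∈ L²` has weak derivatives `u', u'' ∈ L²`. -/
def graphA (l : ℤ) : Submodule ℂ (L2T × L2T) where
  carrier := {p | ∃ u' u'' : L2T, IsWeakDeriv p.1 u' ∧ IsWeakDeriv u' u'' ∧
    p.2 = u'' - ((l : ℂ) ^ 2) • p.1}
  zero_mem' := ⟨0, 0, IsWeakDeriv.zero, IsWeakDeriv.zero, by simp⟩
  add_mem' := by
    rintro p q ⟨u', u'', h1, h2, h3⟩ ⟨v', v'', k1, k2, k3⟩
    refine ⟨u' + v', u'' + v'', h1.add k1, h2.add k2, ?_⟩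
    rw [Prod.snd_add, Prod.fst_add, h3, k3, smul_add]
    abel
  smul_mem' := by
    rintro c p ⟨u', u'', h1, h2, h3⟩
    refine ⟨c • u', c • u'', h1.smul c, h2.smul c, ?_⟩
    rw [Prod.smul_snd, Prod.smul_fst, h3, smul_sub, smul_comm]

/-- The operator `A_l = ∂_y² - l²` in `L²(𝕋)` with domain `W^{2,2}(𝕋)`. -/
def opA (l : ℤ) : L2T →ₗ.[ℂ] L2T := (graphA l).toLinearPMap

/-- `opA l` is indeed the operator with graph `graphA l`. -/
lemma opA_graph (l : ℤ) : (opA l).graph = graphA l := by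
  refine Submodule.toLinearPMap_graph_eq _ ?_
  rintro ⟨p, q⟩ ⟨u', u'', h1, h2, h3⟩ (h0 : p = 0)
  subst h0
  obtain rfl := h1.eq_zero
  obtain rfl := h2.eq_zero
  simpa using h3

/-! ### The operators `Λ̂_l` and `L_{α,l}` -/

/-- The function `sin` on `𝕋`. -/
def sinT : C(Torus, ℝ) where
  toFun := Real.sin_periodic.lift
  continuous_toFun := continuous_coinduced_dom.mpr Real.continuous_sin

lemma sinT_coe (x : ℝ) : sinT (x : Torus) = Real.sin x := rfl

lemma memLp_sin_mul (f : L2T) :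
    MemLp (fun y => (sinT y : ℂ) * f y) 2 torusMeasure := by
  refine (Lp.memLp f).of_le ?_ (Filter.Eventually.of_forall fun y => ?_)
  · exact (Complex.continuous_ofReal.comp sinT.continuous).aestronglyMeasurable.mul
      (Lp.aestronglyMeasurable f)
  · induction y using QuotientAddGroup.induction_on with
    | H x =>
      rw [norm_mul]
      refine mul_le_of_le_one_left (norm_nonneg _) ?_
      rw [Complex.norm_real]
      exact Real.abs_sin_le_one x

/-- The multiplication operator `M_{sin y}` on `L²(𝕋)`. -/
def mulSin : L2T →ₗ[ℂ] L2T where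
  toFun f := (memLp_sin_mul f).toLp _
  map_add' f g := by
    rw [← MemLp.toLp_add, MemLp.toLp_eq_toLp_iff]
    filter_upwards [Lp.coeFn_add f g] with y hy
    rw [hy, Pi.add_apply, Pi.add_apply, mul_add]
  map_smul' c f := by
    rw [RingHom.id_apply, ← MemLp.toLp_const_smul, MemLp.toLp_eq_toLp_iff]
    filter_upwards [Lp.coeFn_smul c f] with y hy
    rw [hy, Pi.smul_apply, Pi.smul_apply, smul_eq_mul, smul_eq_mul]
    ring

/-- The operator `Λ̂_l = M_{sin y} (I + A_l⁻¹)`. -/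
def opLambda (l : ℤ) : L2T →ₗ.[ℂ] L2T :=
  mulSin.compPMap ((LinearMap.id : L2T →ₗ[ℂ] L2T) +ᵥ (opA l).inverse)

/-- The operator `L_{α,l} = A_l - i α l Λ̂_l`. -/
def opL (α : ℝ) (l : ℤ) : L2T →ₗ.[ℂ] L2T :=
  opA l - (Complex.I * α * l) • opLambda l

/-! ### The space `Y_l`, the projection `ℚ_l` and the operator `ℚ_l L_{α,l}` -/

lemma integral_eq_integral_mul_one (f : L2T) :
    ∫ y, f y ∂torusMeasure = ∫ y, f y * (1 : C(Torus, ℂ)) y ∂torusMeasure := by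
  simp

/-- `Y_l` is the space of mean-free functions in `L²(𝕋)` if `l = ±1`, and `L²(𝕋)` otherwise. -/
def spaceY (l : ℤ) : Submodule ℂ L2T where
  carrier := {f | |l| = 1 → ∫ y, f y ∂torusMeasure = 0}
  zero_mem' := fun _ => by rw [integral_eq_integral_mul_one, integral_zero_mul]
  add_mem' := fun {f g} hf hg h => by
    rw [integral_eq_integral_mul_one, integral_add_mul, ← integral_eq_integral_mul_one,
      ← integral_eq_integral_mul_one, hf h, hg h, add_zero]
  smul_mem' := fun c f hf h => by
    rw [integral_eq_integral_mul_one, integral_smul_mul, ← integral_eq_integral_mul_one,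
      hf h, mul_zero]

lemma isClosed_spaceY (l : ℤ) : IsClosed (spaceY l : Set L2T) := by
  have hc : Continuous fun f : L2T => ∫ y, f y ∂torusMeasure := by
    have h : ∀ f : L2T, ∫ y, f y ∂torusMeasure = inner ℂ (fourierLp (T := 2 * Real.pi) 2 0) f := by
      intro f
      rw [L2.inner_def]
      refine integral_congr_ae ?_
      filter_upwards [coeFn_fourierLp (T := 2 * Real.pi) 2 0] with y hy
      rw [hy]
      simp
    simp_rw [h]
    fun_prop
  by_cases h : |l| = 1
  · have : (spaceY l : Set L2T) = {f | ∫ y, f y ∂torusMeasure = 0} := by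
      ext f
      exact ⟨fun hf => hf h, fun hf _ => hf⟩
    rw [this]
    exact isClosed_eq hc continuous_const
  · have : (spaceY l : Set L2T) = Set.univ := by
      ext f
      exact ⟨fun _ => trivial, fun _ h' => absurd h' h⟩
    rw [this]
    exact isClosed_univ

instance completeSpace_spaceY (l : ℤ) : CompleteSpace (spaceY l) :=
  (isClosed_spaceY l).completeSpace_coe

/-- The orthogonal projection `ℚ_l` from `L²(𝕋)` onto `Y_l`. -/
def projQ (l : ℤ) : L2T →L[ℂ] spaceY l := (spaceY l).orthogonalProjectionOnto

/-- The operator `ℚ_l L_{α,l}` in `Y_l`, with domain `D(L_{α,l}) ∩ Y_l`. -/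
def opQL (α : ℝ) (l : ℤ) : spaceY l →ₗ.[ℂ] spaceY l where
  domain := (opL α l).domain.comap (spaceY l).subtype
  toFun := (projQ l : L2T →ₗ[ℂ] spaceY l) ∘ₗ (opL α l).toFun ∘ₗ
    (spaceY l).subtype.restrict (fun _ hu => hu)

end Kolmogorov

end

/-!
Writing `u = G g` with the compact Green operator `G = (-A_l)⁻¹`, the equation
`(z + ℚ_l L_{α,l}) u = f` becomes a compact perturbation of `-g = f`. By the Fredholm alternative
the resolvent exists as soon as an a priori estimate `‖u‖ ≤ M ‖f‖` holds, and that estimate bounds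
it. A bound that is uniform on the imaginary axis extends to a strip of width comparable to `1 / M`,
which is the spectral gap.

The multiplication by `sin` is symmetric, so pairing with `u - G u` gives the estimate for
`Re z ≤ 0`, as well as the one for `|μ| > 1`. Near and inside the range of `sin` only trigonometric
polynomials need to be considered, and after a translation by `π` one may take `μ > 0`. The stream
function `ψ`, with vorticity `ψ'' - l² ψ = u` up to a constant that absorbs `ℚ_l`, solves
`(sin - μ) (ψ'' - m ψ) + μ ψ = small` with `m = l² - 1`, a Rayleigh equation whose right-hand side
is controlled by the viscous term. The viscous term is balanced at the width `d` of the critical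
layer given by `|α l| √δ d³ = 1`, where `δ` is the larger of `1 - |μ|` and `|α l|^(-1/2)`. If the
estimate `‖u‖ ≤ C d² ‖f‖` failed, the right-hand side would be so small that the coercivity of the
Rayleigh equation, combined with a Hardy inequality at the maximum of `sin`, would force the
reduced vorticity `ψ'' - m ψ` to be small compared with itself.
-/

open MeasureTheory

noncomputable section

namespace Kolmogorov

open Real

/-! ### Integrals over one period -/

section PeriodIntegral

/-- The integral over one period of a `2π`-periodic function. -/
def periodInt (f : ℝ → ℝ) : ℝ := ∫ x in (0 : ℝ)..(2 * π), f x

/-- The `L²` norm over one period of a `2π`-periodic function, for the unnormalized measure. -/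
def periodNorm {E : Type*} [NormedAddCommGroup E] (f : ℝ → E) : ℝ :=
  √(periodInt fun x => ‖f x‖ ^ 2)

variable {E F : Type*} [NormedAddCommGroup E] [NormedAddCommGroup F]

lemma periodInt_add {f g : ℝ → ℝ} (hf : Continuous f) (hg : Continuous g) :
    periodInt (fun x => f x + g x) = periodInt f + periodInt g :=
  intervalIntegral.integral_add (hf.intervalIntegrable _ _) (hg.intervalIntegrable _ _)

lemma periodInt_const_mul (c : ℝ) (f : ℝ → ℝ) :
    periodInt (fun x => c * f x) = c * periodInt f :=
  intervalIntegral.integral_const_mul _ _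

lemma periodInt_mono {f g : ℝ → ℝ} (hf : Continuous f) (hg : Continuous g)
    (h : ∀ x ∈ Set.Icc 0 (2 * π), f x ≤ g x) : periodInt f ≤ periodInt g :=
  intervalIntegral.integral_mono_on (by positivity) (hf.intervalIntegrable _ _)
    (hg.intervalIntegrable _ _) h

lemma periodInt_nonneg {f : ℝ → ℝ} (h : ∀ x, 0 ≤ f x) : 0 ≤ periodInt f :=
  intervalIntegral.integral_nonneg (by positivity) fun x _ => h x

lemma periodNorm_nonneg (f : ℝ → E) : 0 ≤ periodNorm f := sqrt_nonneg _

lemma sq_periodNorm (f : ℝ → E) : periodNorm f ^ 2 = periodInt fun x => ‖f x‖ ^ 2 :=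
  sq_sqrt (periodInt_nonneg fun _ => sq_nonneg _)

lemma sq_periodNorm_real (f : ℝ → ℝ) : periodNorm f ^ 2 = periodInt fun x => f x ^ 2 := by
  simp only [sq_periodNorm, norm_eq_abs, sq_abs]

lemma periodNorm_norm (f : ℝ → E) : periodNorm (fun x => ‖f x‖) = periodNorm f := by
  simp only [periodNorm, norm_norm]

lemma periodNorm_const_smul {𝕜 : Type*} [NormedField 𝕜] [NormedSpace 𝕜 E] (c : 𝕜) (f : ℝ → E) :
    periodNorm (fun x => c • f x) = ‖c‖ * periodNorm f := by
  simp only [periodNorm, norm_smul, mul_pow, periodInt_const_mul]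
  rw [sqrt_mul (by positivity), sqrt_sq (norm_nonneg c)]

lemma periodNorm_le_mul {f : ℝ → E} {g : ℝ → F} {K : ℝ} (hf : Continuous f) (hg : Continuous g)
    (hK : 0 ≤ K) (h : ∀ x, ‖f x‖ ≤ K * ‖g x‖) : periodNorm f ≤ K * periodNorm g := by
  refine sqrt_le_iff.2 ⟨mul_nonneg hK (periodNorm_nonneg _), ?_⟩
  rw [mul_pow, sq_periodNorm, ← periodInt_const_mul]
  refine periodInt_mono (by fun_prop) (by fun_prop) fun x _ => ?_
  rw [← mul_pow]
  exact pow_le_pow_left₀ (norm_nonneg _) (h x) 2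

lemma periodNorm_le {f : ℝ → E} {g : ℝ → F} (hf : Continuous f) (hg : Continuous g)
    (h : ∀ x, ‖f x‖ ≤ ‖g x‖) : periodNorm f ≤ periodNorm g := by
  simpa only [one_mul] using periodNorm_le_mul hf hg zero_le_one (by simpa only [one_mul] using h)

/-- Cauchy–Schwarz: `t ↦ ∫ (f - t g)²` is a nonnegative quadratic polynomial. -/
lemma periodInt_mul_le {f g : ℝ → ℝ} (hf : Continuous f) (hg : Continuous g) :
    periodInt (fun x => f x * g x) ≤ periodNorm f * periodNorm g := by
  have quadratic (t : ℝ) : 0 ≤ periodNorm g ^ 2 * (t * t)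
      + (-2 * periodInt fun x => f x * g x) * t + periodNorm f ^ 2 := by
    have expand : (periodInt fun x => (f x - t * g x) ^ 2)
        = periodInt fun x => (f x ^ 2 + (t * t) * g x ^ 2) + (-2 * t) * (f x * g x) := by
      congr 1; funext x; ring
    have h : 0 ≤ periodInt fun x => (f x - t * g x) ^ 2 := periodInt_nonneg fun _ => sq_nonneg _
    rw [expand, periodInt_add (by fun_prop) (by fun_prop),
      periodInt_add (by fun_prop) (by fun_prop), periodInt_const_mul, periodInt_const_mul,
      ← sq_periodNorm_real, ← sq_periodNorm_real] at h
    linarith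
  have h := discrim_le_zero quadratic
  rw [discrim] at h
  refine le_of_sq_le_sq ?_ (mul_nonneg (periodNorm_nonneg _) (periodNorm_nonneg _))
  linarith

lemma abs_periodInt_le_mul {G : ℝ → ℝ} {f : ℝ → E} {g : ℝ → F} {K : ℝ} (hG : Continuous G)
    (hf : Continuous f) (hg : Continuous g) (hK : 0 ≤ K) (h : ∀ x, |G x| ≤ K * (‖f x‖ * ‖g x‖)) :
    |periodInt G| ≤ K * (periodNorm f * periodNorm g) := by
  calc |periodInt G| ≤ periodInt fun x => |G x| :=
        intervalIntegral.abs_integral_le_integral_abs (by positivity)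
    _ ≤ periodInt fun x => K * (‖f x‖ * ‖g x‖) :=
        periodInt_mono hG.abs (by fun_prop) fun x _ => h x
    _ = K * periodInt fun x => ‖f x‖ * ‖g x‖ := periodInt_const_mul _ _
    _ ≤ K * (periodNorm f * periodNorm g) := by
        have := periodInt_mul_le hf.norm hg.norm
        rw [periodNorm_norm, periodNorm_norm] at this
        gcongr

lemma abs_periodInt_mul_le {f g : ℝ → ℝ} (hf : Continuous f) (hg : Continuous g) :
    |periodInt fun x => f x * g x| ≤ periodNorm f * periodNorm g := by
  simpa only [one_mul] using abs_periodInt_le_mul (K := 1) (hf.fun_mul hg) hf hg zero_le_one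
    fun _ => (abs_mul _ _).trans_le (one_mul _).ge

lemma periodNorm_add_le {f g : ℝ → E} (hf : Continuous f) (hg : Continuous g) :
    periodNorm (fun x => f x + g x) ≤ periodNorm f + periodNorm g := by
  refine sqrt_le_iff.2 ⟨add_nonneg (periodNorm_nonneg _) (periodNorm_nonneg _), ?_⟩
  calc (periodInt fun x => ‖f x + g x‖ ^ 2)
      ≤ periodInt fun x => (‖f x‖ ^ 2 + ‖g x‖ ^ 2) + 2 * (‖f x‖ * ‖g x‖) :=
        periodInt_mono (by fun_prop) (by fun_prop) fun x _ => by
          nlinarith [norm_add_le (f x) (g x), norm_nonneg (f x + g x)]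
    _ = periodNorm f ^ 2 + periodNorm g ^ 2 + 2 * periodInt fun x => ‖f x‖ * ‖g x‖ := by
        rw [periodInt_add (by fun_prop) (by fun_prop), periodInt_add (by fun_prop) (by fun_prop),
          periodInt_const_mul, sq_periodNorm, sq_periodNorm]
    _ ≤ (periodNorm f + periodNorm g) ^ 2 := by
        have := periodInt_mul_le hf.norm hg.norm
        rw [periodNorm_norm, periodNorm_norm] at this
        linarith

lemma periodInt_deriv_eq_zero {f f' : ℝ → ℝ} (h : ∀ x, HasDerivAt f (f' x) x)
    (hc : Continuous f') (hp : Function.Periodic f (2 * π)) : periodInt f' = 0 := by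
  rw [periodInt, intervalIntegral.integral_eq_sub_of_hasDerivAt (fun x _ => h x)
    (hc.intervalIntegrable _ _), hp.eq, sub_self]

lemma continuous_of_hasDerivAt {f f' : ℝ → ℝ} (h : ∀ x, HasDerivAt f (f' x) x) :
    Continuous f :=
  continuous_iff_continuousAt.2 fun x => (h x).continuousAt

lemma periodInt_deriv_mul {f f' g g' : ℝ → ℝ} (hf : ∀ x, HasDerivAt f (f' x) x)
    (hg : ∀ x, HasDerivAt g (g' x) x) (hf' : Continuous f') (hg' : Continuous g')
    (hfp : Function.Periodic f (2 * π)) (hgp : Function.Periodic g (2 * π)) :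
    periodInt (fun x => f' x * g x) = -periodInt fun x => f x * g' x := by
  have cf := continuous_of_hasDerivAt hf
  have cg := continuous_of_hasDerivAt hg
  have h := periodInt_deriv_eq_zero (fun x => (hf x).mul (hg x)) (by fun_prop) (hfp.mul hgp)
  rw [periodInt_add (by fun_prop) (by fun_prop)] at h
  linarith

lemma periodic_deriv [NormedSpace ℝ E] {f : ℝ → E} {c : ℝ} (h : Function.Periodic f c) :
    Function.Periodic (deriv f) c := fun x => by
  rw [← deriv_comp_add_const, show (fun y => f (y + c)) = f from funext h]

lemma le_of_sq_le_mul {x y n b c : ℝ} (hx : 0 ≤ x) (hn : 0 ≤ n) (hb : 0 ≤ b) (hc : 0 ≤ c)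
    (h : y ^ 2 ≤ x * (4 * c ^ 2 * n + b * y)) : y ≤ (b + c) * (x + n) := by
  by_contra! hlt
  have hbn := mul_nonneg hb hn
  have hbx := mul_nonneg hb hx
  have hcx : 0 ≤ c * (x + n) := by positivity
  have : c * (x + n) * (c * (x + n)) < y * (y - b * x) :=
    mul_lt_mul'' (by linarith) (by linarith) hcx hcx
  nlinarith [mul_nonneg (sq_nonneg c) (sq_nonneg (x - n))]

lemma periodNorm_mul_deriv_le {s s' w f : ℝ → ℝ} {b c : ℝ} (hs : ∀ x, HasDerivAt s (s' x) x)
    (hs' : Continuous s') (hsp : Function.Periodic s (2 * π)) (hw : Continuous w) (hb : 0 ≤ b)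
    (hc : 0 ≤ c) (hsw : ∀ x, s x ^ 2 ≤ 4 * c ^ 2 * |w x|) (hs'w : ∀ x, 2 * |s' x| ≤ b * |w x|)
    (hf : ContDiff ℝ 2 f) (hfp : Function.Periodic f (2 * π)) :
    periodNorm (fun x => s x * deriv f x)
      ≤ (b + c) * (periodNorm (fun x => w x * f x) + periodNorm (deriv (deriv f))) := by
  have cs := continuous_of_hasDerivAt hs
  have c₀ := hf.continuous
  have c₁ := hf.continuous_deriv one_le_two
  have c₂ : Continuous (deriv (deriv f)) := (hf.deriv' (n := 1)).continuous_deriv_one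
  have hφ (x) : HasDerivAt (fun x => s x ^ 2 * f x)
      (s x ^ 2 * deriv f x + 2 * s x * s' x * f x) x := by
    refine (((hs x).pow 2).mul (hf.differentiable two_ne_zero x).hasDerivAt).congr_deriv ?_
    simp only [Pi.pow_apply]
    push_cast
    ring
  have parts := periodInt_deriv_mul (fun x => (hf.differentiable_deriv_two x).hasDerivAt) hφ c₂
    (by fun_prop) (periodic_deriv hfp) fun x => by simp only [hsp x, hfp x]
  have split : (periodInt fun x => deriv f x * (s x ^ 2 * deriv f x + 2 * s x * s' x * f x))
      = periodNorm (fun x => s x * deriv f x) ^ 2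
        + periodInt fun x => 2 * s x * s' x * f x * deriv f x := by
    rw [sq_periodNorm_real, ← periodInt_add (by fun_prop) (by fun_prop)]
    congr 1; funext x; ring
  have bound₀ : |periodInt fun x => deriv (deriv f) x * (s x ^ 2 * f x)|
      ≤ 4 * c ^ 2 * (periodNorm (fun x => w x * f x) * periodNorm (deriv (deriv f))) :=
    abs_periodInt_le_mul (by fun_prop) (by fun_prop) c₂ (by positivity) fun x => by
      simp only [norm_eq_abs, abs_mul, abs_of_nonneg (sq_nonneg (s x))]
      have := mul_le_mul_of_nonneg_right (hsw x)
        (mul_nonneg (abs_nonneg (f x)) (abs_nonneg (deriv (deriv f) x)))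
      linarith
  have bound₁ : |periodInt fun x => 2 * s x * s' x * f x * deriv f x|
      ≤ b * (periodNorm (fun x => w x * f x) * periodNorm fun x => s x * deriv f x) :=
    abs_periodInt_le_mul (by fun_prop) (by fun_prop) (by fun_prop) hb fun x => by
      simp only [norm_eq_abs, abs_mul, abs_two]
      have := mul_le_mul_of_nonneg_right (hs'w x)
        (mul_nonneg (abs_nonneg (f x)) (mul_nonneg (abs_nonneg (s x)) (abs_nonneg (deriv f x))))
      linarith
  refine le_of_sq_le_mul (periodNorm_nonneg _) (periodNorm_nonneg _) hb hc ?_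
  linarith [neg_le_of_abs_le bound₀, neg_le_of_abs_le bound₁]

end PeriodIntegral

/-! ### The critical layer -/

section CriticalLayer

/-- The weight `((sin - μ)² + κ²)^(-1/2)`, an inverse distance to the critical points `sin = μ`
regularized at height `κ`. -/
def layerWeight (μ κ x : ℝ) : ℝ := (√((sin x - μ) ^ 2 + κ ^ 2))⁻¹

/-- A weight of mass comparable to `δ` concentrated at the critical points `sin = μ`; up to
normalization it regularizes the delta distribution there. -/
def layerBump (μ κ x : ℝ) : ℝ := (1 - sin x) * κ ^ 2 * layerWeight μ κ x ^ 4

/-- The scales of the critical layer of `sin - μ`: `d` is its width, `κ` the size of `sin - μ` on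
it, and `δ` the distance from `μ` to the critical value `1` of `sin`, unless the layer merges with
the one at the maximum of `sin`, in which case `δ = κ = d ^ 2`. -/
structure IsLayer (μ δ κ d : ℝ) : Prop where
  mu_pos : 0 < μ
  d_pos : 0 < d
  κ_pos : 0 < κ
  δ_le : δ ≤ 1
  d_sq_le : d ^ 2 ≤ δ
  κ_sq : κ ^ 2 = d ^ 2 * δ
  dist_le : |1 - μ| ≤ δ
  alt : δ = 1 - μ ∨ κ = δ

variable {μ δ κ d : ℝ}

lemma periodic_layerWeight (μ κ : ℝ) : Function.Periodic (layerWeight μ κ) (2 * π) := fun x => by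
  simp only [layerWeight, sin_add_two_pi]

lemma periodic_layerBump (μ κ : ℝ) : Function.Periodic (layerBump μ κ) (2 * π) := fun x => by
  simp only [layerBump, sin_add_two_pi, periodic_layerWeight μ κ x]

lemma layerWeight_pos (hκ : 0 < κ) (μ x : ℝ) : 0 < layerWeight μ κ x := by
  unfold layerWeight; positivity

lemma sq_layerWeight_add_sq (hκ : 0 < κ) (μ x : ℝ) :
    ((sin x - μ) * layerWeight μ κ x) ^ 2 + (κ * layerWeight μ κ x) ^ 2 = 1 := by
  have h : (sin x - μ) ^ 2 + κ ^ 2 ≠ 0 := by positivity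
  rw [layerWeight, mul_pow, mul_pow, inv_pow, sq_sqrt (by positivity), ← add_mul,
    mul_inv_cancel₀ h]

lemma abs_sin_sub_mul_layerWeight_le (hκ : 0 < κ) (μ x : ℝ) :
    |sin x - μ| * layerWeight μ κ x ≤ 1 := by
  rw [← abs_of_pos (layerWeight_pos hκ μ x), ← abs_mul]
  refine (sq_le_one_iff_abs_le_one _).1 ?_
  linarith [sq_layerWeight_add_sq hκ μ x, sq_nonneg (κ * layerWeight μ κ x)]

lemma mul_layerWeight_le (hκ : 0 < κ) (μ x : ℝ) : κ * layerWeight μ κ x ≤ 1 := by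
  refine le_of_abs_le ((sq_le_one_iff_abs_le_one _).1 ?_)
  linarith [sq_layerWeight_add_sq hκ μ x, sq_nonneg ((sin x - μ) * layerWeight μ κ x)]

lemma layerWeight_le (hκ : 0 < κ) (μ x : ℝ) : layerWeight μ κ x ≤ 1 / κ :=
  (le_div_iff₀' hκ).2 (mul_layerWeight_le hκ μ x)

lemma hasDerivAt_layerWeight (hκ : 0 < κ) (μ x : ℝ) :
    HasDerivAt (layerWeight μ κ) (-((sin x - μ) * cos x * layerWeight μ κ x ^ 3)) x := by
  have hpos : 0 < (sin x - μ) ^ 2 + κ ^ 2 := by positivity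
  have hsq : HasDerivAt (fun x => (sin x - μ) ^ 2 + κ ^ 2) (2 * (sin x - μ) * cos x) x := by
    simpa using (((hasDerivAt_sin x).sub_const μ).pow 2).add_const (κ ^ 2)
  refine ((hsq.sqrt hpos.ne').inv (sqrt_pos.2 hpos).ne').congr_deriv ?_
  have := (sqrt_pos.2 hpos).ne'
  simp only [layerWeight]
  field_simp

lemma continuous_layerWeight (hκ : 0 < κ) (μ : ℝ) : Continuous (layerWeight μ κ) :=
  continuous_of_hasDerivAt (hasDerivAt_layerWeight hκ μ)

lemma layerBump_nonneg (μ κ x : ℝ) : 0 ≤ layerBump μ κ x := by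
  have : 0 ≤ 1 - sin x := by linarith [sin_le_one x]
  unfold layerBump; positivity

lemma hasDerivAt_layerBump (hκ : 0 < κ) (μ x : ℝ) :
    HasDerivAt (layerBump μ κ) (-(cos x * κ ^ 2 * layerWeight μ κ x ^ 4
      + 4 * (sin x - μ) * cos x * layerWeight μ κ x ^ 2 * layerBump μ κ x)) x := by
  refine ((((hasDerivAt_sin x).const_sub 1).mul_const (κ ^ 2)).mul
    ((hasDerivAt_layerWeight hκ μ x).pow 4)).congr_deriv ?_
  simp only [layerBump, Pi.pow_apply]
  push_cast
  ring

lemma continuous_layerBump (hκ : 0 < κ) (μ : ℝ) : Continuous (layerBump μ κ) :=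
  continuous_of_hasDerivAt (hasDerivAt_layerBump hκ μ)

namespace IsLayer

lemma δ_pos (hs : IsLayer μ δ κ d) : 0 < δ := (pow_pos hs.d_pos 2).trans_le hs.d_sq_le

lemma κ_le (hs : IsLayer μ δ κ d) : κ ≤ δ :=
  le_of_sq_le_sq (by nlinarith [hs.κ_sq, hs.d_sq_le, hs.δ_pos]) hs.δ_pos.le

lemma d_sq_le_κ (hs : IsLayer μ δ κ d) : d ^ 2 ≤ κ :=
  le_of_sq_le_sq (by nlinarith [hs.κ_sq, hs.d_sq_le, sq_nonneg d]) hs.κ_pos.le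

lemma mu_le (hs : IsLayer μ δ κ d) : μ ≤ 2 := by
  linarith [neg_le_of_abs_le hs.dist_le, hs.δ_le]

lemma one_le_ratio (hs : IsLayer μ δ κ d) : 1 ≤ δ / κ := (one_le_div hs.κ_pos).2 hs.κ_le

lemma one_sub_sin_le (hs : IsLayer μ δ κ d) (x : ℝ) : 1 - sin x ≤ δ + |sin x - μ| := by
  linarith [le_of_abs_le hs.dist_le, neg_abs_le (sin x - μ)]

lemma one_sub_sin_mul_layerWeight_le (hs : IsLayer μ δ κ d) (x : ℝ) :
    (1 - sin x) * (κ * layerWeight μ κ x) ≤ 2 * δ := by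
  have hσ := layerWeight_pos hs.κ_pos μ x
  have hκ := hs.κ_pos
  have hδ := hs.δ_pos
  calc (1 - sin x) * (κ * layerWeight μ κ x)
      ≤ (δ + |sin x - μ|) * (κ * layerWeight μ κ x) := by gcongr; exact hs.one_sub_sin_le x
    _ = δ * (κ * layerWeight μ κ x) + κ * (|sin x - μ| * layerWeight μ κ x) := by ring
    _ ≤ δ * 1 + δ * 1 := by
        gcongr
        · exact mul_layerWeight_le hκ μ x
        · exact hs.κ_le
        · exact abs_sin_sub_mul_layerWeight_le hκ μ x
    _ = 2 * δ := by ring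

lemma cos_sq_mul_layerWeight_le (hs : IsLayer μ δ κ d) (x : ℝ) :
    cos x ^ 2 * layerWeight μ κ x ≤ 4 * (δ / κ) := by
  have hσ := layerWeight_pos hs.κ_pos μ x
  have hcos : cos x ^ 2 ≤ 2 * (1 - sin x) := by
    nlinarith [sin_sq_add_cos_sq x, sin_le_one x]
  rw [← mul_div_assoc, le_div_iff₀ hs.κ_pos]
  calc cos x ^ 2 * layerWeight μ κ x * κ
      ≤ 2 * (1 - sin x) * layerWeight μ κ x * κ := by have := hs.κ_pos; gcongr
    _ ≤ 4 * δ := by linarith [hs.one_sub_sin_mul_layerWeight_le x]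

lemma abs_cos_mul_layerWeight_le (hs : IsLayer μ δ κ d) (x : ℝ) :
    |cos x| * layerWeight μ κ x ≤ 2 / d := by
  set σ := layerWeight μ κ x
  have hσ : 0 < σ := layerWeight_pos hs.κ_pos μ x
  have hd := hs.d_pos
  have hκ := hs.κ_pos
  rw [le_div_iff₀ hd]
  refine le_of_sq_le_sq ?_ zero_le_two
  have hcos : cos x ^ 2 ≤ 2 * (δ + |sin x - μ|) := by
    nlinarith [sin_sq_add_cos_sq x, sin_le_one x, hs.one_sub_sin_le x]
  calc (|cos x| * σ * d) ^ 2 = cos x ^ 2 * (σ * d) ^ 2 := by rw [mul_assoc, mul_pow, sq_abs]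
    _ ≤ 2 * (δ + |sin x - μ|) * (σ * d) ^ 2 := by gcongr
    _ = 2 * (κ * σ) ^ 2 + 2 * (|sin x - μ| * σ * (d ^ 2 * σ)) := by
        rw [mul_pow κ, hs.κ_sq]; ring
    _ ≤ 2 * 1 ^ 2 + 2 * (1 * 1) := by
        gcongr
        · exact mul_layerWeight_le hκ μ x
        · exact abs_sin_sub_mul_layerWeight_le hκ μ x
        · exact (mul_le_mul_of_nonneg_right hs.d_sq_le_κ hσ.le).trans (mul_layerWeight_le hκ μ x)
    _ = 2 ^ 2 := by norm_num

lemma layerBump_le_mul (hs : IsLayer μ δ κ d) (x : ℝ) :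
    layerBump μ κ x ≤ 2 * (δ / κ) * layerWeight μ κ x := by
  have hσ := layerWeight_pos hs.κ_pos μ x
  have hκ := hs.κ_pos
  have hδ := hs.δ_pos
  calc layerBump μ κ x = (1 - sin x) * (κ * layerWeight μ κ x)
        * ((κ * layerWeight μ κ x) ^ 2 / κ * layerWeight μ κ x) := by
        unfold layerBump; field_simp
    _ ≤ 2 * δ * (1 ^ 2 / κ * layerWeight μ κ x) := by
        refine mul_le_mul (hs.one_sub_sin_mul_layerWeight_le x) ?_ (by positivity) (by positivity)
        gcongr
        exact mul_layerWeight_le hκ μ x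
    _ = 2 * (δ / κ) * layerWeight μ κ x := by ring

lemma layerBump_le (hs : IsLayer μ δ κ d) (x : ℝ) : layerBump μ κ x ≤ 2 * δ / κ ^ 2 := by
  have hκ := hs.κ_pos
  have hδ := hs.δ_pos
  calc layerBump μ κ x ≤ 2 * (δ / κ) * layerWeight μ κ x := hs.layerBump_le_mul x
    _ ≤ 2 * (δ / κ) * (1 / κ) := by gcongr; exact layerWeight_le hκ μ x
    _ = 2 * δ / κ ^ 2 := by field_simp

lemma abs_deriv_layerBump_le (hs : IsLayer μ δ κ d) (x : ℝ) :
    |deriv (layerBump μ κ) x| ≤ 18 * (δ / κ) / d * layerWeight μ κ x := by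
  have hκ := hs.κ_pos
  have hd := hs.d_pos
  have hcos := hs.abs_cos_mul_layerWeight_le x
  rw [(hasDerivAt_layerBump hκ μ x).deriv, abs_neg]
  have hσ := layerWeight_pos hκ μ x
  set σ := layerWeight μ κ x
  have first : |cos x * κ ^ 2 * σ ^ 4| ≤ 2 / d * 1 ^ 2 * σ := by
    rw [show cos x * κ ^ 2 * σ ^ 4 = cos x * (σ * (κ * σ) ^ 2 * σ) by ring, abs_mul,
      abs_of_pos (by positivity : 0 < σ * (κ * σ) ^ 2 * σ), ← mul_assoc, ← mul_assoc]
    gcongr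
    exact mul_layerWeight_le hκ μ x
  have second : |4 * (sin x - μ) * cos x * σ ^ 2 * layerBump μ κ x|
      ≤ 4 * (1 * (2 / d)) * (2 * (δ / κ) * σ) := by
    rw [abs_mul, abs_of_nonneg (layerBump_nonneg μ κ x)]
    refine mul_le_mul ?_ (hs.layerBump_le_mul x) (layerBump_nonneg μ κ x) (by positivity)
    rw [show 4 * (sin x - μ) * cos x * σ ^ 2 = 4 * (((sin x - μ) * σ) * (cos x * σ)) by ring,
      abs_mul, abs_mul, abs_mul, abs_mul, abs_of_pos hσ, abs_of_pos (four_pos (α := ℝ))]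
    gcongr
    exact abs_sin_sub_mul_layerWeight_le hκ μ x
  calc _ ≤ 2 / d * 1 ^ 2 * σ + 4 * (1 * (2 / d)) * (2 * (δ / κ) * σ) :=
        (abs_add_le _ _).trans (add_le_add first second)
    _ = (2 * 1 + 16 * (δ / κ)) / d * σ := by ring
    _ ≤ (2 * (δ / κ) + 16 * (δ / κ)) / d * σ := by gcongr; exact hs.one_le_ratio
    _ = 18 * (δ / κ) / d * σ := by ring

end IsLayer

end CriticalLayer

/-! ### The Rayleigh equation -/

section Rayleigh

variable {E : Type*} [NormedAddCommGroup E] [NormedSpace ℝ E]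

/-- The Helmholtz operator `ψ'' - m ψ`. If `ω = A_l ψ` is the vorticity of the stream function `ψ`
at the wave number `l`, then `(I + A_l⁻¹) ω` is `ψ'' - m ψ` for `m = l² - 1`. -/
def helmholtz (m : ℝ) (ψ : ℝ → E) (x : ℝ) : E := deriv (deriv ψ) x - m • ψ x

/-- The operator `(sin - μ) (ψ'' - m ψ) + μ ψ` of the Rayleigh equation. For `ω = A_l ψ` and
`m = l² - 1` it is `sin (I + A_l⁻¹) ω - μ ω`, the inviscid part of the resolvent equation. -/
def rayleighOp (μ m : ℝ) (ψ : ℝ → E) (x : ℝ) : E := (sin x - μ) • helmholtz m ψ x + μ • ψ x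

/-- `ψ` solves the Rayleigh equation with the small right-hand side `h₁ + h₂'`, and
`ψ'' - m ψ` varies slowly on the scale `d` of the critical layer. All sizes are relative to a bound
`V` for `ψ'' - m ψ`, and `η` is the smallness parameter. -/
structure IsRayleighSol (μ κ d m η V : ℝ) (ψ h₁ h₂ : ℝ → ℝ) : Prop where
  m_nonneg : 0 ≤ m
  η_nonneg : 0 ≤ η
  periodic : Function.Periodic ψ (2 * π)
  periodic_h₂ : Function.Periodic h₂ (2 * π)
  contDiff : ContDiff ℝ 3 ψ
  contDiff_h₂ : ContDiff ℝ 1 h₂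
  continuous_h₁ : Continuous h₁
  eqn : ∀ x, rayleighOp μ m ψ x = h₁ x + deriv h₂ x
  h₁_le : periodNorm h₁ ≤ η * κ * V
  h₂_le : periodNorm h₂ ≤ η * κ * d * V
  helmholtz_le : periodNorm (helmholtz m ψ) ≤ V
  deriv_helmholtz_le : d * periodNorm (deriv (helmholtz m ψ)) ≤ η * V

lemma periodic_helmholtz {c : ℝ} {ψ : ℝ → E} (hp : Function.Periodic ψ c) (m : ℝ) :
    Function.Periodic (helmholtz m ψ) c := fun x => by
  simp only [helmholtz, hp x, periodic_deriv (periodic_deriv hp) x]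

lemma contDiff_helmholtz {n : WithTop ℕ∞} {ψ : ℝ → E} (hψ : ContDiff ℝ (n + 2) ψ) (m : ℝ) :
    ContDiff ℝ n (helmholtz m ψ) := by
  have h1 : ContDiff ℝ (n + 1 + 1) ψ := by rwa [add_assoc, one_add_one_eq_two]
  exact h1.deriv'.deriv'.sub ((hψ.of_le le_self_add).const_smul m)

lemma periodNorm_deriv_deriv_le {m : ℝ} (hm : 0 ≤ m) {ψ : ℝ → ℝ} (hψ : ContDiff ℝ 2 ψ)
    (hp : Function.Periodic ψ (2 * π)) :
    periodNorm (deriv (deriv ψ)) ≤ periodNorm (helmholtz m ψ) := by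
  have c₀ := hψ.continuous
  have c₁ := hψ.continuous_deriv one_le_two
  have c₂ : Continuous (deriv (deriv ψ)) := (hψ.deriv' (n := 1)).continuous_deriv_one
  have parts := periodInt_deriv_mul (fun x => (hψ.differentiable_deriv_two x).hasDerivAt)
    (fun x => (hψ.differentiable two_ne_zero x).hasDerivAt) c₂ c₁ (periodic_deriv hp) hp
  have expand : periodNorm (helmholtz m ψ) ^ 2 = periodNorm (deriv (deriv ψ)) ^ 2
      + -(2 * m) * (periodInt fun x => deriv (deriv ψ) x * ψ x) + m ^ 2 * periodNorm ψ ^ 2 := by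
    simp only [sq_periodNorm_real, ← periodInt_const_mul]
    rw [← periodInt_add (by fun_prop) (by fun_prop), ← periodInt_add (by fun_prop) (by fun_prop)]
    congr 1; funext x; simp only [helmholtz, smul_eq_mul]; ring
  have energy : 0 ≤ periodInt fun x => deriv ψ x * deriv ψ x :=
    periodInt_nonneg fun x => mul_self_nonneg _
  refine le_of_sq_le_sq ?_ (periodNorm_nonneg _)
  rw [expand, parts]
  nlinarith [mul_nonneg hm energy, mul_nonneg (sq_nonneg m) (sq_nonneg (periodNorm ψ))]

namespace IsLayer

variable {μ δ κ d : ℝ} {ψ : ℝ → ℝ}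

lemma periodNorm_cos_deriv_le (hs : IsLayer μ δ κ d) (hψ : ContDiff ℝ 2 ψ)
    (hp : Function.Periodic ψ (2 * π)) :
    periodNorm (fun x => cos x * layerWeight μ κ x * deriv ψ x) ≤ 11 * (δ / κ)
      * (periodNorm (fun x => layerWeight μ κ x * ψ x) + periodNorm (deriv (deriv ψ))) := by
  have cσ := continuous_layerWeight hs.κ_pos μ
  have hD := hs.one_le_ratio
  have hder (x) := (hasDerivAt_cos x).fun_mul (hasDerivAt_layerWeight hs.κ_pos μ x)
  convert periodNorm_mul_deriv_le (b := 10 * (δ / κ)) (c := δ / κ) hder (by fun_prop)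
    (fun x => by simp only [cos_add_two_pi, periodic_layerWeight μ κ x]) cσ (by positivity)
    (by positivity) (fun x => ?_) (fun x => ?_) hψ hp using 1
  · ring
  · have hσ := layerWeight_pos hs.κ_pos μ x
    rw [abs_of_pos hσ]
    calc (cos x * layerWeight μ κ x) ^ 2
        = cos x ^ 2 * layerWeight μ κ x * layerWeight μ κ x := by ring
      _ ≤ 4 * (δ / κ) * layerWeight μ κ x :=
          mul_le_mul_of_nonneg_right (hs.cos_sq_mul_layerWeight_le x) hσ.le
      _ ≤ 4 * (δ / κ) ^ 2 * layerWeight μ κ x := by gcongr; exact le_self_pow₀ hD two_ne_zero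
  · have hσ := layerWeight_pos hs.κ_pos μ x
    set σ := layerWeight μ κ x
    have h1 : |sin x * σ| ≤ 1 * σ := by
      rw [abs_mul, abs_of_pos hσ]; gcongr; exact abs_sin_le_one x
    have h2 : |cos x * ((sin x - μ) * cos x * σ ^ 3)| ≤ 4 * (δ / κ) * 1 * σ := by
      rw [show cos x * ((sin x - μ) * cos x * σ ^ 3)
          = (cos x ^ 2 * σ) * ((sin x - μ) * σ) * σ by ring, abs_mul, abs_mul, abs_mul (_ - _),
        abs_of_pos hσ, abs_of_nonneg (by positivity : 0 ≤ cos x ^ 2 * σ)]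
      refine mul_le_mul_of_nonneg_right (mul_le_mul (hs.cos_sq_mul_layerWeight_le x)
        (abs_sin_sub_mul_layerWeight_le hs.κ_pos μ x) (by positivity) (by positivity)) hσ.le
    calc 2 * |-sin x * σ + cos x * -((sin x - μ) * cos x * σ ^ 3)|
        = 2 * |sin x * σ + cos x * ((sin x - μ) * cos x * σ ^ 3)| := by
          rw [← abs_neg]; ring_nf
      _ ≤ 2 * (1 * σ + 4 * (δ / κ) * 1 * σ) := by
          gcongr; exact (abs_add_le _ _).trans (add_le_add h1 h2)
      _ = (2 * 1 + 8 * (δ / κ)) * σ := by ring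
      _ ≤ (2 * (δ / κ) + 8 * (δ / κ)) * σ := by gcongr
      _ = 10 * (δ / κ) * |σ| := by rw [abs_of_pos hσ]; ring

lemma periodNorm_deriv_le (hs : IsLayer μ δ κ d) (hψ : ContDiff ℝ 2 ψ)
    (hp : Function.Periodic ψ (2 * π)) :
    periodNorm (fun x => layerWeight μ κ x * deriv ψ x) ≤ 5 / d
      * (periodNorm (fun x => layerWeight μ κ x * ψ x) + periodNorm (deriv (deriv ψ))) := by
  have cσ := continuous_layerWeight hs.κ_pos μ
  have hd := hs.d_pos
  convert periodNorm_mul_deriv_le (b := 4 / d) (c := 1 / d)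
    (hasDerivAt_layerWeight hs.κ_pos μ) (by fun_prop) (periodic_layerWeight μ κ) cσ (by positivity)
    (by positivity) (fun x => ?_) (fun x => ?_) hψ hp using 1
  · ring
  · have hσ := layerWeight_pos hs.κ_pos μ x
    rw [abs_of_pos hσ, sq]
    gcongr
    calc layerWeight μ κ x ≤ 1 / κ := layerWeight_le hs.κ_pos μ x
      _ ≤ 1 / d ^ 2 := one_div_le_one_div_of_le (by positivity) hs.d_sq_le_κ
      _ ≤ 4 * (1 / d ^ 2) := le_mul_of_one_le_left (by positivity) (by norm_num)
      _ = 4 * (1 / d) ^ 2 := by rw [one_div_pow]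
  · have hσ := layerWeight_pos hs.κ_pos μ x
    set σ := layerWeight μ κ x
    rw [abs_neg, show (sin x - μ) * cos x * σ ^ 3 = ((sin x - μ) * σ) * (cos x * σ) * σ by ring,
      abs_mul, abs_mul, abs_mul, abs_mul, abs_of_pos hσ]
    calc 2 * (|sin x - μ| * σ * (|cos x| * σ) * σ) ≤ 2 * (1 * (2 / d) * σ) := by
          gcongr
          · exact abs_sin_sub_mul_layerWeight_le hs.κ_pos μ x
          · exact hs.abs_cos_mul_layerWeight_le x
      _ = 4 / d * σ := by ring

end IsLayer

namespace IsRayleighSol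

variable {ψ h₁ h₂ : ℝ → ℝ} {μ δ κ d m η V : ℝ}

lemma V_nonneg (h : IsRayleighSol μ κ d m η V ψ h₁ h₂) : 0 ≤ V :=
  (periodNorm_nonneg _).trans h.helmholtz_le

lemma contDiff_two (h : IsRayleighSol μ κ d m η V ψ h₁ h₂) : ContDiff ℝ 2 ψ :=
  h.contDiff.of_le (by norm_num)

lemma contDiff_helmholtz (h : IsRayleighSol μ κ d m η V ψ h₁ h₂) :
    ContDiff ℝ 1 (helmholtz m ψ) :=
  Kolmogorov.contDiff_helmholtz (h.contDiff.of_le (by norm_num)) m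

lemma continuous_helmholtz (h : IsRayleighSol μ κ d m η V ψ h₁ h₂) :
    Continuous (helmholtz m ψ) :=
  h.contDiff_helmholtz.continuous

lemma continuous_deriv (h : IsRayleighSol μ κ d m η V ψ h₁ h₂) : Continuous (deriv ψ) :=
  h.contDiff_two.continuous_deriv one_le_two

lemma continuous_deriv_deriv (h : IsRayleighSol μ κ d m η V ψ h₁ h₂) :
    Continuous (deriv (deriv ψ)) :=
  (h.contDiff_two.deriv' (n := 1)).continuous_deriv_one

lemma hasDerivAt (h : IsRayleighSol μ κ d m η V ψ h₁ h₂) (x : ℝ) :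
    HasDerivAt ψ (deriv ψ x) x :=
  (h.contDiff_two.differentiable two_ne_zero x).hasDerivAt

lemma hasDerivAt_deriv (h : IsRayleighSol μ κ d m η V ψ h₁ h₂) (x : ℝ) :
    HasDerivAt (deriv ψ) (deriv (deriv ψ) x) x :=
  (h.contDiff_two.differentiable_deriv_two x).hasDerivAt

lemma periodNorm_deriv_deriv_le (h : IsRayleighSol μ κ d m η V ψ h₁ h₂) :
    periodNorm (deriv (deriv ψ)) ≤ V :=
  (Kolmogorov.periodNorm_deriv_deriv_le h.m_nonneg h.contDiff_two h.periodic).trans h.helmholtz_le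

lemma periodNorm_cos_deriv_le (h : IsRayleighSol μ κ d m η V ψ h₁ h₂) (hs : IsLayer μ δ κ d) :
    periodNorm (fun x => cos x * layerWeight μ κ x * deriv ψ x)
      ≤ 11 * (δ / κ) * (periodNorm (fun x => layerWeight μ κ x * ψ x) + V) := by
  have := hs.one_le_ratio
  exact (hs.periodNorm_cos_deriv_le h.contDiff_two h.periodic).trans
    (by gcongr; exact h.periodNorm_deriv_deriv_le)

lemma periodNorm_deriv_le (h : IsRayleighSol μ κ d m η V ψ h₁ h₂) (hs : IsLayer μ δ κ d) :
    periodNorm (fun x => layerWeight μ κ x * deriv ψ x)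
      ≤ 5 / d * (periodNorm (fun x => layerWeight μ κ x * ψ x) + V) := by
  have := hs.d_pos
  exact (hs.periodNorm_deriv_le h.contDiff_two h.periodic).trans
    (by gcongr; exact h.periodNorm_deriv_deriv_le)

lemma abs_periodInt_mul_le (h : IsRayleighSol μ κ d m η V ψ h₁ h₂)
    {φ φ' : ℝ → ℝ} (hφ : ∀ x, HasDerivAt φ (φ' x) x) (hφ' : Continuous φ')
    (hp : Function.Periodic φ (2 * π)) :
    |periodInt fun x => rayleighOp μ m ψ x * φ x|
      ≤ η * κ * V * (periodNorm φ + d * periodNorm φ') := by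
  have cφ := continuous_of_hasDerivAt hφ
  have c₁ := h.continuous_h₁
  have c₂ := h.contDiff_h₂.continuous
  have c₂' := h.contDiff_h₂.continuous_deriv_one
  have parts : (periodInt fun x => rayleighOp μ m ψ x * φ x)
      = (periodInt fun x => h₁ x * φ x) - periodInt fun x => h₂ x * φ' x := by
    rw [sub_eq_add_neg, ← periodInt_deriv_mul
        (fun x => (h.contDiff_h₂.differentiable_one x).hasDerivAt) hφ c₂' hφ' h.periodic_h₂ hp,
      ← periodInt_add (by fun_prop) (by fun_prop)]
    congr 1; funext x; rw [h.eqn]; ring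
  calc |periodInt fun x => rayleighOp μ m ψ x * φ x|
      ≤ |periodInt fun x => h₁ x * φ x| + |periodInt fun x => h₂ x * φ' x| :=
        parts ▸ abs_sub _ _
    _ ≤ periodNorm h₁ * periodNorm φ + periodNorm h₂ * periodNorm φ' :=
        add_le_add (Kolmogorov.abs_periodInt_mul_le c₁ cφ)
          (Kolmogorov.abs_periodInt_mul_le c₂ hφ')
    _ ≤ η * κ * V * periodNorm φ + η * κ * d * V * periodNorm φ' :=
        add_le_add (mul_le_mul_of_nonneg_right h.h₁_le (periodNorm_nonneg _))
          (mul_le_mul_of_nonneg_right h.h₂_le (periodNorm_nonneg _))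
    _ = η * κ * V * (periodNorm φ + d * periodNorm φ') := by ring

end IsRayleighSol

lemma periodNorm_deriv_mul_le {ρ ρ' g g' w : ℝ → ℝ} {A B : ℝ} (cρ : Continuous ρ)
    (cρ' : Continuous ρ') (cg : Continuous g) (cg' : Continuous g') (cw : Continuous w)
    (hA : 0 ≤ A) (hB : 0 ≤ B) (hρ : ∀ x, |ρ x| ≤ A * |w x|) (hρ' : ∀ x, |ρ' x| ≤ B * |w x|) :
    periodNorm (fun x => ρ' x * g x + ρ x * g' x)
      ≤ B * periodNorm (fun x => w x * g x) + A * periodNorm (fun x => w x * g' x) := by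
  refine (periodNorm_add_le (by fun_prop) (by fun_prop)).trans (add_le_add ?_ ?_)
  · refine periodNorm_le_mul (by fun_prop) (by fun_prop) hB fun x => ?_
    rw [norm_mul, norm_mul, ← mul_assoc]
    exact mul_le_mul_of_nonneg_right (hρ' x) (norm_nonneg _)
  · refine periodNorm_le_mul (by fun_prop) (by fun_prop) hA fun x => ?_
    rw [norm_mul, norm_mul, ← mul_assoc]
    exact mul_le_mul_of_nonneg_right (hρ x) (norm_nonneg _)

end Rayleigh

section Coercivity

variable {ψ h₁ h₂ : ℝ → ℝ} {μ δ κ d m η V ε : ℝ}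

lemma IsLayer.layerBump_mul_sq_le (hs : IsLayer μ δ κ d) (hε : 0 < ε) (x : ℝ) :
    layerBump μ κ x * (sin x - μ) ^ 2
      ≤ (δ + κ / (4 * ε)) * (κ * layerWeight μ κ x) ^ 2 + κ * ε := by
  have hσ := layerWeight_pos hs.κ_pos μ x
  have hκ := hs.κ_pos
  have hδ := hs.δ_pos
  have htσ := abs_sin_sub_mul_layerWeight_le hκ μ x
  have ht := abs_nonneg (sin x - μ)
  have young (p : ℝ) : p ≤ p ^ 2 / (4 * ε) + ε := by
    rw [← sub_le_iff_le_add, le_div_iff₀ (by positivity)]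
    linarith [sq_nonneg (p - 2 * ε)]
  rw [layerBump, ← sq_abs (sin x - μ)]
  set σ := layerWeight μ κ x
  set t := |sin x - μ|
  calc (1 - sin x) * κ ^ 2 * σ ^ 4 * t ^ 2 = (1 - sin x) * ((κ * σ) ^ 2 * (t * σ) ^ 2) := by ring
    _ ≤ (δ + t) * ((κ * σ) ^ 2 * (t * σ) ^ 2) := by gcongr; exact hs.one_sub_sin_le x
    _ = δ * ((κ * σ) ^ 2 * (t * σ) ^ 2) + κ * ((κ * σ) * (t * σ) ^ 3) := by ring
    _ ≤ δ * ((κ * σ) ^ 2 * 1 ^ 2) + κ * ((κ * σ) * 1 ^ 3) := by gcongr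
    _ ≤ δ * ((κ * σ) ^ 2 * 1 ^ 2) + κ * ((κ * σ) ^ 2 / (4 * ε) + ε) := by
        gcongr; simpa only [one_pow, mul_one] using young (κ * σ)
    _ = (δ + κ / (4 * ε)) * (κ * σ) ^ 2 + κ * ε := by ring

lemma IsLayer.periodNorm_sqrt_layerBump_le (hs : IsLayer μ δ κ d) (hε : 0 < ε) (hε1 : ε ≤ 1)
    {v : ℝ → ℝ} (cv : Continuous v) (hv : periodNorm v ≤ V)
    (hE : periodNorm (fun x => κ * layerWeight μ κ x * v x) ≤ ε * V) :
    periodNorm (fun x => √(layerBump μ κ x) * ((sin x - μ) * v x)) ≤ √(3 * ε * δ) * V := by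
  have cσ := continuous_layerWeight hs.κ_pos μ
  have cb := continuous_layerBump hs.κ_pos μ
  have hκ := hs.κ_pos
  have hδ := hs.δ_pos
  have hκδ := hs.κ_le
  have hV : 0 ≤ V := (periodNorm_nonneg _).trans hv
  refine le_of_sq_le_sq ?_ (by positivity)
  rw [mul_pow, sq_sqrt (by positivity)]
  calc periodNorm (fun x => √(layerBump μ κ x) * ((sin x - μ) * v x)) ^ 2
      ≤ periodInt fun x => (δ + κ / (4 * ε)) * (κ * layerWeight μ κ x * v x) ^ 2
          + κ * ε * v x ^ 2 := by
        rw [sq_periodNorm_real]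
        refine periodInt_mono (by fun_prop) (by fun_prop) fun x _ => ?_
        rw [mul_pow, mul_pow, sq_sqrt (layerBump_nonneg μ κ x)]
        linarith [mul_le_mul_of_nonneg_right (hs.layerBump_mul_sq_le hε x) (sq_nonneg (v x))]
    _ = (δ + κ / (4 * ε)) * periodNorm (fun x => κ * layerWeight μ κ x * v x) ^ 2
          + κ * ε * periodNorm v ^ 2 := by
        rw [periodInt_add (by fun_prop) (by fun_prop), periodInt_const_mul, periodInt_const_mul,
          sq_periodNorm_real, sq_periodNorm_real]
    _ ≤ (δ + κ / (4 * ε)) * (ε * V) ^ 2 + κ * ε * V ^ 2 := by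
        gcongr <;> exact periodNorm_nonneg _
    _ = (δ * ε + 5 / 4 * κ) * (ε * V ^ 2) := by field_simp; ring
    _ ≤ (δ * 1 + 5 / 4 * δ) * (ε * V ^ 2) := by gcongr
    _ ≤ 3 * ε * δ * V ^ 2 := by linarith [show 0 ≤ δ * (ε * V ^ 2) by positivity]

lemma IsLayer.periodNorm_layerBump_mul_le (hs : IsLayer μ δ κ d) (hψ : Continuous ψ) :
    periodNorm (fun x => layerBump μ κ x * ψ x)
      ≤ √(2 * δ) / κ * periodNorm (fun x => √(layerBump μ κ x) * ψ x) := by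
  have hκ := hs.κ_pos
  have cb := continuous_layerBump hκ μ
  refine periodNorm_le_mul (by fun_prop) (by fun_prop) (by positivity) fun x => ?_
  have hsqrt : √(layerBump μ κ x) ≤ √(2 * δ) / κ := by
    have := sqrt_le_sqrt (hs.layerBump_le x)
    rwa [sqrt_div' _ (sq_nonneg κ), sqrt_sq hκ.le] at this
  nth_rewrite 1 [← mul_self_sqrt (layerBump_nonneg μ κ x)]
  rw [mul_assoc, norm_mul, norm_of_nonneg (sqrt_nonneg _)]
  exact mul_le_mul_of_nonneg_right hsqrt (norm_nonneg _)

namespace IsRayleighSol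

lemma periodNorm_deriv_layerBump_mul_le (h : IsRayleighSol μ κ d m η V ψ h₁ h₂)
    (hs : IsLayer μ δ κ d) :
    periodNorm (fun x => deriv (layerBump μ κ) x * ψ x + layerBump μ κ x * deriv ψ x)
      ≤ 28 * (δ / κ) / d * (periodNorm (fun x => layerWeight μ κ x * ψ x) + V) := by
  have hκ := hs.κ_pos
  have hd := hs.d_pos
  have hδ := hs.δ_pos
  have hV := h.V_nonneg
  have cσ := continuous_layerWeight hκ μ
  have cb := continuous_layerBump hκ μ
  have cb' : Continuous (deriv (layerBump μ κ)) := by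
    rw [funext fun x => (hasDerivAt_layerBump hκ μ x).deriv]; fun_prop
  have hb (x) : |layerBump μ κ x| ≤ 2 * (δ / κ) * |layerWeight μ κ x| := by
    rw [abs_of_nonneg (layerBump_nonneg μ κ x), abs_of_pos (layerWeight_pos hκ μ x)]
    exact hs.layerBump_le_mul x
  have hb' (x) : |deriv (layerBump μ κ) x| ≤ 18 * (δ / κ) / d * |layerWeight μ κ x| := by
    rw [abs_of_pos (layerWeight_pos hκ μ x)]
    exact hs.abs_deriv_layerBump_le x
  set X := periodNorm fun x => layerWeight μ κ x * ψ x
  calc _ ≤ 18 * (δ / κ) / d * X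
        + 2 * (δ / κ) * periodNorm (fun x => layerWeight μ κ x * deriv ψ x) :=
        periodNorm_deriv_mul_le cb cb' h.contDiff.continuous h.continuous_deriv cσ
          (by positivity) (by positivity) hb hb'
    _ ≤ 18 * (δ / κ) / d * (X + V) + 2 * (δ / κ) * (5 / d * (X + V)) := by
        gcongr
        · linarith
        · exact h.periodNorm_deriv_le hs
    _ = 28 * (δ / κ) / d * (X + V) := by ring

/-- Testing the equation with `layerBump * ψ`. -/
lemma mu_mul_sq_periodNorm_sqrt_layerBump_le (h : IsRayleighSol μ κ d m η V ψ h₁ h₂)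
    (hs : IsLayer μ δ κ d) (hε : 0 < ε) (hε1 : ε ≤ 1)
    (hE : periodNorm (fun x => κ * layerWeight μ κ x * helmholtz m ψ x) ≤ ε * V) :
    μ * periodNorm (fun x => √(layerBump μ κ x) * ψ x) ^ 2
      ≤ (√(3 * ε * δ) + η * √(2 * δ)) * V * periodNorm (fun x => √(layerBump μ κ x) * ψ x)
        + 28 * η * δ * V * (periodNorm (fun x => layerWeight μ κ x * ψ x) + V) := by
  have hκ := hs.κ_pos
  have hd := hs.d_pos
  have hη := h.η_nonneg
  have hV := h.V_nonneg
  have c₀ := h.contDiff.continuous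
  have c₁ := h.continuous_deriv
  have cv := h.continuous_helmholtz
  have cb := continuous_layerBump hκ μ
  have cσ := continuous_layerWeight hκ μ
  set J := periodNorm fun x => √(layerBump μ κ x) * ψ x with hJ
  set X := periodNorm fun x => layerWeight μ κ x * ψ x
  have split : (periodInt fun x => rayleighOp μ m ψ x * (layerBump μ κ x * ψ x))
      = (periodInt fun x => √(layerBump μ κ x) * ((sin x - μ) * helmholtz m ψ x)
          * (√(layerBump μ κ x) * ψ x)) + μ * J ^ 2 := by
    rw [hJ, sq_periodNorm_real, ← periodInt_const_mul, ← periodInt_add (by fun_prop) (by fun_prop)]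
    congr 1; funext x
    simp only [rayleighOp, smul_eq_mul]
    linear_combination -(ψ x * ((sin x - μ) * helmholtz m ψ x + μ * ψ x))
      * sq_sqrt (layerBump_nonneg μ κ x)
  have tested := h.abs_periodInt_mul_le
    (fun x => (hasDerivAt_layerBump hκ μ x).differentiableAt.hasDerivAt.fun_mul (h.hasDerivAt x))
    (by simp only [fun x => (hasDerivAt_layerBump hκ μ x).deriv]; fun_prop)
    ((periodic_layerBump μ κ).mul h.periodic)
  have bound : η * κ * V * (periodNorm (fun x => layerBump μ κ x * ψ x)
        + d * periodNorm fun x => deriv (layerBump μ κ) x * ψ x + layerBump μ κ x * deriv ψ x)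
      ≤ η * κ * V * (√(2 * δ) / κ * J + d * (28 * (δ / κ) / d * (X + V))) := by
    gcongr
    · exact hs.periodNorm_layerBump_mul_le c₀
    · exact h.periodNorm_deriv_layerBump_mul_le hs
  have normalize : η * κ * V * (√(2 * δ) / κ * J + d * (28 * (δ / κ) / d * (X + V)))
      = η * √(2 * δ) * V * J + 28 * η * δ * V * (X + V) := by field_simp
  have local_part : |periodInt fun x => √(layerBump μ κ x) * ((sin x - μ) * helmholtz m ψ x)
      * (√(layerBump μ κ x) * ψ x)| ≤ √(3 * ε * δ) * V * J :=
    (Kolmogorov.abs_periodInt_mul_le (by fun_prop) (by fun_prop)).trans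
      (mul_le_mul_of_nonneg_right (hs.periodNorm_sqrt_layerBump_le hε hε1 cv h.helmholtz_le hE)
        (periodNorm_nonneg _))
  linarith [le_of_abs_le tested, neg_le_of_abs_le local_part]

end IsRayleighSol

/-- The regularization `(sin - μ) / ((sin - μ)² + κ²)` of `1 / (sin - μ)`. -/
def layerInv (μ κ x : ℝ) : ℝ := (sin x - μ) * layerWeight μ κ x ^ 2

lemma periodic_layerInv (μ κ : ℝ) : Function.Periodic (layerInv μ κ) (2 * π) := fun x => by
  simp only [layerInv, sin_add_two_pi, periodic_layerWeight μ κ x]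

lemma hasDerivAt_layerInv (hκ : 0 < κ) (μ x : ℝ) :
    HasDerivAt (layerInv μ κ) (cos x * layerWeight μ κ x ^ 2
      * (1 - 2 * ((sin x - μ) * layerWeight μ κ x) ^ 2)) x := by
  refine (((hasDerivAt_sin x).sub_const μ).mul
    ((hasDerivAt_layerWeight hκ μ x).pow 2)).congr_deriv ?_
  simp only [Pi.pow_apply]
  push_cast
  ring

lemma abs_layerInv_le (hκ : 0 < κ) (μ x : ℝ) : |layerInv μ κ x| ≤ |layerWeight μ κ x| := by
  have hσ := layerWeight_pos hκ μ x
  rw [layerInv, sq, ← mul_assoc, abs_mul, abs_mul, abs_of_pos hσ]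
  exact mul_le_of_le_one_left hσ.le (abs_sin_sub_mul_layerWeight_le hκ μ x)

lemma IsLayer.abs_deriv_layerInv_le (hs : IsLayer μ δ κ d) (x : ℝ) :
    |deriv (layerInv μ κ) x| ≤ 2 / d * |layerWeight μ κ x| := by
  have hσ := layerWeight_pos hs.κ_pos μ x
  have hd := hs.d_pos
  have hfactor : |1 - 2 * ((sin x - μ) * layerWeight μ κ x) ^ 2| ≤ 1 := by
    rw [abs_le]
    constructor <;> linarith [sq_layerWeight_add_sq hs.κ_pos μ x,
      sq_nonneg (κ * layerWeight μ κ x), sq_nonneg ((sin x - μ) * layerWeight μ κ x)]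
  rw [(hasDerivAt_layerInv hs.κ_pos μ x).deriv, sq, ← mul_assoc, abs_mul, abs_mul, abs_mul,
    abs_of_pos hσ]
  calc |cos x| * layerWeight μ κ x * layerWeight μ κ x
        * |1 - 2 * ((sin x - μ) * layerWeight μ κ x) ^ 2|
      ≤ 2 / d * layerWeight μ κ x * 1 := by
        gcongr ?_ * _ * ?_
        exact hs.abs_cos_mul_layerWeight_le x
    _ = 2 / d * layerWeight μ κ x := mul_one _

lemma hasDerivAt_coercive_primitive (hκ : 0 < κ) (μ m : ℝ) (hψ : ContDiff ℝ 2 ψ) (x : ℝ) :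
    HasDerivAt (fun x => -(1 / 2) * (deriv ψ x * ψ x)
        + 1 / 2 * (cos x * deriv ψ x ^ 2) - m / 2 * (cos x * ψ x ^ 2)
        + μ / 2 * (layerInv μ κ x * (cos x * ψ x ^ 2)))
      (μ * ((1 + sin x) * (layerBump μ κ x * ψ x ^ 2))
        + -1 * (rayleighOp μ m ψ x * (layerInv μ κ x * (1 / 2 * ψ x - cos x * deriv ψ x)))
        + -κ * ((κ * layerWeight μ κ x * helmholtz m ψ x)
            * (layerWeight μ κ x * (1 / 2 * ψ x - cos x * deriv ψ x)))
        + -(1 / 2) * ((1 + sin x) * deriv ψ x ^ 2) + -(m / 2) * ((1 - sin x) * ψ x ^ 2)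
        + -(μ * (1 + μ) / 2) * ((1 - sin x) * (layerWeight μ κ x * ψ x) ^ 2)) x := by
  have d₀ := (hψ.differentiable two_ne_zero x).hasDerivAt
  have d₁ := (hψ.differentiable_deriv_two x).hasDerivAt
  have dc := hasDerivAt_cos x
  refine ((((d₁.mul d₀).const_mul (-(1 / 2))).add ((dc.mul (d₁.pow 2)).const_mul (1 / 2))).sub
    ((dc.mul (d₀.pow 2)).const_mul (m / 2)) |>.add
    (((hasDerivAt_layerInv hκ μ x).mul (dc.mul (d₀.pow 2))).const_mul (μ / 2))).congr_deriv ?_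
  simp only [Pi.pow_apply, Pi.mul_apply, rayleighOp, smul_eq_mul, helmholtz, layerInv, layerBump]
  push_cast
  linear_combination (μ / 2 * layerWeight μ κ x ^ 2
      * (1 - 2 * ((sin x - μ) * layerWeight μ κ x) ^ 2) * ψ x ^ 2) * sin_sq_add_cos_sq x
    + ((deriv (deriv ψ) x - m * ψ x) * (1 / 2 * ψ x - cos x * deriv ψ x)
      - μ * layerWeight μ κ x ^ 2 * ψ x ^ 2 * (1 - sin x) * (1 + sin x))
      * sq_layerWeight_add_sq hκ μ x

/-- Rayleigh's trick: the multiplier `(ψ / 2 - cos ψ') / (sin - μ)`, here regularized, makes the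
quadratic form coercive. -/
lemma coercive_identity (hκ : 0 < κ) (μ m : ℝ) (hψ : ContDiff ℝ 2 ψ)
    (hp : Function.Periodic ψ (2 * π)) :
    1 / 2 * (periodInt fun x => (1 + sin x) * deriv ψ x ^ 2)
        + m / 2 * (periodInt fun x => (1 - sin x) * ψ x ^ 2)
        + μ * (1 + μ) / 2 * (periodInt fun x => (1 - sin x) * (layerWeight μ κ x * ψ x) ^ 2)
      = μ * (periodInt fun x => (1 + sin x) * (layerBump μ κ x * ψ x ^ 2))
        - (periodInt fun x =>
            rayleighOp μ m ψ x * (layerInv μ κ x * (1 / 2 * ψ x - cos x * deriv ψ x)))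
        - κ * (periodInt fun x => (κ * layerWeight μ κ x * helmholtz m ψ x)
            * (layerWeight μ κ x * (1 / 2 * ψ x - cos x * deriv ψ x))) := by
  have c₀ := hψ.continuous
  have c₁ := hψ.continuous_deriv one_le_two
  have cv := (contDiff_helmholtz (n := 0) (by simpa only [zero_add] using hψ) m).continuous
  have cσ := continuous_layerWeight hκ μ
  have cb := continuous_layerBump hκ μ
  have ck := continuous_of_hasDerivAt (hasDerivAt_layerInv hκ μ)
  have cR : Continuous (rayleighOp μ m ψ) := by unfold rayleighOp; fun_prop
  have key := periodInt_deriv_eq_zero (hasDerivAt_coercive_primitive hκ μ m hψ)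
    (by fun_prop) fun x => by
      simp only [hp x, periodic_deriv hp x, cos_add_two_pi, periodic_layerInv μ κ x]
  rw [periodInt_add (by fun_prop) (by fun_prop), periodInt_add (by fun_prop) (by fun_prop),
    periodInt_add (by fun_prop) (by fun_prop), periodInt_add (by fun_prop) (by fun_prop),
    periodInt_add (by fun_prop) (by fun_prop)] at key
  simp only [periodInt_const_mul] at key
  linarith

namespace IsRayleighSol

lemma periodNorm_multiplier_le (h : IsRayleighSol μ κ d m η V ψ h₁ h₂) (hs : IsLayer μ δ κ d) :
    periodNorm (fun x => layerWeight μ κ x * (1 / 2 * ψ x - cos x * deriv ψ x))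
      ≤ 12 * (δ / κ) * (periodNorm (fun x => layerWeight μ κ x * ψ x) + V) := by
  have c₀ := h.contDiff.continuous
  have c₁ := h.continuous_deriv
  have cσ := continuous_layerWeight hs.κ_pos μ
  have hD := hs.one_le_ratio
  have hV := h.V_nonneg
  have hX := periodNorm_nonneg fun x => layerWeight μ κ x * ψ x
  have split := periodNorm_add_le (f := fun x => (1 / 2 : ℝ) • (layerWeight μ κ x * ψ x))
    (g := fun x => (-1 : ℝ) • (cos x * layerWeight μ κ x * deriv ψ x))
    (by fun_prop) (by fun_prop)
  rw [periodNorm_const_smul, periodNorm_const_smul, norm_neg, norm_one,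
    norm_of_nonneg (by norm_num : (0 : ℝ) ≤ 1 / 2)] at split
  calc periodNorm (fun x => layerWeight μ κ x * (1 / 2 * ψ x - cos x * deriv ψ x))
      = periodNorm (fun x => (1 / 2 : ℝ) • (layerWeight μ κ x * ψ x)
          + (-1 : ℝ) • (cos x * layerWeight μ κ x * deriv ψ x)) := by
        congr 1; funext x; simp only [smul_eq_mul]; ring
    _ ≤ 12 * (δ / κ) * (periodNorm (fun x => layerWeight μ κ x * ψ x) + V) := by
        linarith [h.periodNorm_cos_deriv_le hs, mul_le_mul_of_nonneg_right hD (add_nonneg hX hV)]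

lemma periodNorm_deriv_multiplier_le (h : IsRayleighSol μ κ d m η V ψ h₁ h₂)
    (hs : IsLayer μ δ κ d) :
    periodNorm (fun x => layerWeight μ κ x
        * ((1 / 2 + sin x) * deriv ψ x - cos x * deriv (deriv ψ) x))
      ≤ 10 / d * (periodNorm (fun x => layerWeight μ κ x * ψ x) + V) := by
  have c₁ := h.continuous_deriv
  have c₂ := h.continuous_deriv_deriv
  have cσ := continuous_layerWeight hs.κ_pos μ
  have hd := hs.d_pos
  have hV := h.V_nonneg
  have first : periodNorm (fun x => (1 / 2 + sin x) * (layerWeight μ κ x * deriv ψ x))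
      ≤ 3 / 2 * periodNorm (fun x => layerWeight μ κ x * deriv ψ x) :=
    periodNorm_le_mul (by fun_prop) (by fun_prop) (by norm_num) fun x => by
      rw [norm_mul]
      gcongr
      rw [norm_eq_abs, abs_le]
      constructor <;> linarith [sin_le_one x, neg_one_le_sin x]
  have second : periodNorm (fun x => -(cos x * layerWeight μ κ x * deriv (deriv ψ) x))
      ≤ 2 / d * periodNorm (deriv (deriv ψ)) :=
    periodNorm_le_mul (by fun_prop) c₂ (by positivity) fun x => by
      rw [norm_neg, norm_mul, norm_mul, norm_of_nonneg (layerWeight_pos hs.κ_pos μ x).le]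
      exact mul_le_mul_of_nonneg_right (hs.abs_cos_mul_layerWeight_le x) (norm_nonneg _)
  set X := periodNorm fun x => layerWeight μ κ x * ψ x
  have hX : 0 ≤ X := periodNorm_nonneg _
  calc periodNorm (fun x => layerWeight μ κ x
        * ((1 / 2 + sin x) * deriv ψ x - cos x * deriv (deriv ψ) x))
      = periodNorm (fun x => (1 / 2 + sin x) * (layerWeight μ κ x * deriv ψ x)
          + -(cos x * layerWeight μ κ x * deriv (deriv ψ) x)) := by congr 1; funext x; ring
    _ ≤ 3 / 2 * (5 / d * (X + V)) + 2 / d * (X + V) := by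
        refine (periodNorm_add_le (by fun_prop) (by fun_prop)).trans (add_le_add
          (first.trans (by gcongr; exact h.periodNorm_deriv_le hs)) (second.trans ?_))
        gcongr
        linarith [h.periodNorm_deriv_deriv_le]
    _ = 19 / 2 / d * (X + V) := by ring
    _ ≤ 10 / d * (X + V) := by gcongr; norm_num

lemma hasDerivAt_multiplier (h : IsRayleighSol μ κ d m η V ψ h₁ h₂) (x : ℝ) :
    HasDerivAt (fun x => 1 / 2 * ψ x - cos x * deriv ψ x)
      ((1 / 2 + sin x) * deriv ψ x - cos x * deriv (deriv ψ) x) x :=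
  (((h.hasDerivAt x).const_mul (1 / 2)).sub
    ((hasDerivAt_cos x).mul (h.hasDerivAt_deriv x))).congr_deriv (by ring)

lemma periodNorm_deriv_layerInv_mul_multiplier_le (h : IsRayleighSol μ κ d m η V ψ h₁ h₂)
    (hs : IsLayer μ δ κ d) :
    periodNorm (fun x => deriv (layerInv μ κ) x * (1 / 2 * ψ x - cos x * deriv ψ x)
        + layerInv μ κ x * ((1 / 2 + sin x) * deriv ψ x - cos x * deriv (deriv ψ) x))
      ≤ 34 * (δ / κ) / d * (periodNorm (fun x => layerWeight μ κ x * ψ x) + V) := by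
  have c₁ := h.continuous_deriv
  have c₂ := h.continuous_deriv_deriv
  have hκ := hs.κ_pos
  have hd := hs.d_pos
  have hV := h.V_nonneg
  have cσ := continuous_layerWeight hκ μ
  have ck := continuous_of_hasDerivAt (hasDerivAt_layerInv hκ μ)
  have ck' : Continuous (deriv (layerInv μ κ)) := by
    rw [funext fun x => (hasDerivAt_layerInv hκ μ x).deriv]; fun_prop
  set g := fun x => 1 / 2 * ψ x - cos x * deriv ψ x
  set g' := fun x => (1 / 2 + sin x) * deriv ψ x - cos x * deriv (deriv ψ) x
  set X := periodNorm fun x => layerWeight μ κ x * ψ x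
  have hX : 0 ≤ X := periodNorm_nonneg _
  have cg := continuous_of_hasDerivAt h.hasDerivAt_multiplier
  have cg' : Continuous g' := by fun_prop
  calc _ ≤ 2 / d * periodNorm (fun x => layerWeight μ κ x * g x)
        + 1 * periodNorm (fun x => layerWeight μ κ x * g' x) :=
        periodNorm_deriv_mul_le ck ck' cg cg' cσ zero_le_one (by positivity)
          (fun x => (abs_layerInv_le hκ μ x).trans_eq (one_mul _).symm) hs.abs_deriv_layerInv_le
    _ ≤ 2 / d * (12 * (δ / κ) * (X + V)) + 1 * (10 * 1 / d * (X + V)) := by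
        gcongr
        · exact h.periodNorm_multiplier_le hs
        · simpa only [mul_one] using h.periodNorm_deriv_multiplier_le hs
    _ ≤ 2 / d * (12 * (δ / κ) * (X + V)) + 1 * (10 * (δ / κ) / d * (X + V)) := by
        gcongr; exact hs.one_le_ratio
    _ = 34 * (δ / κ) / d * (X + V) := by ring

lemma abs_periodInt_multiplier_le (h : IsRayleighSol μ κ d m η V ψ h₁ h₂)
    (hs : IsLayer μ δ κ d) :
    |periodInt fun x => rayleighOp μ m ψ x * (layerInv μ κ x * (1 / 2 * ψ x - cos x * deriv ψ x))|
      ≤ 46 * η * δ * V * (periodNorm (fun x => layerWeight μ κ x * ψ x) + V) := by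
  have hκ := hs.κ_pos
  have hd := hs.d_pos
  have hη := h.η_nonneg
  have hV := h.V_nonneg
  have c₁ := h.continuous_deriv
  have c₂ := h.continuous_deriv_deriv
  have cσ := continuous_layerWeight hκ μ
  have ck := continuous_of_hasDerivAt (hasDerivAt_layerInv hκ μ)
  have ck' : Continuous (deriv (layerInv μ κ)) := by
    rw [funext fun x => (hasDerivAt_layerInv hκ μ x).deriv]; fun_prop
  set g := fun x => 1 / 2 * ψ x - cos x * deriv ψ x
  set g' := fun x => (1 / 2 + sin x) * deriv ψ x - cos x * deriv (deriv ψ) x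
  set X := periodNorm fun x => layerWeight μ κ x * ψ x
  have cg := continuous_of_hasDerivAt h.hasDerivAt_multiplier
  have value : periodNorm (fun x => layerInv μ κ x * g x) ≤ 12 * (δ / κ) * (X + V) := by
    refine (periodNorm_le (by fun_prop) (by fun_prop) fun x => ?_).trans
      (h.periodNorm_multiplier_le hs)
    rw [norm_mul, norm_mul]
    exact mul_le_mul_of_nonneg_right (abs_layerInv_le hκ μ x) (norm_nonneg _)
  calc _ ≤ η * κ * V * (periodNorm (fun x => layerInv μ κ x * g x) + d * periodNorm
          fun x => deriv (layerInv μ κ) x * g x + layerInv μ κ x * g' x) :=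
        h.abs_periodInt_mul_le
          (fun x => (hasDerivAt_layerInv hκ μ x).differentiableAt.hasDerivAt.fun_mul
            (h.hasDerivAt_multiplier x))
          (by fun_prop) fun x => by
            simp only [g, h.periodic x, periodic_deriv h.periodic x, cos_add_two_pi,
              periodic_layerInv μ κ x]
    _ ≤ η * κ * V * (12 * (δ / κ) * (X + V) + d * (34 * (δ / κ) / d * (X + V))) := by
        gcongr; exact h.periodNorm_deriv_layerInv_mul_multiplier_le hs
    _ = 46 * η * δ * V * (X + V) := by field_simp; ring

lemma coercive_le (h : IsRayleighSol μ κ d m η V ψ h₁ h₂) (hs : IsLayer μ δ κ d) (hε : 0 ≤ ε)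
    (hE : periodNorm (fun x => κ * layerWeight μ κ x * helmholtz m ψ x) ≤ ε * V) :
    1 / 2 * (periodInt fun x => (1 + sin x) * deriv ψ x ^ 2)
        + μ / 2 * (periodInt fun x => (1 - sin x) * (layerWeight μ κ x * ψ x) ^ 2)
      ≤ 2 * μ * periodNorm (fun x => √(layerBump μ κ x) * ψ x) ^ 2
        + (46 * η + 12 * ε) * δ * V * (periodNorm (fun x => layerWeight μ κ x * ψ x) + V) := by
  have c₀ := h.contDiff.continuous
  have c₁ := h.continuous_deriv
  have cv := h.continuous_helmholtz
  have hκ := hs.κ_pos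
  have hμ := hs.mu_pos
  have hV := h.V_nonneg
  have cσ := continuous_layerWeight hκ μ
  have cb := continuous_layerBump hκ μ
  have one_sub_sin_nonneg (x) : 0 ≤ 1 - sin x := sub_nonneg.2 (sin_le_one x)
  set X := periodNorm fun x => layerWeight μ κ x * ψ x
  have bump : (periodInt fun x => (1 + sin x) * (layerBump μ κ x * ψ x ^ 2))
      ≤ 2 * periodNorm (fun x => √(layerBump μ κ x) * ψ x) ^ 2 := by
    rw [sq_periodNorm_real, ← periodInt_const_mul]
    refine periodInt_mono (by fun_prop) (by fun_prop) fun x _ => ?_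
    have := layerBump_nonneg μ κ x
    rw [mul_pow, sq_sqrt this]
    gcongr
    linarith [sin_le_one x]
  have commutator : |κ * (periodInt fun x => (κ * layerWeight μ κ x * helmholtz m ψ x)
      * (layerWeight μ κ x * (1 / 2 * ψ x - cos x * deriv ψ x)))|
      ≤ κ * (ε * V * (12 * (δ / κ) * (X + V))) := by
    rw [abs_mul, abs_of_pos hκ]
    refine mul_le_mul_of_nonneg_left ((Kolmogorov.abs_periodInt_mul_le (by fun_prop)
      (by fun_prop)).trans ?_) hκ.le
    exact mul_le_mul hE (h.periodNorm_multiplier_le hs) (periodNorm_nonneg _) (by positivity)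
  have normalize : κ * (ε * V * (12 * (δ / κ) * (X + V))) = 12 * ε * δ * V * (X + V) := by
    field_simp
  have potential : 0 ≤ m / 2 * periodInt fun x => (1 - sin x) * ψ x ^ 2 :=
    mul_nonneg (div_nonneg h.m_nonneg zero_le_two) <|
      periodInt_nonneg fun x => mul_nonneg (one_sub_sin_nonneg x) (sq_nonneg _)
  have weighted : 0 ≤ μ ^ 2 / 2 * periodInt fun x => (1 - sin x) * (layerWeight μ κ x * ψ x) ^ 2 :=
    mul_nonneg (by positivity) <|
      periodInt_nonneg fun x => mul_nonneg (one_sub_sin_nonneg x) (sq_nonneg _)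
  linarith [coercive_identity hκ μ m h.contDiff_two h.periodic, neg_le_of_abs_le commutator,
    neg_le_of_abs_le (h.abs_periodInt_multiplier_le hs), mul_le_mul_of_nonneg_left bump hμ.le]

end IsRayleighSol

end Coercivity

section Hardy

variable {μ δ κ d m η V ε : ℝ} {ψ h₁ h₂ : ℝ → ℝ}

/-- The inverse distance to the maximum of `sin`, regularized at height `δ`: the weight of the
Hardy inequality at that maximum. -/
def hardyWeight (δ x : ℝ) : ℝ := (δ + (1 - sin x))⁻¹

lemma add_one_sub_sin_pos (hδ : 0 < δ) (x : ℝ) : 0 < δ + (1 - sin x) := by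
  linarith [sin_le_one x]

lemma hardyWeight_mul (hδ : 0 < δ) (x : ℝ) : hardyWeight δ x * (δ + (1 - sin x)) = 1 :=
  inv_mul_cancel₀ (add_one_sub_sin_pos hδ x).ne'

lemma hasDerivAt_hardyWeight (hδ : 0 < δ) (x : ℝ) :
    HasDerivAt (hardyWeight δ) (cos x * hardyWeight δ x ^ 2) x := by
  refine ((((hasDerivAt_sin x).const_sub 1).const_add δ).inv
    (add_one_sub_sin_pos hδ x).ne').congr_deriv ?_
  rw [hardyWeight, neg_neg, inv_pow, div_eq_mul_inv]

lemma continuous_hardyWeight (hδ : 0 < δ) : Continuous (hardyWeight δ) :=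
  continuous_of_hasDerivAt (hasDerivAt_hardyWeight hδ)

lemma mul_sq_periodNorm_hardyWeight_le (hδ : 0 < δ) (hψ : ContDiff ℝ 1 ψ)
    (hp : Function.Periodic ψ (2 * π)) :
    δ * periodNorm (fun x => hardyWeight δ x * ψ x) ^ 2
      ≤ (periodInt fun x => (1 + sin x) * deriv ψ x ^ 2)
        + (2 + δ) * periodInt fun x => (1 - sin x) * (hardyWeight δ x * ψ x) ^ 2 := by
  have c₀ := hψ.continuous
  have cτ := continuous_hardyWeight hδ
  have primitive (x) : HasDerivAt (fun x => -(cos x * hardyWeight δ x * ψ x ^ 2))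
      (δ * (hardyWeight δ x * ψ x) ^ 2 + -(1 + δ) * ((1 - sin x) * (hardyWeight δ x * ψ x) ^ 2)
        + -2 * (cos x * deriv ψ x * (hardyWeight δ x * ψ x))) x := by
    refine ((((hasDerivAt_cos x).mul (hasDerivAt_hardyWeight hδ x)).mul
      ((hψ.differentiable_one x).hasDerivAt.pow 2)).neg).congr_deriv ?_
    simp only [Pi.pow_apply, Pi.mul_apply]
    push_cast
    linear_combination (-(hardyWeight δ x ^ 2 * ψ x ^ 2)) * sin_sq_add_cos_sq x
      + (-(sin x * hardyWeight δ x * ψ x ^ 2)) * hardyWeight_mul hδ x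
  have key := periodInt_deriv_eq_zero primitive (by fun_prop) fun x => by
    simp only [hardyWeight, sin_add_two_pi, cos_add_two_pi, hp x]
  rw [periodInt_add (by fun_prop) (by fun_prop), periodInt_add (by fun_prop) (by fun_prop)] at key
  simp only [periodInt_const_mul] at key
  have young : (2 * periodInt fun x => cos x * deriv ψ x * (hardyWeight δ x * ψ x))
      ≤ (periodInt fun x => (1 + sin x) * deriv ψ x ^ 2)
        + periodInt fun x => (1 - sin x) * (hardyWeight δ x * ψ x) ^ 2 := by
    rw [← periodInt_const_mul, ← periodInt_add (by fun_prop) (by fun_prop)]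
    refine periodInt_mono (by fun_prop) (by fun_prop) fun x _ => ?_
    have h := two_mul_le_add_of_sq_le_mul
      (mul_nonneg (neg_le_iff_add_nonneg'.1 (neg_one_le_sin x)) (sq_nonneg (deriv ψ x)))
      (mul_nonneg (sub_nonneg.2 (sin_le_one x)) (sq_nonneg (hardyWeight δ x * ψ x)))
      (r := cos x * deriv ψ x * (hardyWeight δ x * ψ x)) (le_of_eq ?_)
    · exact h
    · linear_combination (deriv ψ x * (hardyWeight δ x * ψ x)) ^ 2 * sin_sq_add_cos_sq x
  rw [sq_periodNorm_real]
  linarith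

namespace IsLayer

lemma sq_hardyWeight_le (hs : IsLayer μ δ κ d) (x : ℝ) :
    hardyWeight δ x ^ 2 ≤ 2 * layerWeight μ κ x ^ 2 := by
  have hδ := hs.δ_pos
  have hsin := sin_le_one x
  have hμ := abs_le.1 hs.dist_le
  have distance : (sin x - μ) ^ 2 + κ ^ 2 ≤ 2 * (δ + (1 - sin x)) ^ 2 := by
    have h₁ : (sin x - μ) ^ 2 ≤ (δ + (1 - sin x)) ^ 2 :=
      sq_le_sq' (by linarith) (by linarith)
    have h₂ : κ ^ 2 ≤ (δ + (1 - sin x)) ^ 2 :=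
      pow_le_pow_left₀ hs.κ_pos.le (by linarith [hs.κ_le]) 2
    linarith
  set τ := hardyWeight δ x
  set σ := layerWeight μ κ x
  calc τ ^ 2 = τ ^ 2 * (((sin x - μ) * σ) ^ 2 + (κ * σ) ^ 2) := by
        rw [sq_layerWeight_add_sq hs.κ_pos, mul_one]
    _ = τ ^ 2 * σ ^ 2 * ((sin x - μ) ^ 2 + κ ^ 2) := by ring
    _ ≤ τ ^ 2 * σ ^ 2 * (2 * (δ + (1 - sin x)) ^ 2) := by gcongr
    _ = 2 * σ ^ 2 * (τ * (δ + (1 - sin x))) ^ 2 := by ring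
    _ = 2 * σ ^ 2 := by rw [hardyWeight_mul hδ]; ring

lemma mul_sq_layerWeight_le (hs : IsLayer μ δ κ d) (x : ℝ) :
    δ * layerWeight μ κ x ^ 2
      ≤ 2 * (1 - sin x) * layerWeight μ κ x ^ 2 + 9 * δ * hardyWeight δ x ^ 2 := by
  have hδ := hs.δ_pos
  have hsin := sub_nonneg.2 (sin_le_one x)
  set τ := hardyWeight δ x
  set σ := layerWeight μ κ x
  rcases le_or_gt (δ / 2) (1 - sin x) with far | near
  · refine (?_ : _ ≤ 2 * (1 - sin x) * σ ^ 2).trans (le_add_of_nonneg_right (by positivity))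
    gcongr
    linarith
  have distance : (δ + (1 - sin x)) ^ 2 ≤ 9 * ((sin x - μ) ^ 2 + κ ^ 2) := by
    have h : (δ + (1 - sin x)) ^ 2 ≤ (3 / 2 * δ) ^ 2 :=
      pow_le_pow_left₀ (by positivity) (by linarith) 2
    rcases hs.alt with hμ | hκ
    · have : (δ / 2) ^ 2 ≤ (sin x - μ) ^ 2 := pow_le_pow_left₀ (by positivity) (by linarith) 2
      nlinarith [sq_nonneg κ]
    · rw [hκ]
      nlinarith [sq_nonneg (sin x - μ)]
  have comparison : σ ^ 2 ≤ 9 * τ ^ 2 := by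
    calc σ ^ 2 = σ ^ 2 * (τ * (δ + (1 - sin x))) ^ 2 := by
          rw [hardyWeight_mul hδ, one_pow, mul_one]
      _ = σ ^ 2 * τ ^ 2 * (δ + (1 - sin x)) ^ 2 := by ring
      _ ≤ σ ^ 2 * τ ^ 2 * (9 * ((sin x - μ) ^ 2 + κ ^ 2)) := by gcongr
      _ = 9 * τ ^ 2 * (((sin x - μ) * σ) ^ 2 + (κ * σ) ^ 2) := by ring
      _ = 9 * τ ^ 2 := by rw [sq_layerWeight_add_sq hs.κ_pos, mul_one]
  refine (?_ : _ ≤ 9 * δ * τ ^ 2).trans (le_add_of_nonneg_left (by positivity))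
  linarith [mul_le_mul_of_nonneg_left comparison hδ.le]

lemma mul_sq_periodNorm_layerWeight_le (hs : IsLayer μ δ κ d) (hψ : ContDiff ℝ 1 ψ)
    (hp : Function.Periodic ψ (2 * π)) :
    δ * periodNorm (fun x => layerWeight μ κ x * ψ x) ^ 2
      ≤ 9 * (periodInt fun x => (1 + sin x) * deriv ψ x ^ 2)
        + 56 * periodInt fun x => (1 - sin x) * (layerWeight μ κ x * ψ x) ^ 2 := by
  have c₀ := hψ.continuous
  have cσ := continuous_layerWeight hs.κ_pos μ
  have cτ := continuous_hardyWeight hs.δ_pos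
  have to_hardy : δ * periodNorm (fun x => layerWeight μ κ x * ψ x) ^ 2
      ≤ 2 * (periodInt fun x => (1 - sin x) * (layerWeight μ κ x * ψ x) ^ 2)
        + 9 * (δ * periodNorm (fun x => hardyWeight δ x * ψ x) ^ 2) := by
    rw [sq_periodNorm_real, sq_periodNorm_real]
    simp only [← periodInt_const_mul]
    rw [← periodInt_add (by fun_prop) (by fun_prop)]
    refine periodInt_mono (by fun_prop) (by fun_prop) fun x _ => ?_
    linarith [mul_le_mul_of_nonneg_right (hs.mul_sq_layerWeight_le x) (sq_nonneg (ψ x))]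
  have from_hardy : (periodInt fun x => (1 - sin x) * (hardyWeight δ x * ψ x) ^ 2)
      ≤ 2 * periodInt fun x => (1 - sin x) * (layerWeight μ κ x * ψ x) ^ 2 := by
    rw [← periodInt_const_mul]
    refine periodInt_mono (by fun_prop) (by fun_prop) fun x _ => ?_
    linarith [mul_le_mul_of_nonneg_left (hs.sq_hardyWeight_le x)
      (mul_nonneg (sub_nonneg.2 (sin_le_one x)) (sq_nonneg (ψ x)))]
  have coefficient : (2 + δ) * (periodInt fun x => (1 - sin x) * (hardyWeight δ x * ψ x) ^ 2)
      ≤ (2 + 1) * (2 * periodInt fun x => (1 - sin x) * (layerWeight μ κ x * ψ x) ^ 2) :=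
    mul_le_mul (by linarith [hs.δ_le]) from_hardy
      (periodInt_nonneg fun x => mul_nonneg (sub_nonneg.2 (sin_le_one x)) (sq_nonneg _))
      (by norm_num)
  linarith [mul_sq_periodNorm_hardyWeight_le hs.δ_pos hψ hp]

end IsLayer

namespace IsRayleighSol

lemma abs_periodInt_rayleighOp_mul_layerInv_helmholtz_le
    (h : IsRayleighSol μ κ d m η V ψ h₁ h₂) (hs : IsLayer μ δ κ d) :
    |periodInt fun x => rayleighOp μ m ψ x * (layerInv μ κ x * helmholtz m ψ x)|
      ≤ (3 * η + η ^ 2) * V ^ 2 := by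
  have hκ := hs.κ_pos
  have hd := hs.d_pos
  have hη := h.η_nonneg
  have hV := h.V_nonneg
  have cσ := continuous_layerWeight hκ μ
  have cv := h.continuous_helmholtz
  have cv' := h.contDiff_helmholtz.continuous_deriv_one
  have ck := continuous_of_hasDerivAt (hasDerivAt_layerInv hκ μ)
  have ck' : Continuous (deriv (layerInv μ κ)) := by
    rw [funext fun x => (hasDerivAt_layerInv hκ μ x).deriv]; fun_prop
  have σ_mul {f : ℝ → ℝ} (cf : Continuous f) :
      periodNorm (fun x => layerWeight μ κ x * f x) ≤ 1 / κ * periodNorm f :=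
    periodNorm_le_mul (by fun_prop) cf (by positivity) fun x => by
      rw [norm_mul, norm_of_nonneg (layerWeight_pos hκ μ x).le]
      exact mul_le_mul_of_nonneg_right (layerWeight_le hκ μ x) (norm_nonneg _)
  have σ_helmholtz : periodNorm (fun x => layerWeight μ κ x * helmholtz m ψ x) ≤ 1 / κ * V :=
    (σ_mul cv).trans (by gcongr; exact h.helmholtz_le)
  have value : periodNorm (fun x => layerInv μ κ x * helmholtz m ψ x) ≤ 1 / κ * V := by
    refine (periodNorm_le (by fun_prop) (by fun_prop) fun x => ?_).trans σ_helmholtz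
    rw [norm_mul, norm_mul]
    exact mul_le_mul_of_nonneg_right (abs_layerInv_le hκ μ x) (norm_nonneg _)
  have slope : periodNorm (fun x => deriv (layerInv μ κ) x * helmholtz m ψ x
      + layerInv μ κ x * deriv (helmholtz m ψ) x)
      ≤ 2 / d * (1 / κ * V) + 1 * (1 / κ * (η * V / d)) := by
    refine (periodNorm_deriv_mul_le ck ck' cv cv' cσ zero_le_one (by positivity)
      (fun x => (abs_layerInv_le hκ μ x).trans_eq (one_mul _).symm)
      hs.abs_deriv_layerInv_le).trans ?_
    gcongr
    exact (σ_mul cv').trans (by gcongr; exact (le_div_iff₀' hd).2 h.deriv_helmholtz_le)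
  refine (h.abs_periodInt_mul_le (fun x =>
    (hasDerivAt_layerInv hκ μ x).differentiableAt.hasDerivAt.fun_mul
      (h.contDiff_helmholtz.differentiable_one x).hasDerivAt) (by fun_prop)
    ((periodic_layerInv μ κ).mul (periodic_helmholtz h.periodic m))).trans ?_
  calc _ ≤ η * κ * V * (1 / κ * V + d * (2 / d * (1 / κ * V) + 1 * (1 / κ * (η * V / d)))) := by
        gcongr
    _ = (3 * η + η ^ 2) * V ^ 2 := by field_simp; ring

lemma sq_periodNorm_helmholtz_le (h : IsRayleighSol μ κ d m η V ψ h₁ h₂) (hs : IsLayer μ δ κ d)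
    (hE : periodNorm (fun x => κ * layerWeight μ κ x * helmholtz m ψ x) ≤ ε * V) :
    periodNorm (helmholtz m ψ) ^ 2 ≤ (ε ^ 2 + 3 * η + η ^ 2) * V ^ 2
      + μ * periodNorm (fun x => layerWeight μ κ x * ψ x) * V := by
  have hκ := hs.κ_pos
  have cσ := continuous_layerWeight hκ μ
  have c₀ := h.contDiff.continuous
  have cv := h.continuous_helmholtz
  have ck := continuous_of_hasDerivAt (hasDerivAt_layerInv hκ μ)
  have test := h.abs_periodInt_rayleighOp_mul_layerInv_helmholtz_le hs
  have expand : (periodInt fun x => rayleighOp μ m ψ x * (layerInv μ κ x * helmholtz m ψ x))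
      = periodNorm (helmholtz m ψ) ^ 2
        + -1 * periodNorm (fun x => κ * layerWeight μ κ x * helmholtz m ψ x) ^ 2
        + μ * periodInt fun x => layerInv μ κ x * ψ x * helmholtz m ψ x := by
    simp only [sq_periodNorm_real, ← periodInt_const_mul]
    rw [← periodInt_add (by fun_prop) (by fun_prop), ← periodInt_add (by fun_prop) (by fun_prop)]
    congr 1; funext x
    simp only [rayleighOp, layerInv, smul_eq_mul]
    linear_combination helmholtz m ψ x ^ 2 * sq_layerWeight_add_sq hκ μ x
  have singular : |periodInt fun x => layerInv μ κ x * ψ x * helmholtz m ψ x|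
      ≤ periodNorm (fun x => layerWeight μ κ x * ψ x) * V := by
    refine (abs_periodInt_le_mul (f := fun x => layerWeight μ κ x * ψ x) (g := helmholtz m ψ)
      (by fun_prop) (by fun_prop) cv zero_le_one fun x => ?_).trans ?_
    · rw [one_mul, abs_mul, abs_mul, norm_mul]
      exact mul_le_mul_of_nonneg_right
        (mul_le_mul_of_nonneg_right (abs_layerInv_le hκ μ x) (abs_nonneg _)) (abs_nonneg _)
    · rw [one_mul]
      exact mul_le_mul_of_nonneg_left h.helmholtz_le (periodNorm_nonneg _)
  rw [expand] at test
  linarith [le_of_abs_le test, mul_le_mul_of_nonneg_left (neg_le_of_abs_le singular) hs.mu_pos.le,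
    pow_le_pow_left₀ (periodNorm_nonneg _) hE 2]

end IsRayleighSol

end Hardy

section Sobolev

variable {v v' : ℝ → ℝ} {x y : ℝ}

lemma sq_le_sq_add_periodNorm (hv : ∀ x, HasDerivAt v (v' x) x) (hc : Continuous v')
    (hx : x ∈ Set.Icc 0 (2 * π)) (hy : y ∈ Set.Icc 0 (2 * π)) :
    v x ^ 2 ≤ v y ^ 2 + 2 * (periodNorm v * periodNorm v') := by
  have cv := continuous_of_hasDerivAt hv
  set f := fun t => |2 * (v t * v' t)|
  have cf : Continuous f := by fun_prop
  have increment : ∫ t in y..x, 2 * (v t * v' t) = v x ^ 2 - v y ^ 2 :=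
    intervalIntegral.integral_eq_sub_of_hasDerivAt (f := fun t => v t ^ 2)
      (fun t _ => ((hv t).fun_pow 2).congr_deriv (by push_cast; ring))
      (Continuous.intervalIntegrable (by fun_prop) _ _)
  have period : |∫ t in y..x, f t| ≤ |periodInt f| := by
    refine intervalIntegral.abs_integral_mono_interval ?_
      (Filter.Eventually.of_forall fun t => abs_nonneg _) (cf.intervalIntegrable _ _)
    rw [Set.uIoc_of_le two_pi_pos.le]
    exact Set.Ioc_subset_Ioc (le_min hy.1 hx.1) (max_le hy.2 hx.2)
  have bound : |periodInt f| ≤ 2 * (periodNorm v * periodNorm v') :=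
    abs_periodInt_le_mul cf cv hc zero_le_two fun t => by
      rw [abs_abs, abs_mul, abs_mul, abs_two]; rfl
  calc v x ^ 2 = v y ^ 2 + ∫ t in y..x, 2 * (v t * v' t) := by rw [increment]; ring
    _ ≤ v y ^ 2 + |∫ t in y..x, f t| := by
        gcongr
        exact (le_abs_self _).trans (intervalIntegral.norm_integral_le_abs_integral_norm
          (f := fun t => 2 * (v t * v' t)))
    _ ≤ v y ^ 2 + 2 * (periodNorm v * periodNorm v') := by gcongr; exact period.trans bound

lemma sq_le_periodNorm (hv : ∀ x, HasDerivAt v (v' x) x) (hc : Continuous v')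
    (hx : x ∈ Set.Icc 0 (2 * π)) :
    v x ^ 2 ≤ periodNorm v ^ 2 + 2 * (periodNorm v * periodNorm v') := by
  have cv := continuous_of_hasDerivAt hv
  have periodInt_const (c : ℝ) : (periodInt fun _ => c) = 2 * π * c := by simp [periodInt]
  have average : 2 * π * v x ^ 2
      ≤ periodNorm v ^ 2 + 2 * π * (2 * (periodNorm v * periodNorm v')) := by
    rw [← periodInt_const, ← periodInt_const, sq_periodNorm_real,
      ← periodInt_add (by fun_prop) (by fun_prop)]
    exact periodInt_mono (by fun_prop) (by fun_prop) fun y hy => sq_le_sq_add_periodNorm hv hc hx hy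
  have : periodNorm v ^ 2 ≤ 2 * π * periodNorm v ^ 2 :=
    le_mul_of_one_le_left (sq_nonneg _) (by linarith [pi_gt_three])
  refine le_of_mul_le_mul_left ?_ two_pi_pos
  linarith

end Sobolev

section LayerMass

variable {μ δ κ d m η V : ℝ} {ψ h₁ h₂ : ℝ → ℝ}

/-- A periodic kernel of height `1` and width `d` centred at `b`, with the shape of a Poisson
kernel: the part of the critical layer near one critical point. -/
def layerKernel (d b x : ℝ) : ℝ := d ^ 2 / (sin ((x - b) / 2) ^ 2 + d ^ 2)

lemma continuous_layerKernel (hd : 0 < d) (b : ℝ) : Continuous (layerKernel d b) :=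
  Continuous.div (by fun_prop) (by fun_prop) fun y => by positivity

lemma layerKernel_zero_le (hd : 0 < d) {x : ℝ} (hx : x ∈ Set.Icc (-π) π) :
    layerKernel d 0 x ≤ 1 / (1 + (x / (π * d)) ^ 2) := by
  have hπ := pi_pos
  have jordan : (x / π) ^ 2 ≤ sin (x / 2) ^ 2 := by
    have h := mul_abs_le_abs_sin (x := x / 2) (abs_le.2 ⟨by linarith [hx.1], by linarith [hx.2]⟩)
    refine sq_le_sq.2 (le_trans (le_of_eq ?_) h)
    rw [abs_div, abs_div, abs_two, abs_of_pos hπ]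
    field_simp
  have expand : d ^ 2 * (1 + (x / (π * d)) ^ 2) = d ^ 2 + (x / π) ^ 2 := by field_simp
  rw [layerKernel, sub_zero, div_le_div_iff₀ (by positivity) (by positivity), one_mul, expand]
  linarith

lemma periodInt_layerKernel_le (hd : 0 < d) (b : ℝ) :
    periodInt (layerKernel d b) ≤ π ^ 2 * d := by
  have hπ := pi_pos
  have periodic : Function.Periodic (layerKernel d 0) (2 * π) := fun y => by
    simp only [layerKernel, show (y + 2 * π - 0) / 2 = (y - 0) / 2 + π by ring, sin_add_pi, neg_sq]
  have centre : periodInt (layerKernel d b) = ∫ y in (-π)..π, layerKernel d 0 y := by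
    have translate := intervalIntegral.integral_comp_sub_right (a := 0) (b := 2 * π)
      (layerKernel d 0) b
    have shift := periodic.intervalIntegral_add_eq (0 - b) (-π)
    rw [show 0 - b + 2 * π = 2 * π - b by ring, show -π + 2 * π = π by ring] at shift
    rw [← shift, ← translate, periodInt]
    simp only [layerKernel, sub_zero]
  calc periodInt (layerKernel d b) = ∫ y in (-π)..π, layerKernel d 0 y := centre
    _ ≤ ∫ y in (-π)..π, 1 / (1 + (y / (π * d)) ^ 2) :=
        intervalIntegral.integral_mono_on (by linarith)
          ((continuous_layerKernel hd 0).intervalIntegrable _ _)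
          (Continuous.intervalIntegrable (Continuous.div (by fun_prop) (by fun_prop)
            fun y => by positivity) _ _) fun y hy => layerKernel_zero_le hd hy
    _ = π * d * (arctan (1 / d) - arctan (-(1 / d))) := by
        rw [intervalIntegral.integral_comp_div (fun t => 1 / (1 + t ^ 2)) (by positivity),
          integral_one_div_one_add_sq, smul_eq_mul]
        congr 3 <;> field_simp
    _ ≤ π * d * π := by
        gcongr
        rw [arctan_neg]
        linarith [arctan_lt_pi_div_two (1 / d)]
    _ = π ^ 2 * d := by ring

lemma two_mul_abs_sin_mul_abs_cos_le (hμ : -1 ≤ μ) (x : ℝ) :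
    2 * (|sin ((x - arcsin μ) / 2)| * |cos ((x + arcsin μ) / 2)|) ≤ |sin x - μ| := by
  have product : 2 * (|sin ((x - arcsin μ) / 2)| * |cos ((x + arcsin μ) / 2)|)
      = |sin x - sin (arcsin μ)| := by
    rw [sin_sub_sin, abs_mul, abs_mul, abs_two, mul_assoc]
  rw [product]
  rcases le_or_gt μ 1 with h | h
  · rw [sin_arcsin hμ h]
  · have := sin_le_one x
    rw [arcsin_of_one_le h.le, sin_pi_div_two, abs_of_nonpos (by linarith),
      abs_of_nonpos (by linarith)]
    linarith

lemma cos_le_abs_sin_add_abs_cos (a x : ℝ) :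
    cos a ≤ |sin ((x - a) / 2)| + |cos ((x + a) / 2)| := by
  calc cos a = cos ((x + a) / 2) * cos ((x - a) / 2) + sin ((x + a) / 2) * sin ((x - a) / 2) := by
        rw [← cos_sub]; ring_nf
    _ ≤ |cos ((x + a) / 2)| * |cos ((x - a) / 2)| + |sin ((x + a) / 2)| * |sin ((x - a) / 2)| := by
        rw [← abs_mul, ← abs_mul]; exact add_le_add (le_abs_self _) (le_abs_self _)
    _ ≤ |cos ((x + a) / 2)| * 1 + 1 * |sin ((x - a) / 2)| := by
        gcongr
        · exact abs_cos_le_one _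
        · exact abs_sin_le_one _
    _ = |sin ((x - a) / 2)| + |cos ((x + a) / 2)| := by ring

namespace IsLayer

/-- If `δ = 1 - μ` then `L`, the distance to the other critical point, is at least of order `√δ`;
otherwise the two critical points are at distance less than `d` and `L ≥ M` suffices. -/
lemma sq_mul_layerWeight_le (hs : IsLayer μ δ κ d) {M L x : ℝ} (hM : 0 ≤ M) (hML : M ≤ L)
    (hprod : 2 * (M * L) ≤ |sin x - μ|) (hcos : cos (arcsin μ) ≤ M + L) :
    (κ * layerWeight μ κ x) ^ 2 ≤ 2 * (d ^ 2 / (M ^ 2 + d ^ 2)) := by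
  have hκ := hs.κ_pos
  have hd := hs.d_pos
  have hμ := hs.mu_pos
  have hsq : (2 * (M * L)) ^ 2 ≤ (sin x - μ) ^ 2 :=
    sq_le_sq.2 ((abs_of_nonneg (by have := hM.trans hML; positivity)).trans_le hprod)
  have weight : (κ * layerWeight μ κ x) ^ 2 = κ ^ 2 / ((sin x - μ) ^ 2 + κ ^ 2) := by
    rw [eq_div_iff (by positivity)]
    linear_combination κ ^ 2 * sq_layerWeight_add_sq hκ μ x
  rw [weight, ← mul_div_assoc, div_le_div_iff₀ (by positivity) (by positivity)]
  rcases hs.alt with hδ | hδ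
  · have cos_sq : cos (arcsin μ) ^ 2 = 1 - μ ^ 2 := by
      rw [cos_sq', sin_arcsin (by linarith) (by linarith [hs.δ_pos])]
    have hL : δ ≤ 4 * L ^ 2 := by
      have := pow_le_pow_left₀ (cos_arcsin_nonneg μ) hcos 2
      nlinarith
    have hMδ : M ^ 2 * δ ≤ (sin x - μ) ^ 2 := by
      refine le_trans ?_ hsq
      linarith [mul_le_mul_of_nonneg_left hL (sq_nonneg M)]
    rw [hs.κ_sq]
    have := mul_le_mul_of_nonneg_left hMδ (sq_nonneg d)
    have : 0 ≤ d ^ 2 * (sin x - μ) ^ 2 := by positivity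
    have : 0 ≤ d ^ 2 * (d ^ 2 * δ) := mul_nonneg (sq_nonneg d) (hs.κ_sq ▸ sq_nonneg κ)
    linarith
  · have hκd : κ = d ^ 2 :=
      mul_right_cancel₀ hκ.ne' (by rw [← sq, hs.κ_sq, hδ])
    have hM4 : d ^ 2 * (2 * M ^ 2) ^ 2 ≤ d ^ 2 * (sin x - μ) ^ 2 := by
      refine mul_le_mul_of_nonneg_left (le_trans ?_ hsq) (sq_nonneg d)
      exact pow_le_pow_left₀ (by positivity) (by nlinarith) 2
    rw [hκd]
    have : 0 ≤ d ^ 2 * (d ^ 2 - M ^ 2) ^ 2 := by positivity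
    have : 0 ≤ d ^ 2 * (M ^ 2) ^ 2 := by positivity
    have : 0 ≤ d ^ 2 * (d ^ 2) ^ 2 := by positivity
    linarith

lemma sq_mul_layerWeight_le_layerKernel (hs : IsLayer μ δ κ d) (x : ℝ) :
    (κ * layerWeight μ κ x) ^ 2
      ≤ 2 * (layerKernel d (arcsin μ) x + layerKernel d (π - arcsin μ) x) := by
  have hd := hs.d_pos
  set P := |sin ((x - arcsin μ) / 2)|
  set Q := |cos ((x + arcsin μ) / 2)|
  have hP : 0 ≤ P := abs_nonneg _
  have hQ : 0 ≤ Q := abs_nonneg _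
  have hprod : 2 * (P * Q) ≤ |sin x - μ| :=
    two_mul_abs_sin_mul_abs_cos_le (by linarith [hs.mu_pos]) x
  have hcos : cos (arcsin μ) ≤ P + Q := cos_le_abs_sin_add_abs_cos _ _
  have kernel_P : layerKernel d (arcsin μ) x = d ^ 2 / (P ^ 2 + d ^ 2) := by
    rw [layerKernel, sq_abs]
  have kernel_Q : layerKernel d (π - arcsin μ) x = d ^ 2 / (Q ^ 2 + d ^ 2) := by
    rw [layerKernel, sq_abs, show (x - (π - arcsin μ)) / 2 = (x + arcsin μ) / 2 - π / 2 by ring,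
      sin_sub_pi_div_two, neg_sq]
  rw [kernel_P, kernel_Q]
  have : 0 ≤ d ^ 2 / (P ^ 2 + d ^ 2) := by positivity
  have : 0 ≤ d ^ 2 / (Q ^ 2 + d ^ 2) := by positivity
  rcases le_total P Q with h | h
  · linarith [hs.sq_mul_layerWeight_le hP h hprod hcos]
  · linarith [hs.sq_mul_layerWeight_le hQ h (by rwa [mul_comm Q P]) (by rwa [add_comm])]

lemma sq_periodNorm_mul_layerWeight_le (hs : IsLayer μ δ κ d) :
    periodNorm (fun x => κ * layerWeight μ κ x) ^ 2 ≤ 40 * d := by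
  have hd := hs.d_pos
  have cσ := continuous_layerWeight hs.κ_pos μ
  have c₁ := continuous_layerKernel hd (arcsin μ)
  have c₂ := continuous_layerKernel hd (π - arcsin μ)
  have hπ : π ^ 2 ≤ 10 := by nlinarith [pi_lt_d2, pi_pos]
  calc periodNorm (fun x => κ * layerWeight μ κ x) ^ 2
      ≤ periodInt fun x => 2 * (layerKernel d (arcsin μ) x + layerKernel d (π - arcsin μ) x) := by
        rw [sq_periodNorm_real]
        exact periodInt_mono (by fun_prop) (by fun_prop)
          fun x _ => hs.sq_mul_layerWeight_le_layerKernel x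
    _ = 2 * (periodInt (layerKernel d (arcsin μ))
          + periodInt (layerKernel d (π - arcsin μ))) := by
        rw [periodInt_const_mul, periodInt_add c₁ c₂]
    _ ≤ 2 * (π ^ 2 * d + π ^ 2 * d) := by
        gcongr <;> exact periodInt_layerKernel_le hd _
    _ ≤ 40 * d := by linarith [mul_le_mul_of_nonneg_right hπ hd.le]

end IsLayer

lemma IsRayleighSol.periodNorm_mul_layerWeight_le (h : IsRayleighSol μ κ d m η V ψ h₁ h₂)
    (hs : IsLayer μ δ κ d) (hdη : d ≤ η) :
    periodNorm (fun x => κ * layerWeight μ κ x * helmholtz m ψ x) ≤ 11 * √η * V := by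
  have hd := hs.d_pos
  have hη := h.η_nonneg
  have hV := h.V_nonneg
  have cσ := continuous_layerWeight hs.κ_pos μ
  have cv := h.continuous_helmholtz
  set v := helmholtz m ψ
  set M := periodNorm v ^ 2 + 2 * (periodNorm v * periodNorm (deriv v))
  have hv := periodNorm_nonneg v
  have hv' := periodNorm_nonneg (deriv v)
  have sobolev : periodNorm (fun x => κ * layerWeight μ κ x * v x) ^ 2
      ≤ M * periodNorm (fun x => κ * layerWeight μ κ x) ^ 2 := by
    rw [sq_periodNorm_real, sq_periodNorm_real, ← periodInt_const_mul]
    refine periodInt_mono (by fun_prop) (by fun_prop) fun x hx => ?_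
    rw [mul_pow, mul_comm]
    exact mul_le_mul_of_nonneg_right
      (sq_le_periodNorm (fun x => (h.contDiff_helmholtz.differentiable_one x).hasDerivAt)
        h.contDiff_helmholtz.continuous_deriv_one hx) (sq_nonneg _)
  have hMd : M * d ≤ 3 * η * V ^ 2 := by
    have h₁ : periodNorm v ^ 2 * d ≤ V ^ 2 * η :=
      mul_le_mul (pow_le_pow_left₀ hv h.helmholtz_le 2) hdη hd.le (sq_nonneg _)
    have h₂ : periodNorm v * (d * periodNorm (deriv v)) ≤ V * (η * V) :=
      mul_le_mul h.helmholtz_le h.deriv_helmholtz_le (by positivity) hV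
    linarith
  refine le_of_sq_le_sq ?_ (by positivity)
  rw [mul_pow, mul_pow, sq_sqrt hη]
  have := mul_le_mul_of_nonneg_left hs.sq_periodNorm_mul_layerWeight_le (by positivity : 0 ≤ M)
  linarith [mul_nonneg hη (sq_nonneg V)]

end LayerMass

section Bootstrap

namespace IsRayleighSol

variable {μ δ κ d m η V ε : ℝ} {ψ h₁ h₂ : ℝ → ℝ}

lemma sq_mu_mul_periodNorm_le (h : IsRayleighSol μ κ d m η V ψ h₁ h₂) (hs : IsLayer μ δ κ d)
    (hε : 0 < ε) (hε1 : ε ≤ 1) (hηε : η ≤ ε)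
    (hE : periodNorm (fun x => κ * layerWeight μ κ x * helmholtz m ψ x) ≤ ε * V) :
    (μ * periodNorm (fun x => √(layerBump μ κ x) * ψ x)) ^ 2
      ≤ ε * δ * V * (56 * (μ * periodNorm fun x => layerWeight μ κ x * ψ x) + 122 * V) := by
  have hμ := hs.mu_pos
  have hδ := hs.δ_pos
  have hη := h.η_nonneg
  have hV := h.V_nonneg
  have mass := mul_le_mul_of_nonneg_left
    (h.mu_mul_sq_periodNorm_sqrt_layerBump_le hs hε hε1 hE) hμ.le
  set J := periodNorm fun x => √(layerBump μ κ x) * ψ x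
  set X := periodNorm fun x => layerWeight μ κ x * ψ x
  have hX : 0 ≤ X := periodNorm_nonneg _
  set A := √(3 * ε * δ) + η * √(2 * δ)
  have hA : A ^ 2 ≤ 10 * ε * δ := by
    have hη2 : η ^ 2 ≤ ε := (pow_le_of_le_one hη (hηε.trans hε1) two_ne_zero).trans hηε
    have h₁ := sq_sqrt (by positivity : 0 ≤ 3 * ε * δ)
    have h₂ := sq_sqrt (by positivity : 0 ≤ 2 * δ)
    have := add_sq_le (a := √(3 * ε * δ)) (b := η * √(2 * δ))
    rw [mul_pow, h₁, h₂] at this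
    linarith [mul_le_mul_of_nonneg_right hη2 hδ.le]
  have hA' : A ^ 2 * V ^ 2 ≤ 10 * ε * δ * V ^ 2 := by gcongr
  have error : η * δ * V * (μ * (X + V)) ≤ ε * δ * V * (μ * X + 2 * V) := by
    rw [mul_add]; gcongr; exact hs.mu_le
  linarith [two_mul_le_add_sq (μ * J) (A * V)]

lemma mu_mul_periodNorm_le (h : IsRayleighSol μ κ d m η V ψ h₁ h₂) (hs : IsLayer μ δ κ d)
    (hε : 0 < ε) (hε1 : ε ≤ 1) (hηε : η ≤ ε)
    (hE : periodNorm (fun x => κ * layerWeight μ κ x * helmholtz m ψ x) ≤ ε * V) :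
    μ * periodNorm (fun x => layerWeight μ κ x * ψ x) ≤ 20000 * √ε * V := by
  have hμ := hs.mu_pos
  have hδ := hs.δ_pos
  have hV := h.V_nonneg
  have mass := h.sq_mu_mul_periodNorm_le hs hε hε1 hηε hE
  have coercive := mul_le_mul_of_nonneg_left (h.coercive_le hs hε.le hE) hμ.le
  have hardy := mul_le_mul_of_nonneg_left
    (hs.mul_sq_periodNorm_layerWeight_le (h.contDiff.of_le (by norm_num)) h.periodic) (sq_nonneg μ)
  set J := periodNorm fun x => √(layerBump μ κ x) * ψ x
  set X := periodNorm fun x => layerWeight μ κ x * ψ x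
  set a := periodInt fun x => (1 + sin x) * deriv ψ x ^ 2
  set b := periodInt fun x => (1 - sin x) * (layerWeight μ κ x * ψ x) ^ 2
  have hX : 0 ≤ X := periodNorm_nonneg _
  have ha : 0 ≤ a :=
    periodInt_nonneg fun x => mul_nonneg (by linarith [neg_one_le_sin x]) (sq_nonneg _)
  have error : (46 * η + 12 * ε) * δ * V * (μ * (X + V))
      ≤ 58 * ε * δ * V * (μ * X + 2 * V) := by
    rw [mul_add]; gcongr
    · linarith
    · exact hs.mu_le
  have ha' : μ * (μ * a) ≤ 2 * (μ * a) := mul_le_mul_of_nonneg_right hs.mu_le (by positivity)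
  have quadratic : (μ * X) ^ 2 ≤ 112 * ε * V * (170 * (μ * X) + 360 * V) := by
    refine le_of_mul_le_mul_left ?_ hδ
    linarith [mul_nonneg hμ.le ha]
  refine le_of_sq_le_sq ?_ (by positivity)
  rw [mul_pow (20000 * √ε), mul_pow (20000 : ℝ), sq_sqrt hε.le]
  have hε2 : ε * ε * V ^ 2 ≤ 1 * ε * V ^ 2 := by gcongr
  linarith [two_mul_le_add_sq (μ * X) (19040 * ε * V), (by positivity : 0 ≤ ε * V ^ 2)]

lemma sq_periodNorm_helmholtz_le_sqrt (h : IsRayleighSol μ κ d m η V ψ h₁ h₂)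
    (hs : IsLayer μ δ κ d) (hε : 0 < ε) (hε1 : ε ≤ 1) (hηε : η ≤ ε)
    (hE : periodNorm (fun x => κ * layerWeight μ κ x * helmholtz m ψ x) ≤ ε * V) :
    periodNorm (helmholtz m ψ) ^ 2 ≤ 30000 * √ε * V ^ 2 := by
  have hη := h.η_nonneg
  have hε_sqrt : ε ≤ √ε := le_sqrt_of_sq_le (pow_le_of_le_one hε.le hε1 two_ne_zero)
  have hε2 : ε ^ 2 ≤ ε := pow_le_of_le_one hε.le hε1 two_ne_zero
  have hη2 : η ^ 2 ≤ η := pow_le_of_le_one hη (hηε.trans hε1) two_ne_zero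
  have regular : (ε ^ 2 + 3 * η + η ^ 2) * V ^ 2 ≤ 5 * √ε * V ^ 2 := by gcongr; linarith
  have singular := mul_le_mul_of_nonneg_right
    (h.mu_mul_periodNorm_le hs hε hε1 hηε hE) h.V_nonneg
  linarith [h.sq_periodNorm_helmholtz_le hs hE, (by positivity : 0 ≤ √ε * V ^ 2)]

end IsRayleighSol

theorem exists_rayleigh_threshold : ∃ η : ℝ, 0 < η ∧ η ≤ 1 ∧
    ∀ {μ δ κ d m V : ℝ} {ψ h₁ h₂ : ℝ → ℝ}, IsLayer μ δ κ d → d ≤ η →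
      IsRayleighSol μ κ d m η V ψ h₁ h₂ → periodNorm (helmholtz m ψ) ^ 2 ≤ V ^ 2 / 16 := by
  -- The layer is so thin that `30000 * √ε = 1 / 16` for `ε = 11 * √η`.
  set ε : ℝ := (1 / 480000) ^ 2
  refine ⟨(ε / 11) ^ 2, by positivity, by norm_num [ε], fun {μ δ κ d m V ψ h₁ h₂} hs hd h => ?_⟩
  have layer : 11 * √((ε / 11) ^ 2) = ε := by rw [sqrt_sq (by positivity)]; ring
  have hE := h.periodNorm_mul_layerWeight_le hs hd
  rw [layer] at hE
  have bound := h.sq_periodNorm_helmholtz_le_sqrt hs (by positivity) (by norm_num [ε])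
    (by norm_num [ε]) hE
  rw [sqrt_sq (by norm_num)] at bound
  linarith

end Bootstrap

/-! ### The vorticity equation -/

section Vorticity

/-- `U` is the vorticity of the stream function `Ψ` in the resolvent equation with force `F`: it
solves `i β ((sin - μ) (Ψ'' - m Ψ) + μ Ψ) = U'' - L U - F`, where `Ψ'' - m Ψ` stands for
`(I + A_l⁻¹) U`. The last three fields are what survives of the relation between `U` and `Ψ`, and of
the energy identity. -/
structure IsVorticitySol (μ β m L : ℝ) (Ψ U F : ℝ → ℂ) : Prop where
  m_nonneg : 0 ≤ m
  L_nonneg : 0 ≤ L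
  periodic : Function.Periodic Ψ (2 * π)
  periodic_U : Function.Periodic U (2 * π)
  periodic_F : Function.Periodic F (2 * π)
  contDiff : ContDiff ℝ 3 Ψ
  contDiff_U : ContDiff ℝ 2 U
  continuous_F : Continuous F
  eqn : ∀ x, Complex.I * β * rayleighOp μ m Ψ x = deriv (deriv U) x - L * U x - F x
  U_le : periodNorm U ≤ 2 * periodNorm (helmholtz m Ψ)
  deriv_helmholtz_le : periodNorm (deriv (helmholtz m Ψ)) ≤ periodNorm (deriv U)
  energy : periodNorm (deriv U) ^ 2 + L * periodNorm U ^ 2 ≤ 2 * (periodNorm F * periodNorm U)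

lemma deriv_clm_comp {E F : Type*} [NormedAddCommGroup E] [NormedSpace ℝ E]
    [NormedAddCommGroup F] [NormedSpace ℝ F] (T : E →L[ℝ] F) {f : ℝ → E} (hf : Differentiable ℝ f) :
    deriv (fun x => T (f x)) = fun x => T (deriv f x) :=
  funext fun x => (T.hasFDerivAt.comp_hasDerivAt x (hf x).hasDerivAt).deriv

lemma helmholtz_clm_comp {E F : Type*} [NormedAddCommGroup E] [NormedSpace ℝ E]
    [NormedAddCommGroup F] [NormedSpace ℝ F] (T : E →L[ℝ] F) {f : ℝ → E} (hf : ContDiff ℝ 2 f)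
    (m : ℝ) : helmholtz m (fun x => T (f x)) = fun x => T (helmholtz m f x) := by
  funext x
  rw [helmholtz, deriv_clm_comp T (hf.differentiable two_ne_zero),
    deriv_clm_comp T hf.differentiable_deriv_two, helmholtz, map_sub, map_smul]

lemma helmholtz_comp_add_const {E : Type*} [NormedAddCommGroup E] [NormedSpace ℝ E] (m : ℝ)
    (f : ℝ → E) (a : ℝ) : helmholtz m (fun x => f (x + a)) = fun x => helmholtz m f (x + a) := by
  funext x
  simp only [helmholtz, funext (deriv_comp_add_const f a), deriv_comp_add_const]

lemma periodNorm_comp_add_const {E : Type*} [NormedAddCommGroup E] {f : ℝ → E}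
    (hf : Function.Periodic f (2 * π)) (a : ℝ) :
    periodNorm (fun x => f (x + a)) = periodNorm f := by
  have shift := (hf.comp fun z => ‖z‖ ^ 2).intervalIntegral_add_eq a 0
  simp only [periodNorm, periodInt, Function.comp_def, zero_add] at shift ⊢
  rw [intervalIntegral.integral_comp_add_right (fun x => ‖f x‖ ^ 2), zero_add, add_comm (2 * π),
    shift]

lemma periodic_comp_add_const {E : Type*} {f : ℝ → E} {c : ℝ} (hf : Function.Periodic f c) (a : ℝ) :
    Function.Periodic (fun x => f (x + a)) c := fun x => by
  simp only [add_right_comm x c a, hf (x + a)]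

lemma sq_periodNorm_complex {f : ℝ → ℂ} (hf : Continuous f) :
    periodNorm f ^ 2 = periodNorm (fun x => Complex.reCLM (f x)) ^ 2
      + periodNorm (fun x => Complex.imCLM (f x)) ^ 2 := by
  rw [sq_periodNorm, sq_periodNorm_real, sq_periodNorm_real,
    ← periodInt_add (by fun_prop) (by fun_prop)]
  congr 1; funext x
  rw [← Complex.normSq_eq_norm_sq, Complex.normSq_apply, Complex.reCLM_apply, Complex.imCLM_apply,
    sq, sq]

lemma periodNorm_clm_inv_mul_le {T : ℂ →L[ℝ] ℝ} (hT : ∀ z, |T z| ≤ ‖z‖) (β : ℝ) {f : ℝ → ℂ}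
    (hf : Continuous f) :
    periodNorm (fun x => T ((Complex.I * β)⁻¹ * f x)) ≤ |β|⁻¹ * periodNorm f := by
  calc _ ≤ periodNorm (fun x => (Complex.I * β)⁻¹ • f x) :=
        periodNorm_le (by fun_prop) (by fun_prop) fun x => hT _
    _ = |β|⁻¹ * periodNorm f := by
        rw [periodNorm_const_smul, norm_inv, norm_mul, Complex.norm_I, one_mul, Complex.norm_real,
          norm_eq_abs]

namespace IsVorticitySol

variable {μ δ κ d β m L η : ℝ} {Ψ U F : ℝ → ℂ}

lemma mul_periodNorm_deriv_le (h : IsVorticitySol μ β m L Ψ U F) (hη : 0 ≤ η)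
    (hF : periodNorm F * d ^ 2 ≤ η ^ 2 / 4 * periodNorm U) :
    d * periodNorm (deriv U) ≤ η * periodNorm U := by
  have hU := periodNorm_nonneg U
  have dissipation : periodNorm (deriv U) ^ 2 ≤ 2 * (periodNorm F * periodNorm U) :=
    (le_add_of_nonneg_right (mul_nonneg h.L_nonneg (sq_nonneg _))).trans h.energy
  refine le_of_sq_le_sq ?_ (by positivity)
  calc (d * periodNorm (deriv U)) ^ 2 = d ^ 2 * periodNorm (deriv U) ^ 2 := mul_pow _ _ _
    _ ≤ d ^ 2 * (2 * (periodNorm F * periodNorm U)) := by gcongr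
    _ = 2 * (periodNorm F * d ^ 2) * periodNorm U := by ring
    _ ≤ 2 * (η ^ 2 / 4 * periodNorm U) * periodNorm U := by gcongr
    _ ≤ (η * periodNorm U) ^ 2 := by linarith [sq_nonneg (η * periodNorm U)]

lemma L_mul_periodNorm_le (h : IsVorticitySol μ β m L Ψ U F) :
    L * periodNorm U ≤ 2 * periodNorm F := by
  rcases (periodNorm_nonneg U).eq_or_lt with hU | hU
  · rw [← hU, mul_zero]
    exact mul_nonneg zero_le_two (periodNorm_nonneg F)
  · refine le_of_mul_le_mul_right ?_ hU
    linarith [h.energy, sq_nonneg (periodNorm (deriv U))]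

lemma periodNorm_regular_le (h : IsVorticitySol μ β m L Ψ U F) (hη : 0 ≤ η) (hη1 : η ≤ 1)
    (hF : periodNorm F * d ^ 2 ≤ η ^ 2 / 4 * periodNorm U) :
    periodNorm (fun x => -L * U x - F x) * d ^ 2 ≤ η * periodNorm U := by
  have cU := h.contDiff_U.continuous
  have cF := h.continuous_F
  have hU := periodNorm_nonneg U
  have split : periodNorm (fun x => -L * U x - F x) ≤ L * periodNorm U + periodNorm F := by
    have triangle := periodNorm_add_le (f := fun x => (-L : ℂ) • U x)
      (g := fun x => (-1 : ℂ) • F x) (by fun_prop) (by fun_prop)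
    rw [periodNorm_const_smul, periodNorm_const_smul] at triangle
    simpa only [norm_neg, norm_one, one_mul, Complex.norm_real,
      norm_of_nonneg h.L_nonneg, smul_eq_mul, neg_one_mul, ← sub_eq_add_neg] using triangle
  calc periodNorm (fun x => -L * U x - F x) * d ^ 2
      ≤ 3 * periodNorm F * d ^ 2 := by gcongr; linarith [h.L_mul_periodNorm_le]
    _ = 3 * (periodNorm F * d ^ 2) := by ring
    _ ≤ 3 * (η ^ 2 / 4 * periodNorm U) := by gcongr
    _ = 3 / 4 * (η ^ 2 * periodNorm U) := by ring
    _ ≤ 1 * (η * periodNorm U) := by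
      gcongr
      · norm_num
      · exact pow_le_of_le_one hη hη1 two_ne_zero
    _ = η * periodNorm U := one_mul _

/-- If the a priori estimate failed, then every real component of `Ψ` would solve the Rayleigh
equation with a small right-hand side. -/
lemma isRayleighSol (h : IsVorticitySol μ β m L Ψ U F) (hd : 0 ≤ d) (hκ : 0 ≤ κ)
    (hβ : |β| * (κ * d ^ 2) = 1) (hη : 0 ≤ η) (hη1 : η ≤ 1)
    (hF : periodNorm F * d ^ 2 ≤ η ^ 2 / 4 * periodNorm U) {T : ℂ →L[ℝ] ℝ}
    (hT : ∀ z, |T z| ≤ ‖z‖) :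
    IsRayleighSol μ κ d m η (2 * periodNorm (helmholtz m Ψ)) (fun x => T (Ψ x))
      (fun x => T ((Complex.I * β)⁻¹ * (-L * U x - F x)))
      (fun x => T ((Complex.I * β)⁻¹ * deriv U x)) := by
  have cU := h.contDiff_U.continuous
  have cF := h.continuous_F
  have cU' : ContDiff ℝ 1 (deriv U) := h.contDiff_U.deriv' (n := 1)
  have cU'₀ := cU'.continuous
  have hΨ2 : ContDiff ℝ 2 Ψ := h.contDiff.of_le (by norm_num)
  have cv : ContDiff ℝ 1 (helmholtz m Ψ) := contDiff_helmholtz (h.contDiff.of_le (by norm_num)) m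
  have cv₀ := cv.continuous
  have cv' := cv.continuous_deriv_one
  have hIβ : Complex.I * (β : ℂ) ≠ 0 :=
    mul_ne_zero Complex.I_ne_zero (Complex.ofReal_ne_zero.2 (by rintro rfl; simp at hβ))
  have inv_β : |β|⁻¹ = κ * d ^ 2 := inv_eq_of_mul_eq_one_right hβ
  have norm_le {f : ℝ → ℂ} (hf : Continuous f) : periodNorm (fun x => T (f x)) ≤ periodNorm f :=
    periodNorm_le (by fun_prop) hf fun x => hT (f x)
  have slow := h.mul_periodNorm_deriv_le hη hF
  have hUV := h.U_le
  refine ⟨h.m_nonneg, hη, fun x => by simp only [h.periodic x],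
    fun x => by simp only [periodic_deriv h.periodic_U x], T.contDiff.comp h.contDiff,
    T.contDiff.comp (contDiff_const.mul cU'), by fun_prop, fun x => ?_, ?_, ?_, ?_, ?_⟩
  · simp only [deriv_clm_comp T ((cU'.differentiable one_ne_zero).const_mul _),
      deriv_const_mul_field]
    rw [← map_add, ← mul_add, rayleighOp, helmholtz_clm_comp T hΨ2, ← map_smul, ← map_smul,
      ← map_add]
    refine congrArg T (eq_inv_mul_iff_mul_eq₀ hIβ |>.2 ((h.eqn x).trans ?_))
    ring
  · refine (periodNorm_clm_inv_mul_le hT β (by fun_prop)).trans ?_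
    calc _ = κ * (periodNorm (fun x => -L * U x - F x) * d ^ 2) := by rw [inv_β]; ring
      _ ≤ κ * (η * periodNorm U) :=
          mul_le_mul_of_nonneg_left (h.periodNorm_regular_le hη hη1 hF) hκ
      _ = η * κ * periodNorm U := by ring
      _ ≤ _ := by gcongr
  · refine (periodNorm_clm_inv_mul_le hT β cU'₀).trans ?_
    calc _ = κ * d * (d * periodNorm (deriv U)) := by rw [inv_β]; ring
      _ ≤ κ * d * (η * periodNorm U) := by gcongr
      _ = η * κ * d * periodNorm U := by ring
      _ ≤ _ := by gcongr
  · rw [helmholtz_clm_comp T hΨ2]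
    linarith [norm_le cv₀, periodNorm_nonneg (helmholtz m Ψ)]
  · rw [helmholtz_clm_comp T hΨ2, deriv_clm_comp T (cv.differentiable one_ne_zero)]
    calc _ ≤ d * periodNorm (deriv U) := by
          gcongr; exact (norm_le cv').trans h.deriv_helmholtz_le
      _ ≤ η * periodNorm U := slow
      _ ≤ _ := by gcongr

lemma comp_add_pi (h : IsVorticitySol μ β m L Ψ U F) :
    IsVorticitySol (-μ) (-β) m L (fun x => Ψ (x + π)) (fun x => U (x + π))
      (fun x => F (x + π)) := by
  have hv := periodic_helmholtz h.periodic m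
  have shift_U := periodNorm_comp_add_const h.periodic_U π
  have shift_U' : periodNorm (deriv fun x => U (x + π)) = periodNorm (deriv U) := by
    rw [funext (deriv_comp_add_const U π)]
    exact periodNorm_comp_add_const (periodic_deriv h.periodic_U) π
  refine ⟨h.m_nonneg, h.L_nonneg, periodic_comp_add_const h.periodic π,
    periodic_comp_add_const h.periodic_U π, periodic_comp_add_const h.periodic_F π,
    h.contDiff.comp (by fun_prop), h.contDiff_U.comp (by fun_prop),
    h.continuous_F.comp (by fun_prop), fun x => ?_, ?_, ?_, ?_⟩
  · have eqn := h.eqn (x + π)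
    simp only [rayleighOp, sin_add_pi] at eqn
    simp only [rayleighOp, helmholtz_comp_add_const, funext (deriv_comp_add_const U π),
      deriv_comp_add_const]
    rw [← eqn]
    simp only [Complex.real_smul]
    push_cast
    ring
  · rw [helmholtz_comp_add_const, shift_U, periodNorm_comp_add_const hv]
    exact h.U_le
  · rw [helmholtz_comp_add_const, funext (deriv_comp_add_const (helmholtz m Ψ) π), shift_U',
      periodNorm_comp_add_const (periodic_deriv hv)]
    exact h.deriv_helmholtz_le
  · rw [shift_U, shift_U', periodNorm_comp_add_const h.periodic_F]
    exact h.energy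

end IsVorticitySol

theorem exists_vorticity_bound : ∃ η : ℝ, 0 < η ∧ η ≤ 1 ∧
    ∀ {μ δ κ d β m L : ℝ} {Ψ U F : ℝ → ℂ}, μ ≠ 0 → IsLayer |μ| δ κ d → d ≤ η →
      |β| * (κ * d ^ 2) = 1 → IsVorticitySol μ β m L Ψ U F →
      η ^ 2 / 4 * periodNorm U ≤ periodNorm F * d ^ 2 := by
  obtain ⟨η, hη, hη1, threshold⟩ := exists_rayleigh_threshold
  have bound_of_pos {μ δ κ d β m L : ℝ} {Ψ U F : ℝ → ℂ} (hs : IsLayer μ δ κ d) (hd : d ≤ η)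
      (hβ : |β| * (κ * d ^ 2) = 1) (h : IsVorticitySol μ β m L Ψ U F) :
      η ^ 2 / 4 * periodNorm U ≤ periodNorm F * d ^ 2 := by
    by_contra! hlt
    have hU : 0 < periodNorm U := pos_of_mul_pos_right
      ((mul_nonneg (periodNorm_nonneg F) (sq_nonneg d)).trans_lt hlt) (by positivity)
    have hΨ2 : ContDiff ℝ 2 Ψ := h.contDiff.of_le (by norm_num)
    have small {T : ℂ →L[ℝ] ℝ} (hT : ∀ z, |T z| ≤ ‖z‖) := threshold hs hd
      (h.isRayleighSol hs.d_pos.le hs.κ_pos.le hβ hη.le hη1 hlt.le hT)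
    have re := small Complex.abs_re_le_norm (T := Complex.reCLM)
    have im := small Complex.abs_im_le_norm (T := Complex.imCLM)
    rw [helmholtz_clm_comp _ hΨ2] at re im
    have cv : Continuous (helmholtz m Ψ) :=
      (contDiff_helmholtz (n := 0) (by simpa using hΨ2) m).continuous
    nlinarith [sq_periodNorm_complex cv, h.U_le]
  refine ⟨η, hη, hη1, fun {μ δ κ d β m L Ψ U F} hμ hs hd hβ h => ?_⟩
  rcases hμ.lt_or_gt with hμ | hμ
  · rw [abs_of_neg hμ] at hs
    have shifted := bound_of_pos hs hd (by rwa [abs_neg]) h.comp_add_pi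
    rwa [periodNorm_comp_add_const h.periodic_U, periodNorm_comp_add_const h.periodic_F] at shifted
  · rw [abs_of_pos hμ] at hs
    exact bound_of_pos hs hd hβ h

end Vorticity

/-! ### Fourier series and the Green operator -/

section DiagonalOperator

variable {ι 𝕜 E : Type*} [RCLike 𝕜] [NormedAddCommGroup E] [InnerProductSpace 𝕜 E]
  (b : HilbertBasis ι 𝕜 E) {a : ι → 𝕜} {K : ℝ}

/-- The operator which is diagonal in the Hilbert basis `b`, with the bounded family of eigenvalues
`a`. -/
def diagonalOp (a : ι → 𝕜) {K : ℝ} (hK : 0 ≤ K) (ha : ∀ i, ‖a i‖ ≤ K) : E →L[𝕜] E :=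
  b.repr.symm.toContinuousLinearEquiv.toContinuousLinearMap ∘L
    lp.mapCLM 2 (fun i => a i • ContinuousLinearMap.id 𝕜 𝕜) hK
      (fun i => by simpa [norm_smul] using ha i) ∘L
    b.repr.toContinuousLinearEquiv.toContinuousLinearMap

lemma inner_diagonalOp (hK : 0 ≤ K) (ha : ∀ i, ‖a i‖ ≤ K) (f : E) (i : ι) :
    inner 𝕜 (b i) (diagonalOp b a hK ha f) = a i * inner 𝕜 (b i) f := by
  simp [diagonalOp, ← HilbertBasis.repr_apply_apply]

lemma isCompactOperator_diagonalOp [CompleteSpace E] (hK : 0 ≤ K) (ha : ∀ i, ‖a i‖ ≤ K)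
    (hs : Summable a) : IsCompactOperator (diagonalOp b a hK ha) := by
  let term (i : ι) : E →L[𝕜] E := a i • InnerProductSpace.rankOne 𝕜 (b i) (b i)
  have norm_term (i : ι) : ‖term i‖ = ‖a i‖ := by
    simp [term, norm_smul, InnerProductSpace.norm_rankOne, b.orthonormal.1 i]
  have summable_term : Summable term := .of_norm (by simpa only [norm_term] using hs.norm)
  have hasSum_term : HasSum term (diagonalOp b a hK ha) := by
    refine summable_term.hasSum_iff.2 (ContinuousLinearMap.ext fun f => ?_)
    refine (summable_term.hasSum.mapL (ContinuousLinearMap.apply 𝕜 E f)).unique ?_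
    convert b.hasSum_repr (diagonalOp b a hK ha f) using 2 with i
    rw [HilbertBasis.repr_apply_apply, inner_diagonalOp, mul_smul]
    rfl
  have compact_term (i : ι) : IsCompactOperator (term i) :=
    ((isCompactOperator_of_locallyCompactSpace_rng
      (ContinuousLinearMap.toSpanSingleton 𝕜 (b i))).comp_clm (innerSL 𝕜 (b i))).smul (a i)
  exact isCompactOperator_of_tendsto hasSum_term <| .of_forall fun s =>
    Submodule.sum_mem (compactOperator (RingHom.id 𝕜) E E) fun i _ => compact_term i

end DiagonalOperator

section FourierCoefficients

/-- The character `y ↦ exp (i n y)` as an element of `L²(𝕋)`. -/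
def character (n : ℤ) : L2T := fourierBasis (T := 2 * π) n

/-- The `n`-th Fourier coefficient, as a functional on `L²(𝕋)`. -/
def coeff (n : ℤ) : L2T →L[ℂ] ℂ := innerSL ℂ (character n)

lemma coeff_apply (n : ℤ) (f : L2T) : coeff n f = inner ℂ (character n) f := rfl

lemma character_eq_toLp (n : ℤ) :
    character n = ContinuousMap.toLp 2 torusMeasure ℂ (fourier n) := by
  rw [character, coe_fourierBasis]

lemma ext_coeff {f g : L2T} (h : ∀ n, coeff n f = coeff n g) : f = g := by
  refine (fourierBasis (T := 2 * π)).repr.injective (lp.ext (funext fun n => ?_))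
  rw [HilbertBasis.repr_apply_apply, HilbertBasis.repr_apply_apply]
  exact h n

lemma hasSum_coeff_smul (f : L2T) : HasSum (fun n => coeff n f • character n) f := by
  have expansion := (fourierBasis (T := 2 * π)).hasSum_repr f
  simp only [HilbertBasis.repr_apply_apply] at expansion
  exact expansion

lemma coeff_character (m n : ℤ) : coeff m (character n) = if m = n then 1 else 0 :=
  orthonormal_iff_ite.1 (fourierBasis (T := 2 * π)).orthonormal m n

lemma hasSum_inner_coeff (f g : L2T) :
    HasSum (fun n => starRingEnd ℂ (coeff n f) * coeff n g) (inner ℂ f g) := by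
  simp only [coeff_apply, inner_conj_symm]
  exact (fourierBasis (T := 2 * π)).hasSum_inner_mul_inner f g

lemma hasSum_sq_norm_coeff (f : L2T) : HasSum (fun n => ‖coeff n f‖ ^ 2) (‖f‖ ^ 2) := by
  rw [← Complex.hasSum_ofReal]
  simpa only [Complex.conj_mul', inner_self_eq_norm_sq_to_K, Complex.coe_algebraMap,
    Complex.ofReal_pow] using hasSum_inner_coeff f f

end FourierCoefficients

section WeakDerivative

lemma continuous_coe_comp {E : Type*} [TopologicalSpace E] (φ : C(Torus, E)) :
    Continuous fun x : ℝ => φ (x : Torus) :=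
  φ.continuous.comp (AddCircle.continuous_mk' _)

lemma integral_torus {E : Type*} [NormedAddCommGroup E] [NormedSpace ℝ E] (f : Torus → E) :
    ∫ y, f y ∂torusMeasure = (2 * π)⁻¹ • ∫ x in 0..2 * π, f (x : Torus) := by
  rw [AddCircle.integral_haarAddCircle, ← AddCircle.intervalIntegral_preimage (2 * π) 0, zero_add]

lemma integral_torus_deriv {φ ψ : C(Torus, ℂ)}
    (h : ∀ x : ℝ, HasDerivAt (fun x : ℝ => φ (x : Torus)) (ψ (x : Torus)) x) :
    ∫ y, ψ y ∂torusMeasure = 0 := by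
  rw [integral_torus, intervalIntegral.integral_eq_sub_of_hasDerivAt (fun x _ => h x)
    ((continuous_coe_comp ψ).intervalIntegrable _ _), AddCircle.coe_period,
    QuotientAddGroup.mk_zero, sub_self, smul_zero]

lemma integral_mul_eq_inner (f : L2T) (φ : C(Torus, ℂ)) :
    ∫ y, f y * φ y ∂torusMeasure
      = inner ℂ (ContinuousMap.toLp 2 torusMeasure ℂ (star φ)) f := by
  rw [L2.inner_def]
  refine integral_congr_ae ?_
  filter_upwards [ContinuousMap.coeFn_toLp (p := 2) (𝕜 := ℂ) torusMeasure (star φ)] with y hy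
  rw [hy]
  simp

lemma coeff_eq_integral (n : ℤ) (f : L2T) :
    coeff n f = ∫ y, f y * fourier (-n) y ∂torusMeasure := by
  rw [integral_mul_eq_inner, coeff_apply, character_eq_toLp]
  congr 2
  ext y
  simp

lemma IsWeakDeriv.coeff_eq {f g : L2T} (h : IsWeakDeriv f g) (n : ℤ) :
    coeff n g = Complex.I * n * coeff n f := by
  have parts := h _ _ (contDiff_fourier_torus (-n)) (hasDerivAt_fourier_torus (-n))
  simp only [ContinuousMap.smul_apply, smul_eq_mul, mul_left_comm] at parts
  rw [integral_const_mul, ← coeff_eq_integral, ← coeff_eq_integral, Int.cast_neg] at parts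
  linear_combination parts

lemma integral_character_mul (n : ℤ) (φ : C(Torus, ℂ)) :
    ∫ y, character n y * φ y ∂torusMeasure = ∫ y, fourier n y * φ y ∂torusMeasure := by
  refine integral_congr_ae ?_
  filter_upwards [coeFn_fourierLp (T := 2 * π) 2 n] with y hy
  rw [character, coe_fourierBasis, hy]

lemma isWeakDeriv_character (n : ℤ) :
    IsWeakDeriv (character n) ((Complex.I * n) • character n) := by
  intro φ ψ _ hψ
  have parts := integral_torus_deriv
    (φ := fourier n * φ) (ψ := fourier n * ψ + (Complex.I * n) • (fourier n * φ)) fun x =>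
      ((hasDerivAt_fourier_torus n x).mul (hψ x)).congr_deriv
        (by simp only [ContinuousMap.add_apply, ContinuousMap.mul_apply, ContinuousMap.smul_apply,
          smul_eq_mul]; ring)
  simp only [ContinuousMap.add_apply, ContinuousMap.mul_apply, ContinuousMap.smul_apply] at parts
  rw [integral_add (Continuous.integrable_of_hasCompactSupport (by fun_prop) (.of_compactSpace _))
    (Continuous.integrable_of_hasCompactSupport (by fun_prop) (.of_compactSpace _)),
    integral_smul] at parts
  rw [integral_smul_mul, integral_character_mul, integral_character_mul]
  exact eq_neg_of_add_eq_zero_left parts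

lemma hasSum_coeff_mul_integral (f : L2T) (φ : C(Torus, ℂ)) :
    HasSum (fun n => coeff n f * ∫ y, character n y * φ y ∂torusMeasure)
      (∫ y, f y * φ y ∂torusMeasure) := by
  simp only [integral_mul_eq_inner]
  simpa using (hasSum_coeff_smul f).mapL
    (innerSL ℂ (ContinuousMap.toLp 2 torusMeasure ℂ (star φ)))

lemma isWeakDeriv_iff_coeff {f g : L2T} :
    IsWeakDeriv f g ↔ ∀ n, coeff n g = Complex.I * n * coeff n f := by
  refine ⟨IsWeakDeriv.coeff_eq, fun h φ ψ hφ hψ => ?_⟩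
  refine (hasSum_coeff_mul_integral f ψ).unique ?_
  refine (hasSum_coeff_mul_integral g φ).neg.congr_fun fun n => ?_
  rw [isWeakDeriv_character n φ ψ hφ hψ, integral_smul_mul, h n]
  ring

end WeakDerivative

section GreenOperator

variable {l : ℤ}

lemma coeff_diagonalOp {a : ℤ → ℂ} {K : ℝ} (hK : 0 ≤ K) (ha : ∀ n, ‖a n‖ ≤ K) (f : L2T) (n : ℤ) :
    coeff n (diagonalOp (fourierBasis (T := 2 * π)) a hK ha f) = a n * coeff n f :=
  inner_diagonalOp (fourierBasis (T := 2 * π)) hK ha f n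

/-- The Fourier symbol of `-A_l`. -/
def symbol (l n : ℤ) : ℤ := n ^ 2 + l ^ 2

lemma symbol_pos (hl : l ≠ 0) (n : ℤ) : 0 < symbol l n := by
  unfold symbol
  positivity

lemma symbol_ne_zero (hl : l ≠ 0) (n : ℤ) : (symbol l n : ℂ) ≠ 0 :=
  Int.cast_ne_zero.2 (symbol_pos hl n).ne'

lemma symbol_nonneg (l n : ℤ) : 0 ≤ symbol l n := by
  unfold symbol
  positivity

lemma abs_le_symbol (l n : ℤ) : |n| ≤ symbol l n := by
  have := Int.le_self_sq |n|
  rw [sq_abs] at this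
  exact this.trans (le_add_of_nonneg_right (sq_nonneg l))

lemma norm_div_symbol_le_one (l : ℤ) {n k : ℤ} (h : |k| ≤ symbol l n) :
    ‖(k : ℂ) / symbol l n‖ ≤ 1 := by
  rw [norm_div, Complex.norm_intCast, Complex.norm_intCast, ← Int.cast_abs, ← Int.cast_abs]
  exact div_le_one_of_le₀ (by exact_mod_cast h.trans (le_abs_self _)) (by positivity)

lemma norm_inv_symbol_le_one (l n : ℤ) : ‖(symbol l n : ℂ)⁻¹‖ ≤ 1 := by
  rcases (symbol_nonneg l n).eq_or_lt with h | h
  · simp [← h]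
  · simpa using norm_div_symbol_le_one l (k := 1) (by simpa using Int.add_one_le_iff.2 h)

lemma summable_inv_symbol (l : ℤ) : Summable fun n => (symbol l n : ℂ)⁻¹ := by
  refine .of_norm_bounded_eventually (Real.summable_one_div_int_pow.2 one_lt_two) ?_
  filter_upwards [(Set.finite_singleton (0 : ℤ)).compl_mem_cofinite] with n (hn : n ≠ 0)
  rw [norm_inv, Complex.norm_intCast, one_div,
    abs_of_nonneg (Int.cast_nonneg (symbol_nonneg l n))]
  refine inv_anti₀ (by positivity) ?_
  simp [symbol, sq_nonneg]

/-- The operator `(-A_l)⁻¹`, for `l ≠ 0`. -/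
def greenOp (l : ℤ) : L2T →L[ℂ] L2T :=
  diagonalOp fourierBasis (fun n => (symbol l n : ℂ)⁻¹) zero_le_one (norm_inv_symbol_le_one l)

lemma coeff_greenOp (l n : ℤ) (f : L2T) :
    coeff n (greenOp l f) = (symbol l n : ℂ)⁻¹ * coeff n f :=
  coeff_diagonalOp _ _ f n

lemma greenOp_injective (hl : l ≠ 0) : Function.Injective (greenOp l) := fun f g h =>
  ext_coeff fun n => mul_left_cancel₀ (inv_ne_zero (symbol_ne_zero hl n)) <| by
    rw [← coeff_greenOp, ← coeff_greenOp, h]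

lemma isCompactOperator_greenOp (l : ℤ) : IsCompactOperator (greenOp l) :=
  isCompactOperator_diagonalOp _ _ _ (summable_inv_symbol l)

lemma isWeakDeriv_diagonalOp_greenOp (l : ℤ) (w : L2T) :
    IsWeakDeriv (greenOp l w) (Complex.I • diagonalOp fourierBasis
      (fun n => (n : ℂ) / symbol l n) zero_le_one
      (fun n => norm_div_symbol_le_one l (abs_le_symbol l n)) w) := by
  refine isWeakDeriv_iff_coeff.2 fun n => ?_
  rw [map_smul, coeff_greenOp, coeff_diagonalOp, smul_eq_mul]
  ring

lemma mem_graphA_iff (hl : l ≠ 0) {u w : L2T} : (u, w) ∈ graphA l ↔ u = greenOp l (-w) := by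
  constructor
  · rintro ⟨u', u'', hu, hu', rfl : w = u'' - (l : ℂ) ^ 2 • u⟩
    refine ext_coeff fun n => ?_
    rw [coeff_greenOp, eq_inv_mul_iff_mul_eq₀ (symbol_ne_zero hl n), map_neg, map_sub, map_smul,
      hu'.coeff_eq, hu.coeff_eq, symbol, smul_eq_mul]
    push_cast
    linear_combination (n : ℂ) ^ 2 * coeff n u * Complex.I_sq
  · rintro rfl
    refine ⟨_, w + (l : ℂ) ^ 2 • greenOp l (-w), isWeakDeriv_diagonalOp_greenOp l (-w),
      isWeakDeriv_iff_coeff.2 fun n => ?_, (add_sub_cancel_right _ _).symm⟩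
    rw [(isWeakDeriv_diagonalOp_greenOp l (-w)).coeff_eq, map_add, map_smul, coeff_greenOp,
      map_neg, smul_eq_mul]
    have := symbol_ne_zero hl n
    field_simp
    rw [symbol]
    push_cast
    linear_combination (n : ℂ) ^ 2 * coeff n w * Complex.I_sq

end GreenOperator

section UnboundedOperators

variable {l : ℤ}

lemma mem_opA_domain_iff (hl : l ≠ 0) {u : L2T} :
    u ∈ (opA l).domain ↔ ∃ g, greenOp l g = u := by
  simp only [LinearPMap.mem_domain_iff, opA_graph, mem_graphA_iff hl]
  exact ⟨fun ⟨w, hw⟩ => ⟨-w, hw.symm⟩, fun ⟨g, hg⟩ => ⟨-g, by rw [neg_neg, hg]⟩⟩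

lemma greenOp_mem_opA_domain (hl : l ≠ 0) (g : L2T) : greenOp l g ∈ (opA l).domain :=
  (mem_opA_domain_iff hl).2 ⟨g, rfl⟩

lemma opA_greenOp (hl : l ≠ 0) (g : L2T) :
    opA l ⟨greenOp l g, greenOp_mem_opA_domain hl g⟩ = -g := by
  have mem_graph := (opA l).mem_graph ⟨greenOp l g, greenOp_mem_opA_domain hl g⟩
  rw [opA_graph, mem_graphA_iff hl] at mem_graph
  exact (neg_eq_iff_eq_neg.1 (greenOp_injective hl mem_graph).symm)

lemma ker_opA (hl : l ≠ 0) : LinearMap.ker (opA l).toFun = ⊥ := by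
  rw [LinearMap.ker_eq_bot']
  rintro ⟨u, hu⟩ (h : opA l ⟨u, hu⟩ = 0)
  obtain ⟨g, rfl⟩ := (mem_opA_domain_iff hl).1 hu
  rw [opA_greenOp hl, neg_eq_zero] at h
  simp [h]

lemma opA_neg_greenOp (hl : l ≠ 0) (f : L2T) :
    opA l ⟨greenOp l (-f), greenOp_mem_opA_domain hl (-f)⟩ = f := by
  rw [opA_greenOp hl, neg_neg]

lemma mem_opLambda_domain (hl : l ≠ 0) (f : L2T) : f ∈ (opLambda l).domain := by
  change f ∈ (opA l).inverse.domain
  rw [LinearPMap.inverse_domain]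
  exact ⟨_, opA_neg_greenOp hl f⟩

lemma opLambda_apply (hl : l ≠ 0) (f : L2T) (h : f ∈ (opLambda l).domain) :
    opLambda l ⟨f, h⟩ = mulSin (f - greenOp l f) := by
  have inverse_apply : (opA l).inverse ⟨f, h⟩ = -greenOp l f :=
    (LinearPMap.inverse_apply_eq (ker_opA hl) (y := ⟨f, h⟩) (opA_neg_greenOp hl f)).trans
      (map_neg _ _)
  change mulSin (f + (opA l).inverse ⟨f, h⟩) = _
  rw [inverse_apply, ← sub_eq_add_neg]

lemma mem_opL_domain (hl : l ≠ 0) (α : ℝ) {u : L2T} :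
    u ∈ (opL α l).domain ↔ ∃ g, greenOp l g = u :=
  Iff.trans ⟨fun h => h.1, fun h => ⟨h, mem_opLambda_domain hl u⟩⟩ (mem_opA_domain_iff hl)

lemma opL_greenOp (hl : l ≠ 0) (α : ℝ) (g : L2T) (h : greenOp l g ∈ (opL α l).domain) :
    opL α l ⟨greenOp l g, h⟩
      = -g - (Complex.I * α * l) • mulSin (greenOp l g - greenOp l (greenOp l g)) := by
  change opA l ⟨greenOp l g, greenOp_mem_opA_domain hl g⟩
    - (Complex.I * α * l) • opLambda l ⟨greenOp l g, mem_opLambda_domain hl _⟩ = _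
  rw [opA_greenOp hl, opLambda_apply hl]

end UnboundedOperators

section MulSin

lemma coeFn_mulSin (f : L2T) : mulSin f =ᵐ[torusMeasure] fun y => (sinT y : ℂ) * f y :=
  (memLp_sin_mul f).coeFn_toLp

lemma norm_sinT_le_one (y : Torus) : ‖(sinT y : ℂ)‖ ≤ 1 := by
  induction y using QuotientAddGroup.induction_on with
  | H x => exact (Complex.norm_real _).trans_le (abs_sin_le_one x)

lemma norm_mulSin_le (f : L2T) : ‖mulSin f‖ ≤ ‖f‖ := by
  refine Lp.norm_le_norm_of_ae_le ?_
  filter_upwards [coeFn_mulSin f] with y hy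
  rw [hy, norm_mul]
  exact mul_le_of_le_one_left (norm_nonneg _) (norm_sinT_le_one y)

lemma isSymmetric_mulSin : mulSin.IsSymmetric := fun f g => by
  rw [L2.inner_def, L2.inner_def]
  refine integral_congr_ae ?_
  filter_upwards [coeFn_mulSin f, coeFn_mulSin g] with y hf hg
  rw [hf, hg, RCLike.inner_apply, RCLike.inner_apply, map_mul, Complex.conj_ofReal]
  ring

end MulSin

section MeanFreeSpace

variable {l : ℤ}

lemma mem_spaceY_iff {f : L2T} : f ∈ spaceY l ↔ (|l| = 1 → coeff 0 f = 0) := by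
  have integral_eq : coeff 0 f = ∫ y, f y ∂torusMeasure := by simp [coeff_eq_integral]
  rw [integral_eq]
  rfl

lemma greenOp_mem_spaceY_iff (hl : l ≠ 0) {f : L2T} : greenOp l f ∈ spaceY l ↔ f ∈ spaceY l := by
  simp [mem_spaceY_iff, coeff_greenOp, symbol_ne_zero hl 0]

lemma coeff_eq_zero_of_symbol_lt_two (hl : l ≠ 0) {f : L2T} (hf : f ∈ spaceY l) {n : ℤ}
    (h : symbol l n < 2) : coeff n f = 0 := by
  have one_le : 1 ≤ |l| := Int.one_le_abs hl
  obtain rfl : n = 0 := by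
    by_contra hn
    have := Int.one_le_abs hn
    unfold symbol at h
    nlinarith [sq_abs l, sq_abs n]
  refine mem_spaceY_iff.1 hf ?_
  unfold symbol at h
  nlinarith [sq_abs l]

lemma projQ_of_mem {f : L2T} (hf : f ∈ spaceY l) : (projQ l f : L2T) = f :=
  congrArg Subtype.val
    (Submodule.orthogonalProjectionOnto_mem_subspace_eq_self (⟨f, hf⟩ : spaceY l))

lemma inner_projQ (f : spaceY l) (h : L2T) :
    inner ℂ f (projQ l h) = inner ℂ (f : L2T) h :=
  Submodule.inner_orthogonalProjectionOnto_eq_of_mem_left f h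

lemma projQ_character_zero (h : |l| = 1) : projQ l (character 0) = 0 := by
  rw [projQ, Submodule.orthogonalProjectionOnto_eq_zero_iff, Submodule.mem_orthogonal']
  exact fun u hu => mem_spaceY_iff.1 hu h

/-- The mean value that `projQ l` removes from `f`: it is `0` unless `l = ±1`. -/
def removedMean (l : ℤ) (f : L2T) : ℂ := if |l| = 1 then coeff 0 f else 0

lemma sq_sub_one_mul_removedMean (f : L2T) : ((l : ℂ) ^ 2 - 1) * removedMean l f = 0 := by
  unfold removedMean
  split_ifs with h
  · have sq_l : l ^ 2 = 1 := by rw [← sq_abs, h, one_pow]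
    have sq_l' : (l : ℂ) ^ 2 = 1 := by exact_mod_cast sq_l
    rw [sq_l', sub_self, zero_mul]
  · rw [mul_zero]

lemma projQ_eq (f : L2T) : (projQ l f : L2T) = f - removedMean l f • character 0 := by
  unfold removedMean
  split_ifs with h
  · have mem_spaceY : f - coeff 0 f • character 0 ∈ spaceY l :=
      mem_spaceY_iff.2 fun _ => by simp [coeff_character]
    rw [← projQ_of_mem mem_spaceY, map_sub, map_smul, projQ_character_zero h, smul_zero, sub_zero]
  · rw [zero_smul, sub_zero]
    exact projQ_of_mem (mem_spaceY_iff.2 (absurd · h))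

/-- The restriction of `(-A_l)⁻¹` to `Y_l`. -/
def greenOpY (l : ℤ) : spaceY l →L[ℂ] spaceY l :=
  projQ l ∘L greenOp l ∘L (spaceY l).subtypeL

lemma coe_greenOpY (hl : l ≠ 0) (g : spaceY l) : (greenOpY l g : L2T) = greenOp l g :=
  projQ_of_mem ((greenOp_mem_spaceY_iff hl).2 g.2)

lemma greenOpY_injective (hl : l ≠ 0) : Function.Injective (greenOpY l) := fun f g h =>
  Subtype.ext <| greenOp_injective hl <| by rw [← coe_greenOpY hl, ← coe_greenOpY hl, h]

lemma isCompactOperator_greenOpY (l : ℤ) : IsCompactOperator (greenOpY l) :=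
  ((isCompactOperator_greenOp l).comp_clm (spaceY l).subtypeL).clm_comp (projQ l)

lemma isSymmetric_greenOpY (hl : l ≠ 0) :
    (greenOpY l : spaceY l →ₗ[ℂ] spaceY l).IsSymmetric := fun f g => by
  rw [ContinuousLinearMap.coe_coe, Submodule.coe_inner, Submodule.coe_inner, coe_greenOpY hl,
    coe_greenOpY hl]
  refine (hasSum_inner_coeff _ _).unique ?_
  convert hasSum_inner_coeff (f : L2T) (greenOp l g) using 2 with n
  rw [coeff_greenOp, coeff_greenOp, map_mul, map_inv₀, map_intCast]
  ring

lemma two_mul_sq_norm_greenOpY_le (hl : l ≠ 0) (g : spaceY l) :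
    2 * ‖greenOpY l g‖ ^ 2 ≤ (inner ℂ (greenOpY l g) g).re := by
  rw [Submodule.coe_norm, Submodule.coe_inner, coe_greenOpY hl]
  refine hasSum_le (fun n => ?_) ((hasSum_sq_norm_coeff (greenOp l (g : L2T))).mul_left 2)
    (Complex.hasSum_re (hasSum_inner_coeff (greenOp l (g : L2T)) g))
  have term_eq : (starRingEnd ℂ (coeff n (greenOp l (g : L2T))) * coeff n g).re
      = symbol l n * ‖coeff n (greenOp l (g : L2T))‖ ^ 2 := by
    have coeff_eq : coeff n g = symbol l n * coeff n (greenOp l (g : L2T)) := by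
      rw [coeff_greenOp, mul_inv_cancel_left₀ (symbol_ne_zero hl n)]
    rw [coeff_eq, mul_left_comm, Complex.conj_mul']
    norm_cast
  rw [term_eq]
  rcases lt_or_ge (symbol l n) 2 with h | h
  · simp [coeff_greenOp, coeff_eq_zero_of_symbol_lt_two hl g.2 h]
  · have two_le : (2 : ℝ) ≤ symbol l n := by exact_mod_cast h
    exact mul_le_mul_of_nonneg_right two_le (sq_nonneg _)

/-- The compression of `M_{sin y}` to `Y_l`. -/
def sinY (l : ℤ) : spaceY l →L[ℂ] spaceY l :=
  projQ l ∘L mulSin.mkContinuous 1 (fun f => (norm_mulSin_le f).trans_eq (one_mul _).symm) ∘L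
    (spaceY l).subtypeL

lemma sinY_apply (f : spaceY l) : sinY l f = projQ l (mulSin f) := rfl

lemma norm_sinY_le (f : spaceY l) : ‖sinY l f‖ ≤ ‖f‖ :=
  ((spaceY l).norm_orthogonalProjectionOnto_apply_le _).trans (norm_mulSin_le f)

lemma isSymmetric_sinY : (sinY l : spaceY l →ₗ[ℂ] spaceY l).IsSymmetric := fun f g => by
  rw [ContinuousLinearMap.coe_coe, ← inner_conj_symm, sinY_apply, sinY_apply, inner_projQ,
    inner_projQ, inner_conj_symm]
  exact isSymmetric_mulSin _ _

lemma mem_opQL_domain_iff (hl : l ≠ 0) (α : ℝ) {u : spaceY l} :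
    u ∈ (opQL α l).domain ↔ ∃ g, greenOpY l g = u := by
  refine (mem_opL_domain hl α).trans ⟨fun ⟨g, hg⟩ => ?_, fun ⟨g, hg⟩ => ?_⟩
  · have mem_spaceY : g ∈ spaceY l := (greenOp_mem_spaceY_iff hl).1 (hg ▸ u.2)
    exact ⟨⟨g, mem_spaceY⟩, Subtype.ext ((coe_greenOpY hl _).trans hg)⟩
  · exact ⟨g, by rw [← coe_greenOpY hl, hg]; rfl⟩

lemma opQL_greenOpY (hl : l ≠ 0) (α : ℝ) (g : spaceY l) (h : greenOpY l g ∈ (opQL α l).domain) :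
    opQL α l ⟨greenOpY l g, h⟩
      = -g - (Complex.I * α * l) • sinY l (greenOpY l g - greenOpY l (greenOpY l g)) := by
  have opL_eq : opL α l ⟨greenOpY l g, h⟩ = -(g : L2T)
      - (Complex.I * α * l) • mulSin ↑(greenOpY l g - greenOpY l (greenOpY l g)) := by
    have := opL_greenOp hl α g (by rw [← coe_greenOpY hl]; exact h)
    simpa only [← coe_greenOpY hl, ← Submodule.coe_sub] using this
  change projQ l (opL α l ⟨greenOpY l g, h⟩) = _
  rw [opL_eq, map_sub, map_neg, map_smul, sinY_apply]
  exact congrArg (-· - _) (Subtype.ext (projQ_of_mem g.2))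

end MeanFreeSpace

/-! ### The operator pencil -/

section BoundedInverse

variable {E : Type*} [NormedAddCommGroup E] [NormedSpace ℂ E] {S : E →ₗ.[ℂ] E} {R : E →L[ℂ] E}

lemma IsBoundedInverse.neg (h : IsBoundedInverse S R) : IsBoundedInverse (-S) (-R) := by
  refine ⟨fun f => ?_, fun u => ?_⟩
  · obtain ⟨mem_domain, apply_eq⟩ := h.1 f
    refine ⟨S.domain.neg_mem mem_domain, ?_⟩
    exact (congrArg Neg.neg (S.map_neg ⟨R f, mem_domain⟩)).trans ((neg_neg _).trans apply_eq)
  · simpa using h.2 u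

lemma mem_shift_domain {z : ℂ} {u : E} : u ∈ (shift z S).domain ↔ u ∈ S.domain := by
  simp [shift]

lemma shift_apply (z : ℂ) (S : E →ₗ.[ℂ] E) {u : E} (hu : u ∈ S.domain) :
    shift z S ⟨u, mem_shift_domain.2 hu⟩ = z • u + S ⟨u, hu⟩ := rfl

lemma shift_neg (z : ℂ) (S : E →ₗ.[ℂ] E) : shift z (-S) = -shift (-z) S := by
  refine LinearPMap.ext rfl fun u hu _ => ?_
  change z • u + -S ⟨u, hu⟩ = -(-z • u + S ⟨u, hu⟩)
  module

lemma IsBoundedInverse.notMem_opSpectrum {ζ : ℂ} (h : IsBoundedInverse (shift (-ζ) S) R) :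
    ζ ∉ opSpectrum S :=
  not_not.2 ⟨-R, by rw [shift_neg]; exact h.neg⟩

lemma exists_equiv_of_isCompactOperator_add_one [CompleteSpace E] {P : E →L[ℂ] E}
    (hP : IsCompactOperator (P + 1 : E →L[ℂ] E)) (ker : ∀ g, P g = 0 → g = 0) :
    ∃ e : E ≃L[ℂ] E, ∀ g, e g = P g := by
  have mem_resolventSet : (1 : ℂ) ∈ resolventSet ℂ (P + 1) := by
    refine (hP.hasEigenvalue_or_mem_resolventSet one_ne_zero).resolve_left fun eigenvalue => ?_
    obtain ⟨g, hg⟩ := eigenvalue.exists_hasEigenvector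
    exact hg.2 (ker g (by simpa using hg.apply_eq_smul))
  obtain ⟨V, hV⟩ := (spectrum.mem_resolventSet_iff.1 mem_resolventSet).neg
  refine ⟨ContinuousLinearEquiv.unitsEquiv ℂ E V, fun g => ?_⟩
  rw [ContinuousLinearEquiv.unitsEquiv_apply, hV]
  simp

lemma exists_isBoundedInverse [CompleteSpace E] {G P : E →L[ℂ] E}
    (hP : IsCompactOperator (P + 1 : E →L[ℂ] E)) (ker : ∀ g, P g = 0 → g = 0)
    (hdom : ∀ u, u ∈ S.domain ↔ ∃ g, G g = u) (hS : ∀ g h, S ⟨G g, h⟩ = P g) :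
    ∃ R : E →L[ℂ] E, IsBoundedInverse S R ∧
      ∀ M, 0 ≤ M → (∀ g, ‖G g‖ ≤ M * ‖P g‖) → ‖R‖ ≤ M := by
  obtain ⟨e, he⟩ := exists_equiv_of_isCompactOperator_add_one hP ker
  refine ⟨G ∘L e.symm, ⟨fun f => ⟨(hdom _).2 ⟨_, rfl⟩, ?_⟩, ?_⟩, fun M hM bound => ?_⟩
  · exact (hS (e.symm f) _).trans (by rw [← he, e.apply_symm_apply])
  · rintro ⟨u, hu⟩
    obtain ⟨g, rfl⟩ := (hdom u).1 hu
    rw [hS, ← he]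
    exact congrArg G (e.symm_apply_apply g)
  · refine ContinuousLinearMap.opNorm_le_bound _ hM fun f => ?_
    simpa [← he] using bound (e.symm f)

end BoundedInverse

section Pencil

variable {H : Type*} [NormedAddCommGroup H] [InnerProductSpace ℂ H] {G B : H →L[ℂ] H}

/-- For `G = (-A_l)⁻¹` and `B = M_{sin y}`, both restricted to `Y_l`, this is the operator
`(z + ℚ_l L_{α,l}) (-A_l)⁻¹` with `β = α l`. -/
def pencil (G B : H →L[ℂ] H) (β : ℝ) (z : ℂ) : H →L[ℂ] H :=
  z • G - (Complex.I * β) • B ∘L (G - G ∘L G) - 1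

lemma pencil_apply (β : ℝ) (z : ℂ) (g : H) :
    pencil G B β z g = z • G g - (Complex.I * β) • B (G g - G (G g)) - g := rfl

lemma norm_le_of_pencil_le {β M : ℝ} {z w : ℂ} {g : H} (hM : 0 ≤ M) (hzw : M * ‖z - w‖ ≤ 1 / 2)
    (h : ‖G g‖ ≤ M * ‖pencil G B β w g‖) : ‖G g‖ ≤ 2 * M * ‖pencil G B β z g‖ := by
  have pencil_eq : pencil G B β w g = pencil G B β z g - (z - w) • G g := by
    rw [pencil_apply, pencil_apply]
    module
  have norm_pencil_le : ‖pencil G B β w g‖ ≤ ‖pencil G B β z g‖ + ‖z - w‖ * ‖G g‖ := by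
    rw [pencil_eq, ← norm_smul]
    exact norm_sub_le _ _
  nlinarith [mul_le_mul_of_nonneg_left norm_pencil_le hM,
    mul_le_mul_of_nonneg_right hzw (norm_nonneg (G g))]

lemma norm_sq_eq_re_inner (f : H) : ‖f‖ ^ 2 = (inner ℂ f f).re := by
  rw [inner_self_eq_norm_sq_to_K]
  norm_cast

section Coercive

variable (hG : ∀ g, 2 * ‖G g‖ ^ 2 ≤ (inner ℂ (G g) g).re)

include hG

lemma two_mul_norm_le (u : H) : 2 * ‖G u‖ ≤ ‖u‖ := by
  have cauchy_schwarz := (hG u).trans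
    ((Complex.re_le_norm _).trans (norm_inner_le_norm (𝕜 := ℂ) (G u) u))
  rcases (norm_nonneg (G u)).eq_or_lt with h | h
  · simp [← h]
  · nlinarith

lemma norm_le_two_mul_norm_sub (u : H) : ‖u‖ ≤ 2 * ‖u - G u‖ := by
  linarith [two_mul_norm_le hG u, norm_sub_norm_le u (G u)]

lemma sq_norm_le_two_mul_re_inner (u : H) : ‖u‖ ^ 2 ≤ 2 * (inner ℂ (u - G u) u).re := by
  have cauchy_schwarz := (Complex.re_le_norm _).trans (norm_inner_le_norm (𝕜 := ℂ) (G u) u)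
  have := mul_le_mul_of_nonneg_right (two_mul_norm_le hG u) (norm_nonneg u)
  rw [inner_sub_left, Complex.sub_re, ← norm_sq_eq_re_inner]
  linarith

lemma sq_norm_sub_le_re_inner (u : H) : ‖u - G u‖ ^ 2 ≤ (inner ℂ (u - G u) u).re := by
  have re_inner_eq : (inner ℂ (u - G u) u).re = ‖u‖ ^ 2 - (inner ℂ (G u) u).re := by
    rw [inner_sub_left, Complex.sub_re, norm_sq_eq_re_inner]
  have sq_norm_eq : ‖u - G u‖ ^ 2 = ‖u‖ ^ 2 - 2 * (inner ℂ (G u) u).re + ‖G u‖ ^ 2 := by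
    rw [@norm_sub_sq ℂ, ← inner_conj_symm]
    rfl
  linarith [hG u, sq_nonneg ‖G u‖]

lemma norm_sub_apply_le (u : H) : ‖u - G u‖ ≤ ‖u‖ := by
  have cauchy_schwarz := (sq_norm_sub_le_re_inner hG u).trans
    ((Complex.re_le_norm _).trans (norm_inner_le_norm (𝕜 := ℂ) (u - G u) u))
  rcases (norm_nonneg (u - G u)).eq_or_lt with h | h
  · simp [← h]
  · nlinarith

end Coercive

section EnergyEstimates

variable (β : ℝ) (z : ℂ) (g : H)

lemma norm_inner_sub_pencil_le (hG : ∀ g, 2 * ‖G g‖ ^ 2 ≤ (inner ℂ (G g) g).re) :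
    ‖inner ℂ (G g - G (G g)) (pencil G B β z g)‖ ≤ ‖pencil G B β z g‖ * ‖G g‖ := by
  refine (norm_inner_le_norm _ _).trans ?_
  rw [mul_comm]
  exact mul_le_mul_of_nonneg_left (norm_sub_apply_le hG _) (norm_nonneg _)

lemma inner_pencil (x : H) : inner ℂ x (pencil G B β z g)
    = z * inner ℂ x (G g) - Complex.I * β * inner ℂ x (B (G g - G (G g))) - inner ℂ x g := by
  rw [pencil_apply, inner_sub_right, inner_sub_right, inner_smul_right, inner_smul_right]

variable (symmG : (G : H →ₗ[ℂ] H).IsSymmetric)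

include symmG

lemma im_inner_sub_apply (u : H) : (inner ℂ (u - G u) u).im = 0 := by
  rw [inner_sub_left, Complex.sub_im, inner_self_eq_norm_sq_to_K]
  have im_inner : (inner ℂ (G u) u).im = 0 := symmG.im_inner_apply_self u
  rw [im_inner, sub_zero]
  norm_cast

lemma inner_sub_self : inner ℂ (G g - G (G g)) g = inner ℂ (G g) g - (‖G g‖ : ℂ) ^ 2 := by
  have inner_square : inner ℂ (G (G g)) g = inner ℂ (G g) (G g) := symmG (G g) g
  rw [inner_sub_left, inner_square, inner_self_eq_norm_sq_to_K]
  rfl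

lemma re_inner_sub_pencil (symmB : (B : H →ₗ[ℂ] H).IsSymmetric) :
    (inner ℂ (G g - G (G g)) (pencil G B β z g)).re
    = z.re * (inner ℂ (G g - G (G g)) (G g)).re - ((inner ℂ (G g) g).re - ‖G g‖ ^ 2) := by
  have im_inner_G := im_inner_sub_apply symmG (G g)
  have im_inner_B : (inner ℂ (G g - G (G g)) (B (G g - G (G g)))).im = 0 :=
    symmB.im_inner_self_apply _
  rw [inner_pencil, inner_sub_self g symmG]
  simp only [Complex.sub_re, Complex.mul_re, Complex.mul_im, Complex.I_re, Complex.I_im,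
    Complex.ofReal_re, Complex.ofReal_im, ← Complex.ofReal_pow, im_inner_G, im_inner_B]
  ring

lemma im_inner_sub_pencil : (inner ℂ (G g - G (G g)) (pencil G B β z g)).im
    = z.im * (inner ℂ (G g - G (G g)) (G g)).re
      - β * (inner ℂ (G g - G (G g)) (B (G g - G (G g)))).re := by
  have im_inner_G := im_inner_sub_apply symmG (G g)
  have im_inner_self : (inner ℂ (G g) g).im = 0 := symmG.im_inner_apply_self g
  rw [inner_pencil, inner_sub_self g symmG]
  simp only [Complex.sub_im, Complex.mul_re, Complex.mul_im, Complex.I_re, Complex.I_im,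
    Complex.ofReal_re, Complex.ofReal_im, ← Complex.ofReal_pow, im_inner_G, im_inner_self]
  ring

variable (hG : ∀ g, 2 * ‖G g‖ ^ 2 ≤ (inner ℂ (G g) g).re)

include hG

variable {z} in
lemma re_inner_le_of_re_nonpos (symmB : (B : H →ₗ[ℂ] H).IsSymmetric) (hz : z.re ≤ 0) :
    (inner ℂ (G g) g).re ≤ 2 * (‖pencil G B β z g‖ * ‖G g‖) := by
  have re_ge := neg_le_of_abs_le
    ((Complex.abs_re_le_norm _).trans (norm_inner_sub_pencil_le (B := B) β z g hG))
  rw [re_inner_sub_pencil β z g symmG symmB] at re_ge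
  have drift_nonpos : z.re * (inner ℂ (G g - G (G g)) (G g)).re ≤ 0 :=
    mul_nonpos_of_nonpos_of_nonneg hz ((sq_nonneg _).trans (sq_norm_sub_le_re_inner hG _))
  linarith [hG g]

variable {z} in
lemma norm_le_norm_pencil_of_re_nonpos (symmB : (B : H →ₗ[ℂ] H).IsSymmetric) (hz : z.re ≤ 0) :
    ‖G g‖ ≤ ‖pencil G B β z g‖ := by
  have energy := (hG g).trans (re_inner_le_of_re_nonpos β g symmG hG symmB hz)
  rcases (norm_nonneg (G g)).eq_or_lt with h | h
  · rw [← h]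
    exact norm_nonneg _
  · nlinarith

lemma norm_le_norm_pencil_of_one_lt (normB : ∀ f, ‖B f‖ ≤ ‖f‖) {μ : ℝ} (hβ : β ≠ 0)
    (hμ : 1 < |μ|) :
    ‖G g‖ ≤ 2 / (|β| * (|μ| - 1)) * ‖pencil G B β (Complex.I * (β * μ : ℝ)) g‖ := by
  set z : ℂ := Complex.I * (β * μ : ℝ)
  have im_z : z.im = β * μ := by simp [z]
  set x := G g - G (G g)
  set A := (inner ℂ x (G g)).re
  set s := (inner ℂ x (B x)).re
  have im_le : |β * (μ * A - s)| ≤ ‖pencil G B β z g‖ * ‖G g‖ := by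
    have im_eq : (inner ℂ x (pencil G B β z g)).im = β * (μ * A - s) := by
      rw [im_inner_sub_pencil β z g symmG, im_z]
      ring
    rw [← im_eq]
    exact (Complex.abs_im_le_norm _).trans (norm_inner_sub_pencil_le β z g hG)
  have abs_s_le : |s| ≤ A := by
    refine (Complex.abs_re_le_norm _).trans ((norm_inner_le_norm _ _).trans ?_)
    refine (mul_le_mul_of_nonneg_left (normB x) (norm_nonneg x)).trans ?_
    rw [← sq]
    exact sq_norm_sub_le_re_inner hG (G g)
  have A_nonneg : 0 ≤ A := (abs_nonneg s).trans abs_s_le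
  have gap_le : (|μ| - 1) * A ≤ |μ * A - s| := by
    have := abs_sub_abs_le_abs_sub (μ * A) s
    rw [abs_mul, abs_of_nonneg A_nonneg] at this
    linarith
  have gap_pos : 0 < |β| * (|μ| - 1) := mul_pos (abs_pos.2 hβ) (sub_pos.2 hμ)
  have bound : |β| * (|μ| - 1) * ‖G g‖ ^ 2 ≤ 2 * (‖pencil G B β z g‖ * ‖G g‖) := by
    rw [abs_mul] at im_le
    linarith [mul_le_mul_of_nonneg_left (sq_norm_le_two_mul_re_inner hG (G g)) gap_pos.le,
      mul_le_mul_of_nonneg_left gap_le (abs_nonneg β)]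
  rw [div_mul_eq_mul_div, le_div_iff₀ gap_pos]
  rcases (norm_nonneg (G g)).eq_or_lt with h | h
  · rw [← h, zero_mul]
    positivity
  · nlinarith

end EnergyEstimates

end Pencil

/-! ### Reduction to trigonometric polynomials -/

section TrigonometricPolynomials

/-- The `2π`-periodic function on the line given by a function on the circle. -/
def pullback (φ : C(Torus, ℂ)) (x : ℝ) : ℂ := φ (x : Torus)

lemma periodic_pullback (φ : C(Torus, ℂ)) : Function.Periodic (pullback φ) (2 * π) := fun x => by
  rw [pullback, AddCircle.coe_add_period, pullback]

/-- The class of a continuous function in `L²(𝕋)`. -/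
abbrev toL2 (φ : C(Torus, ℂ)) : L2T := ContinuousMap.toLp 2 torusMeasure ℂ φ

lemma sq_periodNorm_pullback (φ : C(Torus, ℂ)) :
    periodNorm (pullback φ) ^ 2 = 2 * π * ‖toL2 φ‖ ^ 2 := by
  have sq_norm : ‖toL2 φ‖ ^ 2 = ∫ y, ‖φ y‖ ^ 2 ∂torusMeasure := by
    rw [← Complex.ofReal_inj, ← integral_complex_ofReal]
    push_cast
    rw [← Complex.coe_algebraMap, ← inner_self_eq_norm_sq_to_K, L2.inner_def]
    refine integral_congr_ae ?_
    filter_upwards [ContinuousMap.coeFn_toLp (p := 2) (𝕜 := ℂ) torusMeasure φ] with y hy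
    rw [hy, inner_self_eq_norm_sq_to_K]
  rw [sq_norm, integral_torus, sq_periodNorm, periodInt, smul_eq_mul,
    mul_inv_cancel_left₀ (by positivity)]
  simp only [pullback]

lemma periodNorm_pullback (φ : C(Torus, ℂ)) :
    periodNorm (pullback φ) = √(2 * π) * ‖toL2 φ‖ := by
  rw [← sqrt_sq (periodNorm_nonneg _), sq_periodNorm_pullback, sqrt_mul (by positivity),
    sqrt_sq (norm_nonneg _)]

/-- The trigonometric polynomial with the coefficients `a n`, `n ∈ s`. -/
def trigPoly (s : Finset ℤ) : (ℤ → ℂ) →ₗ[ℂ] C(Torus, ℂ) :=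
  ∑ n ∈ s, (LinearMap.proj n).smulRight (fourier n)

lemma trigPoly_eq_sum (s : Finset ℤ) (a : ℤ → ℂ) : trigPoly s a = ∑ n ∈ s, a n • fourier n := by
  simp [trigPoly, LinearMap.sum_apply]

lemma pullback_trigPoly (s : Finset ℤ) (a : ℤ → ℂ) :
    pullback (trigPoly s a) = fun x => ∑ n ∈ s, a n * pullback (fourier n) x := by
  funext x
  simp [pullback, trigPoly_eq_sum, ContinuousMap.sum_apply]

lemma contDiff_trigPoly (s : Finset ℤ) (a : ℤ → ℂ) (k : ℕ) :
    ContDiff ℝ k (pullback (trigPoly s a)) := by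
  rw [pullback_trigPoly]
  exact ContDiff.sum fun n _ => contDiff_const.mul
    ((contDiff_fourier_torus n).of_le (by exact_mod_cast le_top))

lemma deriv_trigPoly (s : Finset ℤ) (a : ℤ → ℂ) :
    deriv (pullback (trigPoly s a)) = pullback (trigPoly s fun n => Complex.I * n * a n) := by
  simp only [pullback_trigPoly]
  funext x
  refine HasDerivAt.deriv (HasDerivAt.fun_sum fun n _ => ?_)
  refine ((hasDerivAt_fourier_torus n x).const_mul (a n)).congr_deriv ?_
  rw [ContinuousMap.smul_apply, smul_eq_mul, pullback]
  ring

lemma helmholtz_trigPoly (s : Finset ℤ) (a : ℤ → ℂ) (m : ℝ) :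
    helmholtz m (pullback (trigPoly s a))
      = pullback (trigPoly s fun n => -((n : ℂ) ^ 2 + m) * a n) := by
  funext x
  simp only [helmholtz, deriv_trigPoly]
  simp only [pullback_trigPoly, Complex.real_smul, Finset.mul_sum, ← Finset.sum_sub_distrib]
  refine Finset.sum_congr rfl fun n _ => ?_
  linear_combination (n : ℂ) ^ 2 * a n * pullback (fourier n) x * Complex.I_sq

lemma toL2_trigPoly (s : Finset ℤ) (a : ℤ → ℂ) :
    toL2 (trigPoly s a) = ∑ n ∈ s, a n • character n := by
  simp only [trigPoly_eq_sum, map_sum, map_smul, character_eq_toLp]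

lemma coeff_sum_smul_character (s : Finset ℤ) (a : ℤ → ℂ) (n : ℤ) :
    coeff n (∑ k ∈ s, a k • character k) = if n ∈ s then a n else 0 := by
  simp only [map_sum, map_smul, coeff_character, smul_eq_mul, mul_ite, mul_one, mul_zero,
    Finset.sum_ite_eq]

lemma toL2_trigPoly_coeff {s : Finset ℤ} {f : L2T} (hs : ∀ n ∉ s, coeff n f = 0) :
    toL2 (trigPoly s fun n => coeff n f) = f := ext_coeff fun n => by
  rw [toL2_trigPoly, coeff_sum_smul_character]
  split_ifs with h
  · rfl
  · exact (hs n h).symm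

lemma sq_periodNorm_trigPoly (s : Finset ℤ) (a : ℤ → ℂ) :
    periodNorm (pullback (trigPoly s a)) ^ 2 = 2 * π * ∑ n ∈ s, ‖a n‖ ^ 2 := by
  rw [sq_periodNorm_pullback, toL2_trigPoly]
  congr 1
  rw [← (hasSum_sq_norm_coeff _).tsum_eq, tsum_eq_sum fun n hn => ?_]
  · exact Finset.sum_congr rfl fun n hn => by rw [coeff_sum_smul_character, if_pos hn]
  · rw [coeff_sum_smul_character, if_neg hn, norm_zero, zero_pow two_ne_zero]

/-- The function `sin` on the circle, with complex values. -/
def sinC : C(Torus, ℂ) where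
  toFun y := sinT y
  continuous_toFun := Complex.continuous_ofReal.comp sinT.continuous

lemma toL2_sinC_mul (φ : C(Torus, ℂ)) : toL2 (sinC * φ) = mulSin (toL2 φ) := by
  refine Lp.ext ?_
  filter_upwards [ContinuousMap.coeFn_toLp (p := 2) (𝕜 := ℂ) torusMeasure (sinC * φ),
    ContinuousMap.coeFn_toLp (p := 2) (𝕜 := ℂ) torusMeasure φ, coeFn_mulSin (toL2 φ)]
    with y h_mul h h_sin
  rw [h_mul, h_sin, h]
  rfl

end TrigonometricPolynomials

section ResolventEquation

variable {l : ℤ} {s : Finset ℤ} {μ : ℝ}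

/-- `(I + A_l⁻¹) ω` for the vorticity `ω = (-A_l)⁻¹ g`. -/
def reducedVorticity (l : ℤ) (g : L2T) : L2T := greenOp l g - greenOp l (greenOp l g)

/-- The Fourier coefficients of the stream function `Ψ` in `IsVorticitySol` when
`U = (-A_l)⁻¹ g`. If `l = ±1`, the mean of `Ψ` is chosen to absorb the effect of the projection. -/
def streamCoeff (l : ℤ) (μ : ℝ) (g : L2T) (n : ℤ) : ℂ :=
  -coeff n (greenOp l (greenOp l g))
    - if n = 0 then removedMean l (mulSin (reducedVorticity l g)) / μ else 0

/-- The trigonometric polynomial with the Fourier coefficients of `f` in `s`, on the line. -/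
def partialSum (s : Finset ℤ) (f : L2T) : ℝ → ℂ := pullback (trigPoly s fun n => coeff n f)

/-- The force `F` in `IsVorticitySol` when `U = (-A_l)⁻¹ g`. -/
def force (l : ℤ) (β μ : ℝ) (s : Finset ℤ) (g : L2T) : C(Torus, ℂ) :=
  (Complex.I * (β * μ : ℝ)) • trigPoly s (fun n => coeff n (greenOp l g))
    - (Complex.I * β) • (sinC * trigPoly s (fun n => coeff n (reducedVorticity l g))
      - removedMean l (mulSin (reducedVorticity l g)) • fourier 0)
    - trigPoly s fun n => coeff n g

lemma symbol_mul_coeff_greenOp (hl : l ≠ 0) (n : ℤ) (g : L2T) :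
    ((n : ℂ) ^ 2 + (l : ℂ) ^ 2) * coeff n (greenOp l g) = coeff n g := by
  have symbol_eq : (symbol l n : ℂ) = n ^ 2 + l ^ 2 := by simp [symbol]
  rw [coeff_greenOp, ← symbol_eq, mul_inv_cancel_left₀ (symbol_ne_zero hl n)]

lemma helmholtz_streamCoeff (hl : l ≠ 0) (s : Finset ℤ) (μ : ℝ) (g : L2T) :
    helmholtz ((l : ℝ) ^ 2 - 1) (pullback (trigPoly s (streamCoeff l μ g)))
      = partialSum s (reducedVorticity l g) := by
  rw [helmholtz_trigPoly, partialSum]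
  congr 2
  funext n
  have green_eq := symbol_mul_coeff_greenOp hl n (greenOp l g)
  have mean_eq := sq_sub_one_mul_removedMean (l := l) (mulSin (reducedVorticity l g))
  have coeff_eq : coeff n (reducedVorticity l g) = _ := map_sub (coeff n) _ _
  rw [streamCoeff, coeff_eq]
  push_cast
  split_ifs with h
  · rw [h, Int.cast_zero] at green_eq ⊢
    linear_combination green_eq + (μ : ℂ)⁻¹ * mean_eq
  · linear_combination green_eq

lemma helmholtz_greenOp (hl : l ≠ 0) (s : Finset ℤ) (g : L2T) :
    helmholtz ((l : ℝ) ^ 2) (partialSum s (greenOp l g)) = -partialSum s g := by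
  rw [partialSum, helmholtz_trigPoly]
  have coeff_eq : (fun n : ℤ => -((n : ℂ) ^ 2 + ((l : ℝ) ^ 2 : ℝ)) * coeff n (greenOp l g))
      = -fun n => coeff n g := funext fun n => by
    rw [Pi.neg_apply, ← symbol_mul_coeff_greenOp hl n g]
    push_cast
    ring
  rw [coeff_eq, map_neg]
  rfl

lemma pullback_streamCoeff (hs : 0 ∈ s) (x : ℝ) (g : L2T) :
    pullback (trigPoly s (streamCoeff l μ g)) x
      = partialSum s (reducedVorticity l g) x - partialSum s (greenOp l g) x
        - removedMean l (mulSin (reducedVorticity l g)) / μ := by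
  simp only [partialSum, pullback_trigPoly, streamCoeff, reducedVorticity, map_sub]
  simp only [sub_mul, Finset.sum_sub_distrib, ite_mul, zero_mul, Finset.sum_ite_eq', if_pos hs]
  simp [pullback]

lemma eqn_force (hl : l ≠ 0) (hμ : μ ≠ 0) (β : ℝ) (hs : 0 ∈ s) (g : L2T) (x : ℝ) :
    Complex.I * β * rayleighOp μ ((l : ℝ) ^ 2 - 1) (pullback (trigPoly s (streamCoeff l μ g))) x
      = deriv (deriv (partialSum s (greenOp l g))) x
        - ((l : ℝ) ^ 2 : ℝ) * partialSum s (greenOp l g) x - pullback (force l β μ s g) x := by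
  have green_eq := congrFun (helmholtz_greenOp hl s g) x
  rw [helmholtz, Complex.real_smul, Pi.neg_apply] at green_eq
  have force_eq : pullback (force l β μ s g) x
      = Complex.I * (β * μ : ℝ) * partialSum s (greenOp l g) x
        - Complex.I * β * ((sin x : ℝ) * partialSum s (reducedVorticity l g) x
          - removedMean l (mulSin (reducedVorticity l g))) - partialSum s g x := by
    simp [pullback, partialSum, force, sinC, sinT_coe]
  have mean_eq := mul_div_cancel₀ (removedMean l (mulSin (reducedVorticity l g)))
    (Complex.ofReal_ne_zero.2 hμ)
  rw [rayleighOp, helmholtz_streamCoeff hl, pullback_streamCoeff hs, green_eq, force_eq,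
    Complex.real_smul, Complex.real_smul]
  push_cast
  linear_combination (-Complex.I * β) * mean_eq

lemma coeff_greenOp_eq_zero {n : ℤ} {g : L2T} (h : coeff n g = 0) : coeff n (greenOp l g) = 0 := by
  rw [coeff_greenOp, h, mul_zero]

lemma coeff_reducedVorticity_eq_zero {n : ℤ} {g : L2T} (h : coeff n g = 0) :
    coeff n (reducedVorticity l g) = 0 := by
  have green_zero := coeff_greenOp_eq_zero (l := l) h
  rw [reducedVorticity, map_sub, green_zero, coeff_greenOp_eq_zero green_zero, sub_zero]

lemma coe_greenOpY_sub (hl : l ≠ 0) (g : spaceY l) :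
    ((greenOpY l g - greenOpY l (greenOpY l g) : spaceY l) : L2T) = reducedVorticity l g := by
  rw [Submodule.coe_sub, coe_greenOpY hl, coe_greenOpY hl, coe_greenOpY hl, reducedVorticity]

lemma periodNorm_partialSum {f : L2T} (hs : ∀ n ∉ s, coeff n f = 0) :
    periodNorm (partialSum s f) = √(2 * π) * ‖f‖ := by
  rw [partialSum, periodNorm_pullback, toL2_trigPoly_coeff hs]

lemma periodNorm_partialSum_greenOp (hl : l ≠ 0) {g : spaceY l}
    (hs : ∀ n ∉ s, coeff n (g : L2T) = 0) :
    periodNorm (partialSum s (greenOp l g)) = √(2 * π) * ‖greenOpY l g‖ := by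
  rw [periodNorm_partialSum fun n hn => coeff_greenOp_eq_zero (hs n hn), ← coe_greenOpY hl,
    Submodule.coe_norm]

lemma periodNorm_partialSum_reducedVorticity (hl : l ≠ 0) {g : spaceY l}
    (hs : ∀ n ∉ s, coeff n (g : L2T) = 0) :
    periodNorm (partialSum s (reducedVorticity l g))
      = √(2 * π) * ‖greenOpY l g - greenOpY l (greenOpY l g)‖ := by
  rw [periodNorm_partialSum fun n hn => coeff_reducedVorticity_eq_zero (hs n hn),
    ← coe_greenOpY_sub hl, Submodule.coe_norm]

lemma periodNorm_force (hl : l ≠ 0) (β μ : ℝ) {g : spaceY l}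
    (hs : ∀ n ∉ s, coeff n (g : L2T) = 0) :
    periodNorm (pullback (force l β μ s g))
      = √(2 * π) * ‖pencil (greenOpY l) (sinY l) β (Complex.I * (β * μ : ℝ)) g‖ := by
  have toL2_eq : toL2 (force l β μ s g)
      = pencil (greenOpY l) (sinY l) β (Complex.I * (β * μ : ℝ)) g := by
    rw [pencil_apply, force, sinY_apply, coe_greenOpY_sub hl]
    simp only [map_sub, map_smul, toL2_sinC_mul, toL2_trigPoly_coeff hs, ← character_eq_toLp,
      toL2_trigPoly_coeff fun n hn => coeff_greenOp_eq_zero (l := l) (hs n hn),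
      toL2_trigPoly_coeff fun n hn => coeff_reducedVorticity_eq_zero (l := l) (hs n hn),
      Submodule.coe_sub, Submodule.coe_smul, projQ_eq, coe_greenOpY hl]
  rw [periodNorm_pullback, toL2_eq, Submodule.coe_norm]

lemma re_inner_greenOp (hl : l ≠ 0) {g : L2T} (hs : ∀ n ∉ s, coeff n g = 0) :
    (inner ℂ (greenOp l g) g).re
      = ∑ n ∈ s, ((n : ℝ) ^ 2 + (l : ℝ) ^ 2) * ‖coeff n (greenOp l g)‖ ^ 2 := by
  rw [← (hasSum_inner_coeff _ _).tsum_eq, tsum_eq_sum fun n hn => by rw [hs n hn, mul_zero],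
    Complex.re_sum]
  refine Finset.sum_congr rfl fun n _ => ?_
  rw [← symbol_mul_coeff_greenOp hl n g, mul_left_comm, Complex.conj_mul']
  norm_cast

lemma sq_periodNorm_deriv_greenOp_add (hl : l ≠ 0) {g : L2T} (hs : ∀ n ∉ s, coeff n g = 0) :
    periodNorm (deriv (partialSum s (greenOp l g))) ^ 2
      + (l : ℝ) ^ 2 * periodNorm (partialSum s (greenOp l g)) ^ 2
      = 2 * π * (inner ℂ (greenOp l g) g).re := by
  rw [re_inner_greenOp hl hs, partialSum, deriv_trigPoly, sq_periodNorm_trigPoly,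
    sq_periodNorm_trigPoly, mul_left_comm, ← mul_add, Finset.mul_sum, ← Finset.sum_add_distrib]
  congr 1
  refine Finset.sum_congr rfl fun n _ => ?_
  rw [norm_mul, norm_mul, Complex.norm_I, Complex.norm_intCast, one_mul, mul_pow, sq_abs, add_mul]

lemma norm_coeff_reducedVorticity_le (hl : l ≠ 0) (g : L2T) (n : ℤ) :
    ‖coeff n (reducedVorticity l g)‖ ≤ ‖coeff n (greenOp l g)‖ := by
  have one_le : (1 : ℝ) ≤ symbol l n := by exact_mod_cast symbol_pos hl n
  have coeff_eq : coeff n (reducedVorticity l g)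
      = ((1 - (symbol l n : ℝ)⁻¹ : ℝ) : ℂ) * coeff n (greenOp l g) := by
    rw [reducedVorticity, map_sub, coeff_greenOp l n (greenOp l g)]
    push_cast
    ring
  rw [coeff_eq, norm_mul, Complex.norm_real]
  refine mul_le_of_le_one_left (norm_nonneg _) ?_
  rw [norm_of_nonneg (sub_nonneg.2 (inv_le_one_of_one_le₀ one_le))]
  exact sub_le_self _ (by positivity)

lemma periodNorm_deriv_reducedVorticity_le (hl : l ≠ 0) (s : Finset ℤ) (g : L2T) :
    periodNorm (deriv (partialSum s (reducedVorticity l g)))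
      ≤ periodNorm (deriv (partialSum s (greenOp l g))) := by
  refine le_of_sq_le_sq ?_ (periodNorm_nonneg _)
  simp only [partialSum, deriv_trigPoly, sq_periodNorm_trigPoly, norm_mul]
  gcongr with n
  exact norm_coeff_reducedVorticity_le hl g n

lemma isVorticitySol_force (hl : l ≠ 0) (hμ : μ ≠ 0) (β : ℝ) {g : spaceY l} (h0 : 0 ∈ s)
    (hs : ∀ n ∉ s, coeff n (g : L2T) = 0) :
    IsVorticitySol μ β ((l : ℝ) ^ 2 - 1) ((l : ℝ) ^ 2) (pullback (trigPoly s (streamCoeff l μ g)))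
      (partialSum s (greenOp l g)) (pullback (force l β μ s g)) where
  m_nonneg := by
    have : 0 < l ^ 2 := by positivity
    exact sub_nonneg.2 (by exact_mod_cast this)
  L_nonneg := sq_nonneg _
  periodic := periodic_pullback _
  periodic_U := periodic_pullback _
  periodic_F := periodic_pullback _
  contDiff := contDiff_trigPoly _ _ 3
  contDiff_U := contDiff_trigPoly _ _ 2
  continuous_F := continuous_coe_comp _
  eqn := eqn_force hl hμ β h0 g
  U_le := by
    rw [helmholtz_streamCoeff hl, periodNorm_partialSum_greenOp hl hs,
      periodNorm_partialSum_reducedVorticity hl hs, mul_left_comm]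
    exact mul_le_mul_of_nonneg_left
      (norm_le_two_mul_norm_sub (two_mul_sq_norm_greenOpY_le hl) _) (sqrt_nonneg _)
  deriv_helmholtz_le := by
    rw [helmholtz_streamCoeff hl]
    exact periodNorm_deriv_reducedVorticity_le hl s g
  energy := by
    have energy := mul_le_mul_of_nonneg_left (re_inner_le_of_re_nonpos (B := sinY l)
      (z := Complex.I * (β * μ : ℝ)) β g (isSymmetric_greenOpY hl) (two_mul_sq_norm_greenOpY_le hl)
      isSymmetric_sinY (by simp)) (sq_nonneg √(2 * π))
    rw [sq_periodNorm_deriv_greenOp_add hl hs, periodNorm_partialSum_greenOp hl hs,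
      periodNorm_force hl β μ hs, ← coe_greenOpY hl, ← Submodule.coe_inner]
    rw [sq_sqrt two_pi_pos.le] at energy
    refine energy.trans_eq ?_
    linear_combination (-2 * ‖pencil (greenOpY l) (sinY l) β (Complex.I * (β * μ : ℝ)) g‖
      * ‖greenOpY l g‖) * sq_sqrt two_pi_pos.le

lemma norm_greenOpY_le_of_finite (β : ℝ) (z : ℂ) {M : ℝ}
    (h : ∀ (g : spaceY l) (s : Finset ℤ), (∀ n ∉ s, coeff n (g : L2T) = 0) →
      ‖greenOpY l g‖ ≤ M * ‖pencil (greenOpY l) (sinY l) β z g‖) (g : spaceY l) :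
    ‖greenOpY l g‖ ≤ M * ‖pencil (greenOpY l) (sinY l) β z g‖ := by
  let approx (s : Finset ℤ) : spaceY l := projQ l (∑ n ∈ s, coeff n (g : L2T) • character n)
  have tendsto_approx : Filter.Tendsto approx Filter.atTop (nhds g) := by
    have := ((projQ l).continuous.tendsto (g : L2T)).comp (hasSum_coeff_smul (g : L2T))
    rwa [Subtype.ext (projQ_of_mem g.2)] at this
  have coeff_approx (s : Finset ℤ) (n : ℤ) (hn : n ∉ s) : coeff n (approx s : L2T) = 0 := by
    rw [projQ_of_mem (mem_spaceY_iff.2 fun hl1 => ?_), coeff_sum_smul_character, if_neg hn]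
    rw [coeff_sum_smul_character, mem_spaceY_iff.1 g.2 hl1, ite_self]
  have cont_left : Continuous fun g : spaceY l => ‖greenOpY l g‖ := by fun_prop
  have cont_right : Continuous fun g => M * ‖pencil (greenOpY l) (sinY l) β z g‖ := by fun_prop
  exact le_of_tendsto_of_tendsto ((cont_left.tendsto g).comp tendsto_approx)
    ((cont_right.tendsto g).comp tendsto_approx)
    (.of_forall fun s => h _ s (coeff_approx s))

end ResolventEquation

/-! ### Resolvent bounds -/

section LayerScale

lemma rpow_one_third_pow_three {x : ℝ} (hx : 0 ≤ x) : (x ^ (1 / 3 : ℝ)) ^ 3 = x := by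
  rw [← rpow_natCast, ← rpow_mul hx]
  norm_num

lemma mul_sq_one_div_rpow_half {b : ℝ} (hb : 0 < b) : b * (1 / b ^ (1 / 2 : ℝ)) ^ 2 = 1 := by
  rw [← sqrt_eq_rpow, div_pow, sq_sqrt hb.le, one_pow, mul_one_div_cancel hb.ne']

/-- The distance `1 - μ` of `μ` to the top of the range of `sin`, truncated from below at
`b ^ (-1/2)`, for `b = |α l|`. -/
def layerDepth (b μ : ℝ) : ℝ := max (1 - μ) (1 / b ^ (1 / 2 : ℝ))

/-- The width `d` of the layer around the critical points `sin y = μ`, where transport and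
diffusion balance: the slope of `sin` there is about `√δ`, with `δ = layerDepth b μ`, and
`b √δ d = d ^ (-2)`. -/
def layerWidth (b μ : ℝ) : ℝ := (1 / (b * √(layerDepth b μ))) ^ (1 / 3 : ℝ)

variable {b μ : ℝ} (hb : 0 < b)

include hb

lemma layerDepth_pos : 0 < layerDepth b μ :=
  lt_max_of_lt_right (by positivity)

lemma layerWidth_pos : 0 < layerWidth b μ :=
  have := layerDepth_pos hb (μ := μ)
  by unfold layerWidth; positivity

lemma mul_layerWidth_pow_three : b * (√(layerDepth b μ) * layerWidth b μ ^ 3) = 1 := by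
  have slope_pos : 0 < √(layerDepth b μ) := sqrt_pos.2 (layerDepth_pos hb)
  rw [layerWidth, rpow_one_third_pow_three (by positivity)]
  field_simp

lemma sq_mul_layerWidth_sq_pow_three :
    b ^ 2 * layerDepth b μ * (layerWidth b μ ^ 2) ^ 3 = 1 := by
  calc b ^ 2 * layerDepth b μ * (layerWidth b μ ^ 2) ^ 3
      = (b * (√(layerDepth b μ) * layerWidth b μ ^ 3)) ^ 2 := by
        rw [mul_pow, mul_pow, sq_sqrt (layerDepth_pos hb).le]
        ring
    _ = 1 := by rw [mul_layerWidth_pow_three hb, one_pow]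

lemma continuous_layerWidth : Continuous (layerWidth b) := by
  have continuous_layerDepth : Continuous (layerDepth b) := by
    unfold layerDepth
    fun_prop
  have ne_zero (μ : ℝ) : b * √(layerDepth b μ) ≠ 0 :=
    (mul_pos hb (sqrt_pos.2 (layerDepth_pos hb))).ne'
  exact (continuous_const.div (by fun_prop) ne_zero).rpow_const fun μ => .inr (by norm_num)

lemma layerWidth_sq_le : layerWidth b μ ^ 2 ≤ 1 / b ^ (1 / 2 : ℝ) := by
  set ε := 1 / b ^ (1 / 2 : ℝ) with hε
  have ε_pos : 0 < ε := by positivity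
  refine le_of_pow_le_pow_left₀ three_ne_zero ε_pos.le ?_
  refine le_of_mul_le_mul_left (a := b ^ 2 * ε) ?_ (by positivity)
  calc b ^ 2 * ε * (layerWidth b μ ^ 2) ^ 3
      ≤ b ^ 2 * layerDepth b μ * (layerWidth b μ ^ 2) ^ 3 := by
        gcongr
        exact le_max_right _ _
    _ = (b * ε ^ 2) ^ 2 := by
        rw [sq_mul_layerWidth_sq_pow_three hb, hε, mul_sq_one_div_rpow_half hb, one_pow]
    _ = b ^ 2 * ε * ε ^ 3 := by ring

lemma layerWidth_sq_eq_of_le (h : 1 - μ ≤ 1 / b ^ (1 / 2 : ℝ)) :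
    layerWidth b μ ^ 2 = 1 / b ^ (1 / 2 : ℝ) := by
  have depth_eq : layerDepth b μ = 1 / b ^ (1 / 2 : ℝ) := max_eq_right h
  have cube_eq := sq_mul_layerWidth_sq_pow_three hb (μ := μ)
  rw [depth_eq] at cube_eq
  set ε := 1 / b ^ (1 / 2 : ℝ) with hε
  have ε_pos : 0 < ε := by positivity
  refine (pow_left_inj₀ (sq_nonneg _) ε_pos.le three_ne_zero).1 ?_
  refine mul_left_cancel₀ (a := b ^ 2 * ε) (by positivity) ?_
  calc b ^ 2 * ε * (layerWidth b μ ^ 2) ^ 3 = (b * ε ^ 2) ^ 2 := by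
        rw [cube_eq, hε, mul_sq_one_div_rpow_half hb, one_pow]
    _ = b ^ 2 * ε * ε ^ 3 := by ring

lemma layerWidth_sq_eq (h : μ ≤ 1 - 1 / b ^ (1 / 2 : ℝ)) :
    layerWidth b μ ^ 2 = 1 / (b ^ (2 / 3 : ℝ) * (1 - μ) ^ (1 / 3 : ℝ)) := by
  have gap_pos : 0 < 1 - μ := lt_of_lt_of_le (by positivity : 0 < 1 / b ^ (1 / 2 : ℝ)) (by linarith)
  have depth_eq : layerDepth b μ = 1 - μ := max_eq_left (by linarith)
  have rpow_two_thirds : (b ^ (2 / 3 : ℝ)) ^ 3 = b ^ 2 := by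
    rw [← rpow_natCast, ← rpow_mul hb.le, ← rpow_natCast]
    norm_num
  refine (pow_left_inj₀ (sq_nonneg _) (by positivity) three_ne_zero).1 ?_
  rw [div_pow, mul_pow, rpow_two_thirds, rpow_one_third_pow_three gap_pos.le, one_pow,
    eq_div_iff (by positivity), mul_comm, ← depth_eq, sq_mul_layerWidth_sq_pow_three hb]

lemma layerWidth_le {η : ℝ} (hη : 0 < η) (hηb : 1 / η ^ 4 ≤ b) : layerWidth b μ ≤ η := by
  refine le_of_pow_le_pow_left₀ (n := 4) (by norm_num) hη.le ?_
  calc layerWidth b μ ^ 4 = (layerWidth b μ ^ 2) ^ 2 := by ring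
    _ ≤ (1 / b ^ (1 / 2 : ℝ)) ^ 2 := pow_le_pow_left₀ (sq_nonneg _) (layerWidth_sq_le hb) 2
    _ = 1 / b := eq_one_div_of_mul_eq_one_right (mul_sq_one_div_rpow_half hb)
    _ ≤ η ^ 4 := (one_div_le (by positivity) hb).1 hηb

omit hb in
lemma isLayer_layerWidth (hb : 1 ≤ b) (hμ : 0 < μ) (hμ1 : μ ≤ 1 + 1 / b ^ (1 / 2 : ℝ)) :
    IsLayer μ (layerDepth b μ) (layerWidth b μ * √(layerDepth b μ)) (layerWidth b μ) := by
  have b_pos : 0 < b := one_pos.trans_le hb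
  have depth_pos := layerDepth_pos b_pos (μ := μ)
  have width_pos := layerWidth_pos b_pos (μ := μ)
  have le_depth : 1 / b ^ (1 / 2 : ℝ) ≤ layerDepth b μ := le_max_right _ _
  refine
    { mu_pos := hμ
      d_pos := width_pos
      κ_pos := by positivity
      δ_le := max_le (by linarith)
        (div_le_one_of_le₀ (one_le_rpow hb (by norm_num)) (by positivity))
      d_sq_le := (layerWidth_sq_le b_pos).trans le_depth
      κ_sq := by rw [mul_pow, sq_sqrt depth_pos.le]
      dist_le := abs_le.2 ⟨by linarith, le_max_left _ _⟩
      alt := (le_total (1 / b ^ (1 / 2 : ℝ)) (1 - μ)).imp max_eq_left fun h => ?_ }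
  have depth_eq : layerDepth b μ = layerWidth b μ ^ 2 := by
    rw [layerWidth_sq_eq_of_le b_pos h, layerDepth, max_eq_right h]
  rw [depth_eq, sqrt_sq width_pos.le, sq]

end LayerScale

section Resolvent

variable {l : ℤ} {β M : ℝ} {z : ℂ}

/-- `IsResolventBound l β z M` is the a priori form of `‖(z + ℚ_l L_{α,l})⁻¹‖ ≤ M`, with
`β = α l`, written for `u = (-A_l)⁻¹ g`. -/
def IsResolventBound (l : ℤ) (β : ℝ) (z : ℂ) (M : ℝ) : Prop :=
  ∀ g : spaceY l, ‖greenOpY l g‖ ≤ M * ‖pencil (greenOpY l) (sinY l) β z g‖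

lemma IsResolventBound.mono (h : IsResolventBound l β z M) {N : ℝ} (hMN : M ≤ N) :
    IsResolventBound l β z N :=
  fun g => (h g).trans (mul_le_mul_of_nonneg_right hMN (norm_nonneg _))

lemma IsResolventBound.of_norm_sub_le {w : ℂ} (h : IsResolventBound l β w M) (hM : 0 ≤ M)
    (hzw : M * ‖z - w‖ ≤ 1 / 2) : IsResolventBound l β z (2 * M) :=
  fun g => norm_le_of_pencil_le hM hzw (h g)

lemma isResolventBound_one (hl : l ≠ 0) (β : ℝ) (hz : z.re ≤ 0) : IsResolventBound l β z 1 :=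
  fun g => by
    rw [one_mul]
    exact norm_le_norm_pencil_of_re_nonpos β g (isSymmetric_greenOpY hl)
      (two_mul_sq_norm_greenOpY_le hl) isSymmetric_sinY hz

lemma isResolventBound_of_one_lt (hl : l ≠ 0) (hβ : β ≠ 0) {μ : ℝ} (hμ : 1 < |μ|) :
    IsResolventBound l β (Complex.I * (β * μ : ℝ)) (2 / (|β| * (|μ| - 1))) :=
  fun g => norm_le_norm_pencil_of_one_lt β g (isSymmetric_greenOpY hl)
    (two_mul_sq_norm_greenOpY_le hl) norm_sinY_le hβ hμ

lemma isCompactOperator_pencil_add_one (β : ℝ) (z : ℂ) :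
    IsCompactOperator (pencil (greenOpY l) (sinY l) β z + 1 : spaceY l →L[ℂ] spaceY l) := by
  rw [pencil, sub_add_cancel]
  have compact := isCompactOperator_greenOpY l
  exact (compact.smul z).sub
    (((compact.sub (compact.comp_clm (greenOpY l))).clm_comp (sinY l)).smul _)

lemma exists_isBoundedInverse_shift_opQL (hl : l ≠ 0) (α : ℝ)
    (h : IsResolventBound l (α * l) z M) :
    ∃ R : spaceY l →L[ℂ] spaceY l, IsBoundedInverse (shift z (opQL α l)) R ∧
      ∀ N, 0 ≤ N → IsResolventBound l (α * l) z N → ‖R‖ ≤ N := by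
  refine exists_isBoundedInverse (isCompactOperator_pencil_add_one (α * l) z) (fun g hg => ?_)
    (fun _ => mem_shift_domain.trans (mem_opQL_domain_iff hl α)) fun g hu => ?_
  · refine (map_eq_zero_iff _ (greenOpY_injective hl)).1 ?_
    simpa [hg] using h g
  · rw [shift_apply z (opQL α l) (mem_shift_domain.1 hu), opQL_greenOpY hl, pencil_apply]
    push_cast
    simp only [mul_assoc]
    abel

lemma exists_isResolventBound_of_re_le (hl : l ≠ 0) (hM : 0 < M)
    (h : ∀ lam : ℝ, IsResolventBound l β (Complex.I * lam) M) (hz : z.re ≤ 1 / (2 * M)) :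
    ∃ N, IsResolventBound l β z N := by
  rcases le_total z.re 0 with re_nonpos | re_nonneg
  · exact ⟨1, isResolventBound_one hl β re_nonpos⟩
  · refine ⟨2 * M, (h z.im).of_norm_sub_le hM.le ?_⟩
    have sub_eq : z - Complex.I * z.im = z.re := by
      linear_combination -(Complex.re_add_im z)
    rw [sub_eq, Complex.norm_of_nonneg re_nonneg]
    rw [le_div_iff₀ (by positivity)] at hz
    linarith

lemma re_le_of_mem_opSpectrum_opQL (hl : l ≠ 0) {α : ℝ} {ζ : ℂ} (hM : 0 < M)
    (h : ∀ lam : ℝ, IsResolventBound l (α * l) (Complex.I * lam) M)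
    (hζ : ζ ∈ opSpectrum (opQL α l)) : ζ.re ≤ -(1 / (2 * M)) := by
  by_contra! hlt
  obtain ⟨N, hN⟩ := exists_isResolventBound_of_re_le (z := -ζ) hl hM h
    (by simpa using (neg_lt.1 hlt).le)
  obtain ⟨R, isBoundedInverse, -⟩ := exists_isBoundedInverse_shift_opQL hl α hN
  exact isBoundedInverse.notMem_opSpectrum hζ

end Resolvent

section Estimates

lemma exists_isResolventBound_layerWidth_of_ne_zero : ∃ C b₀ : ℝ, 2 ≤ C ∧ 1 ≤ b₀ ∧
    ∀ {l : ℤ} {β μ : ℝ}, l ≠ 0 → b₀ ≤ |β| → μ ≠ 0 → |μ| ≤ 1 + 1 / |β| ^ (1 / 2 : ℝ) →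
      IsResolventBound l β (Complex.I * (β * μ : ℝ)) (C * layerWidth |β| |μ| ^ 2) := by
  obtain ⟨η, η_pos, η_le, vorticity_bound⟩ := exists_vorticity_bound
  have one_le : 1 ≤ 1 / η ^ 4 := one_le_one_div (by positivity) (pow_le_one₀ η_pos.le η_le)
  have two_le : 2 ≤ 4 / η ^ 2 := by
    rw [le_div_iff₀ (by positivity)]
    nlinarith
  refine ⟨4 / η ^ 2, 1 / η ^ 4, two_le, one_le, fun {l β μ} hl hβ hμ hμ1 => ?_⟩
  have b_pos : 0 < |β| := one_pos.trans_le (one_le.trans hβ)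
  refine norm_greenOpY_le_of_finite β _ fun g s hs => ?_
  have hs' : ∀ n ∉ insert 0 s, coeff n (g : L2T) = 0 := fun n hn =>
    hs n fun h => hn (Finset.mem_insert_of_mem h)
  have width_balance : |β| * (layerWidth |β| |μ| * √(layerDepth |β| |μ|)
      * layerWidth |β| |μ| ^ 2) = 1 := by
    linear_combination mul_layerWidth_pow_three b_pos (μ := |μ|)
  have bound := vorticity_bound hμ
    (isLayer_layerWidth (one_le.trans hβ) (abs_pos.2 hμ) hμ1) (layerWidth_le b_pos η_pos hβ)
    width_balance (isVorticitySol_force hl hμ β (Finset.mem_insert_self 0 s) hs')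
  rw [periodNorm_partialSum_greenOp hl hs', periodNorm_force hl β μ hs'] at bound
  have bound' : η ^ 2 / 4 * ‖greenOpY l g‖ ≤
      ‖pencil (greenOpY l) (sinY l) β (Complex.I * (β * μ : ℝ)) g‖ * layerWidth |β| |μ| ^ 2 :=
    le_of_mul_le_mul_left (by linarith) (sqrt_pos.2 two_pi_pos)
  have := mul_le_mul_of_nonneg_left bound' (by positivity : 0 ≤ 4 / η ^ 2)
  rw [← mul_assoc, show 4 / η ^ 2 * (η ^ 2 / 4) = 1 by field_simp, one_mul] at this
  linarith

lemma exists_isResolventBound_layerWidth : ∃ C b₀ : ℝ, 2 ≤ C ∧ 1 ≤ b₀ ∧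
    ∀ {l : ℤ} {β μ : ℝ}, l ≠ 0 → b₀ ≤ |β| → |μ| ≤ 1 + 1 / |β| ^ (1 / 2 : ℝ) →
      IsResolventBound l β (Complex.I * (β * μ : ℝ)) (C * layerWidth |β| |μ| ^ 2) := by
  obtain ⟨C, b₀, hC, hb₀, bound⟩ := exists_isResolventBound_layerWidth_of_ne_zero
  refine ⟨C, b₀, hC, hb₀, fun {l β μ} hl hβ hμ g => ?_⟩
  rcases ne_or_eq μ 0 with h0 | rfl
  · exact bound hl hβ h0 hμ g
  have b_pos : 0 < |β| := one_pos.trans_le (hb₀.trans hβ)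
  have continuous_bound : Continuous fun ν : ℝ => C * layerWidth |β| |ν| ^ 2
      * ‖pencil (greenOpY l) (sinY l) β (Complex.I * (β * ν : ℝ)) g‖ := by
    have := (continuous_layerWidth b_pos).comp continuous_abs
    simp only [pencil_apply]
    fun_prop
  refine ge_of_tendsto ((continuous_bound.tendsto 0).mono_left
    (nhdsWithin_le_nhds (s := {0}ᶜ))) ?_
  have eventually_lt : ∀ᶠ ν : ℝ in nhds 0, |ν| < 1 :=
    continuous_abs.tendsto' 0 0 abs_zero |>.eventually (gt_mem_nhds one_pos)
  filter_upwards [self_mem_nhdsWithin, eventually_lt.filter_mono nhdsWithin_le_nhds] with ν hν hν1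
  exact bound hl hβ hν (hν1.le.trans (le_add_of_nonneg_right (by positivity))) g

lemma exists_isResolventBound : ∃ C b₀ : ℝ, 0 < C ∧ 0 < b₀ ∧
    ∀ {l : ℤ} {β : ℝ}, l ≠ 0 → b₀ ≤ |β| → ∀ μ : ℝ,
      (1 < |μ| → IsResolventBound l β (Complex.I * (β * μ : ℝ)) (C / (|β| * (|μ| - 1)))) ∧
      IsResolventBound l β (Complex.I * (β * μ : ℝ)) (C / |β| ^ (1 / 2 : ℝ)) ∧
      (|μ| ≤ 1 - 1 / |β| ^ (1 / 2 : ℝ) → IsResolventBound l β (Complex.I * (β * μ : ℝ))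
        (C / (|β| ^ (2 / 3 : ℝ) * (1 - |μ|) ^ (1 / 3 : ℝ)))) := by
  obtain ⟨C, b₀, hC, hb₀, layer_bound⟩ := exists_isResolventBound_layerWidth
  refine ⟨C, b₀, by linarith, by linarith, fun {l β} hl hβ μ => ?_⟩
  have b_pos : 0 < |β| := one_pos.trans_le (hb₀.trans hβ)
  have ε_pos : 0 < 1 / |β| ^ (1 / 2 : ℝ) := by positivity
  have outer_bound (h : 1 < |μ|) : IsResolventBound l β (Complex.I * (β * μ : ℝ))
      (C / (|β| * (|μ| - 1))) :=
    (isResolventBound_of_one_lt hl (abs_pos.1 b_pos) h).mono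
      (div_le_div_of_nonneg_right hC (mul_nonneg b_pos.le (sub_nonneg.2 h.le)))
  refine ⟨outer_bound, ?_, fun h => ?_⟩
  · rcases le_or_gt |μ| (1 + 1 / |β| ^ (1 / 2 : ℝ)) with h | h
    · refine (layer_bound hl hβ h).mono ?_
      rw [div_eq_mul_one_div]
      exact mul_le_mul_of_nonneg_left (layerWidth_sq_le b_pos) (by linarith)
    · refine (outer_bound (by linarith)).mono ?_
      refine div_le_div_of_nonneg_left (by linarith) (by positivity) ?_
      calc |β| ^ (1 / 2 : ℝ) = |β| * (1 / |β| ^ (1 / 2 : ℝ)) := by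
            rw [mul_one_div, eq_div_iff (by positivity), ← rpow_add b_pos]
            norm_num
        _ ≤ |β| * (|μ| - 1) := mul_le_mul_of_nonneg_left (by linarith) b_pos.le
  · rw [div_eq_mul_one_div, ← layerWidth_sq_eq b_pos h]
    exact layer_bound hl hβ (by linarith)

end Estimates

end Kolmogorov

end

open Kolmogorov in
theorem mainTheorem1_general :
    ∃ c C b₀ : ℝ, 0 < c ∧ 0 < C ∧ 0 < b₀ ∧
      ∀ (α : ℝ) (l : ℤ), l ≠ 0 → b₀ ≤ |α * l| →
        (∀ ζ ∈ opSpectrum (opQL α l), ζ.re ≤ -c * |α * l| ^ (1 / 2 : ℝ)) ∧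
        ∀ lam μ : ℝ, μ = lam / (α * l) →
          ∃ R : spaceY l →L[ℂ] spaceY l,
            IsBoundedInverse (shift (Complex.I * lam) (opQL α l)) R ∧
            (1 < |μ| → ‖R‖ ≤ C / (|α * l| * (|μ| - 1))) ∧
            ‖R‖ ≤ C / |α * l| ^ (1 / 2 : ℝ) ∧
            (|μ| ≤ 1 - 1 / |α * l| ^ (1 / 2 : ℝ) →
              ‖R‖ ≤ C / (|α * l| ^ (2 / 3 : ℝ) * (1 - |μ|) ^ (1 / 3 : ℝ))) := by
  obtain ⟨C, b₀, hC, hb₀, bound⟩ := exists_isResolventBound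
  refine ⟨1 / (2 * C), C, b₀, by positivity, hC, hb₀, fun α l hl hb => ?_⟩
  have b_pos : 0 < |α * l| := hb₀.trans_le hb
  have ε_pos : 0 < 1 / |α * l| ^ (1 / 2 : ℝ) := by positivity
  have mul_div (lam : ℝ) : α * l * (lam / (α * l)) = lam := mul_div_cancel₀ lam (abs_pos.1 b_pos)
  refine ⟨fun ζ hζ => ?_, fun lam μ hμ => ?_⟩
  · have uniform_bound (lam : ℝ) := (bound hl hb (lam / (α * l))).2.1
    simp only [mul_div] at uniform_bound
    refine (re_le_of_mem_opSpectrum_opQL hl (by positivity) uniform_bound hζ).trans_eq ?_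
    field_simp
  · obtain rfl : lam = α * l * μ := by rw [hμ, mul_div]
    obtain ⟨outer, uniform, inner⟩ := bound hl hb μ
    obtain ⟨R, hR, norm_le⟩ := exists_isBoundedInverse_shift_opQL hl α uniform
    refine ⟨R, hR, fun h => norm_le _ ?_ (outer h), norm_le _ (by positivity) uniform,
      fun h => norm_le _ ?_ (inner h)⟩
    · exact div_nonneg hC.le (mul_nonneg b_pos.le (by linarith))
    · exact div_nonneg hC.le (mul_nonneg (by positivity) (Real.rpow_nonneg (by linarith) _))

theorem mainTheorem1 :
    ∃ c C α₀ : ℝ, 0 < c ∧ 0 < C ∧ 0 < α₀ ∧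
      ∀ α : ℝ, α₀ ≤ |α| → ∀ l : ℤ, l ≠ 0 →
        (∀ ζ ∈ Kolmogorov.opSpectrum (Kolmogorov.opQL α l),
          ζ.re ≤ -c * |α * l| ^ (1 / 2 : ℝ)) ∧
        ∀ lam μ : ℝ, μ = lam / (α * l) →
          ∃ R : Kolmogorov.spaceY l →L[ℂ] Kolmogorov.spaceY l,
            Kolmogorov.IsBoundedInverse
              (Kolmogorov.shift (Complex.I * lam) (Kolmogorov.opQL α l)) R ∧
            (1 + 1 / |α * l| ^ (1 / 2 : ℝ) < |μ| →
              ‖R‖ ≤ C / (|α * l| * (|μ| - 1))) ∧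
            (1 - 1 / |α * l| ^ (1 / 2 : ℝ) < |μ| → |μ| ≤ 1 + 1 / |α * l| ^ (1 / 2 : ℝ) →
              ‖R‖ ≤ C / |α * l| ^ (1 / 2 : ℝ)) ∧
            (|μ| ≤ 1 - 1 / |α * l| ^ (1 / 2 : ℝ) →
              ‖R‖ ≤ C / (|α * l| ^ (2 / 3 : ℝ) * (1 - |μ|) ^ (1 / 3 : ℝ))) := by
  obtain ⟨c, C, b₀, hc, hC, hb₀, main⟩ := mainTheorem1_general
  refine ⟨c, C, b₀, hc, hC, hb₀, fun α hα l hl => ?_⟩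
  have b_le : b₀ ≤ |α * l| := by
    rw [abs_mul]
    exact hα.trans (le_mul_of_one_le_right (abs_nonneg α) (mod_cast Int.one_le_abs hl))
  refine (main α l hl b_le).imp_right fun resolvent lam μ hμ => ?_
  obtain ⟨R, hR, outer, uniform, inner⟩ := resolvent lam μ hμ
  have ε_nonneg : 0 ≤ 1 / |α * l| ^ (1 / 2 : ℝ) := by positivity
  exact ⟨R, hR, fun h => outer (by linarith), fun _ _ => uniform, inner⟩
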